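/- Let $(X,\mathsf d,\mathfrak m)$ be a metric measure space: $(X,\mathsf d)$ is a complete separable metric space and $\mathfrak m\neq 0$ is a nonnegative Borel measure that is finite on bounded sets. For $p\in(1,\infty)$ let $q=p/(p-1)$. \emph{Definitions.} For a continuous curve $\gamma:[0,1]\to X$ write $\gamma\in AC^q$ if there is $g\in L^q(0,1)$ with $\mathsf d(\gamma_t,\gamma_s)\le\int_s^t g$ for all $s\le t$; then $|\dot\gamma_t|=\lim_{h\downarrow0}\mathsf d(\gamma_{t+h},\gamma_t)/h$ exists for a.e. $t$. A \emph{$q$-test plan} is a Borel probability measure $\pi$ on $C([0,1],X)$ such that $(e_t)_\sharp\pi\le C\mathfrak m$ for all $t\in[0,1]$ and some constant $C$, where $e_t(\gamma)=\gamma_t$, and $\iint_0^1|\dot\gamma_t|^q\,dt\,d\pi<\infty$ (the inner integral being $+\infty$ if $\gamma\notin AC^q$). A Borel function $f:X\to\mathbb R$ is in $S^p(X)$ if there is $0\le G\in L^p(\mathfrak m)$, a \emph{$p$-weak upper gradient} of $f$, with $$\int|f(\gamma_1)-f(\gamma_0)|\,d\pi\le\iint_0^1G(\gamma_t)|\dot\gamma_t|\,dt\,d\pi\qquad(\ast)$$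 for every $q$-test plan $\pi$; $|Df|_p$ is the $p$-weak upper gradient of least $L^p$ norm. $W^{1,p}(X)=S^p(X)\cap L^p(\mathfrak m)$, with norm $(\|f\|_{L^p}^p+\||Df|_p\|_{L^p}^p)^{1/p}$. $L^p_{loc}$ means $L^p$ on every bounded set. A Borel function $f:X\to\mathbb R$ is in $S^p_{loc}(X)$ if there is $0\le G\in L^p_{loc}(\mathfrak m)$ such that for every $k>0$ and every Lipschitz $\eta$ with bounded support, $\eta f^k\in S^p(X)$, where $f^k=k\wedge(f\vee-k)$, and $|D(\eta f^k)|_p\le|\eta|G$ a.e. on $\{\eta=1\}$; then $|Df|_p\in L^p_{loc}$ is determined by $|Df|_p=|D(\eta f^k)|_p$ a.e. on $\{\eta=1\}\cap\{|f|<k\}$ for all such $\eta,k$. $\mathrm{OptGeo}_q(\mu_0,\mu_1)$ is the set of Borel probability measures $\pi$ on $C([0,1],X)$ concentrated on constant speed minimizing geodesics such that $(e_0,e_1)_\sharp\pi$ is an optimal coupling of $\mu_0,\mu_1$ for the cost $\mathsf d^q$. A \emph{profile function} for $q\in(1,\infty)$ is a map $C_q:(0,\infty)\to[1,\infty)$ such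 that for all $D>0$ and all probability measures $\mu_i=\rho_i\mathfrak m$, $\rho_i\in L^\infty(\mathfrak m)$ ($i=0,1$), with $\mathrm{diam}(\mathrm{supp}\,\mu_0\cup\mathrm{supp}\,\mu_1)<D$ there is $\pi\in\mathrm{OptGeo}_q(\mu_0,\mu_1)$ with $(e_t)_\sharp\pi=\rho_t\mathfrak m$ and $\|\rho_t\|_{L^\infty}\le C_q(D)\,(\|\rho_0\|_{L^\infty}\vee\|\rho_1\|_{L^\infty})$ for all $t\in[0,1]$. $X$ is a \emph{BIP-space} (has the Bounded Interpolation Property) if a profile function exists for every $q\in(1,\infty)$. Given a profile function $C_q$, $\mathsf{Geod}_q(X)$ is the set of all $\pi$ for which there are $D>0$ and probability measures $\mu_i=\rho_i\mathfrak m$, $\rho_i\in L^\infty(\mathfrak m)$, with $\mathrm{diam}(\mathrm{supp}\,\mu_0\cup\mathrm{supp}\,\mu_1)\le D$, $\pi\in\mathrm{OptGeo}_q(\mu_0,\mu_1)$ and $(e_t)_\sharp\pi\le C_q(D)(\|\rho_0\|_{L^\infty}\vee\|\rho_1\|_{L^\infty})\,\mathfrak m$ for all $t\in[0,1]$. \emph{Theorem.}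 (1) Let $X$ be a BIP-space and $p_1,p_2\in(1,\infty)$. If $f\in S^{p_1}_{loc}(X)$ and $|Df|_{p_1}\in L^{p_2}_{loc}(\mathfrak m)$, then $f\in S^{p_2}_{loc}(X)$ and $|Df|_{p_1}=|Df|_{p_2}$ $\mathfrak m$-a.e. (No doubling assumption is made.) (2) Let $X$ be a BIP-space, $p\in(1,\infty)$, $C_q$ a profile function for $q=p/(p-1)$, $f:X\to\mathbb R$ Borel and $0\le G\in L^p(\mathfrak m)$. Then $f\in S^p(X)$ with $p$-weak upper gradient $G$ if and only if $(\ast)$ holds for every $\pi\in\mathsf{Geod}_q(X)$. (3) On an arbitrary metric measure space consider, for all $p_1,p_2\in(1,\infty)$: a) $W^{1,p_1}(X)\cap W^{1,p_2}(X)$ is dense in both $W^{1,p_1}(X)$ and $W^{1,p_2}(X)$; b) $|Df|_{p_1}=|Df|_{p_2}$ $\mathfrak m$-a.e. for all $f\in W^{1,p_1}(X)\cap W^{1,p_2}(X)$; c) every $f\in W^{1,p_1}(X)$ with $f,|Df|_{p_1}\in L^{p_2}(\mathfrak m)$ belongs to $W^{1,p_2}(X)$. The conclusion of (1), for all $p_1,p_2\in(1,\infty)$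 and all $f$, holds if and only if b) and c) hold for all $p_1,p_2\in(1,\infty)$. Hence $X$ has $p$-independent weak upper gradients in the strong sense, i.e. a), b), c) hold for all $p_1,p_2$, if and only if a) holds for all $p_1,p_2$ and the conclusion of (1) holds for all $p_1,p_2$ and all $f$. -/

import Mathlib

open MeasureTheory Set Filter Topology
open scoped ENNReal NNReal unitInterval

noncomputable section

namespace BIPSpaces

variable {X : Type*} [MetricSpace X] [MeasurableSpace X]

/-- Continuous curves `[0,1] → X`, with the uniform distance. -/
abbrev Curve (X : Type*) [MetricSpace X] : Type _ := C(I, X)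

instance instMeasurableSpaceCurve (X : Type*) [MetricSpace X] : MeasurableSpace C(I, X) :=
  borel _

instance instBorelSpaceCurve (X : Type*) [MetricSpace X] : BorelSpace C(I, X) := ⟨rfl⟩

/-- Finiteness of a measure on bounded sets. -/
def BoundedlyFinite (m : Measure X) : Prop :=
  ∀ s : Set X, Bornology.IsBounded s → m s < ∞

/-! ### Absolutely continuous curves, speed, kinetic energy -/

/-- `γ ∈ AC^q([0,1], X)`. -/
def IsACq (q : ℝ) (γ : Curve X) : Prop :=
  ∃ g : I → ℝ, MemLp g (ENNReal.ofReal q) volume ∧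
    ∀ s t : I, s ≤ t → dist (γ t) (γ s) ≤ ∫ r in Icc s t, g r

/-- The metric speed `|γ̇_t| = lim_{h ↓ 0} d(γ_{t+h}, γ_t) / h`. The limit exists for a.e. `t` when
`γ` is absolutely continuous; the upper limit gives it a value for every `t`. -/
def speed (γ : Curve X) (t : I) : ℝ≥0∞ :=
  limsup (fun s : I => edist (γ s) (γ t) / edist s t) (𝓝[>] t)

open Classical in
/-- `∫₀¹ |γ̇_t|^q dt` on `AC^q` curves, `+∞` on the others. -/
def kineticEnergy (q : ℝ) (γ : Curve X) : ℝ≥0∞ :=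
  if IsACq q γ then ∫⁻ t : I, speed γ t ^ q else ∞

/-! ### Test plans and the Sobolev class -/

/-- `π` is a `q`-test plan. -/
structure IsTestPlan (m : Measure X) (q : ℝ) (π : Measure (Curve X)) : Prop where
  isProbabilityMeasure : IsProbabilityMeasure π
  compression : ∃ C : ℝ≥0, ∀ t : I, π.map (fun γ => γ t) ≤ C • m
  energy : ∫⁻ γ, kineticEnergy q γ ∂π < ∞

/-- `∫ |f(γ₁) - f(γ₀)| dπ ≤ ∬₀¹ G(γ_t) |γ̇_t| dt dπ`. -/
def PlanInequality (π : Measure (Curve X)) (f G : X → ℝ) : Prop :=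
  ∫⁻ γ, ENNReal.ofReal |f (γ 1) - f (γ 0)| ∂π ≤
    ∫⁻ γ, (∫⁻ t : I, ENNReal.ofReal (G (γ t)) * speed γ t) ∂π

/-- `G` is a `p`-weak upper gradient of `f`. -/
structure IsWeakUpperGradient (m : Measure X) (p : ℝ) (f G : X → ℝ) : Prop where
  nonneg : 0 ≤ᵐ[m] G
  memLp : MemLp G (ENNReal.ofReal p) m
  le : ∀ π : Measure (Curve X), IsTestPlan m p.conjExponent π → PlanInequality π f G

/-- `f ∈ S^p(X)`. -/
def InSobolevClass (m : Measure X) (p : ℝ) (f : X → ℝ) : Prop :=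
  Measurable f ∧ ∃ G, IsWeakUpperGradient m p f G

/-- `G` has least `L^p` norm among the `p`-weak upper gradients of `f`. -/
def IsMinimalWeakUpperGradient (m : Measure X) (p : ℝ) (f G : X → ℝ) : Prop :=
  IsWeakUpperGradient m p f G ∧
    ∀ G', IsWeakUpperGradient m p f G' →
      eLpNorm G (ENNReal.ofReal p) m ≤ eLpNorm G' (ENNReal.ofReal p) m

open Classical in
/-- `|Df|_p` for `f ∈ S^p(X)`: a representative of the minimal `p`-weak upper gradient. -/
def minGrad (m : Measure X) (p : ℝ) (f : X → ℝ) : X → ℝ :=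
  if h : ∃ G, IsMinimalWeakUpperGradient m p f G then h.choose else 0

/-! ### The local Sobolev class -/

/-- `G ∈ L^p_loc(m)`: the restriction of `G` to every bounded set is in `L^p`. -/
def MemLpLoc (m : Measure X) (p : ℝ) (G : X → ℝ) : Prop :=
  ∀ s : Set X, Bornology.IsBounded s → MemLp G (ENNReal.ofReal p) (m.restrict s)

/-- Lipschitz functions with bounded support. -/
def IsLipBS (η : X → ℝ) : Prop :=
  (∃ K : ℝ≥0, LipschitzWith K η) ∧ Bornology.IsBounded (Function.support η)

/-- `η · f^k` with `f^k = k ∧ (f ∨ -k)`. -/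
def cutoff (η : X → ℝ) (k : ℝ) (f : X → ℝ) : X → ℝ :=
  fun x => η x * min k (max (f x) (-k))

/-- `f ∈ S^p_loc(X)`. -/
def InSobolevClassLoc (m : Measure X) (p : ℝ) (f : X → ℝ) : Prop :=
  Measurable f ∧ ∃ G : X → ℝ, MemLpLoc m p G ∧ 0 ≤ᵐ[m] G ∧
    ∀ k : ℝ, 0 < k → ∀ η : X → ℝ, IsLipBS η →
      InSobolevClass m p (cutoff η k f) ∧
      ∀ᵐ x ∂m, η x = 1 → minGrad m p (cutoff η k f) x ≤ |η x| * G x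

/-- The property that characterizes `|Df|_p` up to `m`-null sets, for `f ∈ S^p_loc(X)`. -/
def IsLocalGradient (m : Measure X) (p : ℝ) (f G : X → ℝ) : Prop :=
  MemLpLoc m p G ∧ ∀ k : ℝ, 0 < k → ∀ η : X → ℝ, IsLipBS η →
    ∀ᵐ x ∂m, η x = 1 → |f x| < k → G x = minGrad m p (cutoff η k f) x

open Classical in
/-- `|Df|_p` for `f ∈ S^p_loc(X)`. -/
def localGrad (m : Measure X) (p : ℝ) (f : X → ℝ) : X → ℝ :=
  if h : ∃ G, IsLocalGradient m p f G then h.choose else 0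

/-! ### Sobolev spaces and `p`-independence -/

/-- `f ∈ W^{1,p}(X)`. -/
def InSobolevSpace (m : Measure X) (p : ℝ) (f : X → ℝ) : Prop :=
  InSobolevClass m p f ∧ MemLp f (ENNReal.ofReal p) m

/-- The norm of `W^{1,p}(X)`. -/
def sobolevNorm (m : Measure X) (p : ℝ) (f : X → ℝ) : ℝ≥0∞ :=
  (eLpNorm f (ENNReal.ofReal p) m ^ p + eLpNorm (minGrad m p f) (ENNReal.ofReal p) m ^ p) ^ (1 / p)

/-- For all `p₁, p₂ ∈ (1,∞)`, `W^{1,p₁} ∩ W^{1,p₂}` is dense in `W^{1,p₁}` (and, by exchanging the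
exponents, in `W^{1,p₂}`). -/
def DenseIntersections (m : Measure X) : Prop :=
  ∀ p₁ p₂ : ℝ, 1 < p₁ → 1 < p₂ → ∀ f : X → ℝ, InSobolevSpace m p₁ f → ∀ ε : ℝ≥0∞, 0 < ε →
    ∃ g : X → ℝ, InSobolevSpace m p₁ g ∧ InSobolevSpace m p₂ g ∧ sobolevNorm m p₁ (f - g) < ε

/-- For all `p₁, p₂ ∈ (1,∞)`, `|Df|_{p₁} = |Df|_{p₂}` for `f ∈ W^{1,p₁} ∩ W^{1,p₂}`. -/
def GradientsAgree (m : Measure X) : Prop :=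
  ∀ p₁ p₂ : ℝ, 1 < p₁ → 1 < p₂ → ∀ f : X → ℝ, InSobolevSpace m p₁ f → InSobolevSpace m p₂ f →
    minGrad m p₁ f =ᵐ[m] minGrad m p₂ f

/-- For all `p₁, p₂ ∈ (1,∞)`, `f ∈ W^{1,p₁}` with `f, |Df|_{p₁} ∈ L^{p₂}` is in `W^{1,p₂}`. -/
def SobolevUpgrade (m : Measure X) : Prop :=
  ∀ p₁ p₂ : ℝ, 1 < p₁ → 1 < p₂ → ∀ f : X → ℝ, InSobolevSpace m p₁ f →
    MemLp f (ENNReal.ofReal p₂) m → MemLp (minGrad m p₁ f) (ENNReal.ofReal p₂) m →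
      InSobolevSpace m p₂ f

/-- `p`-independent weak upper gradients in the strong sense. -/
def StrongPIndependence (m : Measure X) : Prop :=
  DenseIntersections m ∧ GradientsAgree m ∧ SobolevUpgrade m

/-- For all `p₁, p₂ ∈ (1,∞)`, `f ∈ S^{p₁}_loc` with `|Df|_{p₁} ∈ L^{p₂}_loc` is in `S^{p₂}_loc`, with
the same minimal weak upper gradient. -/
def LocalPIndependence (m : Measure X) : Prop :=
  ∀ p₁ p₂ : ℝ, 1 < p₁ → 1 < p₂ → ∀ f : X → ℝ,
    InSobolevClassLoc m p₁ f → MemLpLoc m p₂ (localGrad m p₁ f) →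
      InSobolevClassLoc m p₂ f ∧ localGrad m p₁ f =ᵐ[m] localGrad m p₂ f

/-! ### Optimal geodesic plans and the Bounded Interpolation Property -/

/-- Constant speed length minimizing geodesics on `[0,1]`. -/
def IsGeodesic (γ : Curve X) : Prop :=
  ∀ s t : I, dist (γ s) (γ t) = |(s : ℝ) - t| * dist (γ 0) (γ 1)

/-- `α ∈ Π(μ₀, μ₁)`. -/
def IsCoupling (μ₀ μ₁ : Measure X) (α : Measure (X × X)) : Prop :=
  IsProbabilityMeasure α ∧ α.map Prod.fst = μ₀ ∧ α.map Prod.snd = μ₁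

/-- `α ∈ Opt_q(μ₀, μ₁)`. -/
def IsOptimalPlan (q : ℝ) (μ₀ μ₁ : Measure X) (α : Measure (X × X)) : Prop :=
  IsCoupling μ₀ μ₁ α ∧ ∀ β, IsCoupling μ₀ μ₁ β →
    ∫⁻ z, edist z.1 z.2 ^ q ∂α ≤ ∫⁻ z, edist z.1 z.2 ^ q ∂β

/-- `π ∈ OptGeo_q(μ₀, μ₁)`. -/
structure IsOptGeo (q : ℝ) (μ₀ μ₁ : Measure X) (π : Measure (Curve X)) : Prop where
  isProbabilityMeasure : IsProbabilityMeasure π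
  geodesic : ∀ᵐ γ ∂π, IsGeodesic γ
  optimal : IsOptimalPlan q μ₀ μ₁ (π.map (fun γ => (γ 0, γ 1)))

/-- `‖dμ/dm‖_{L^∞(m)}`, for `μ ≪ m`. -/
def densityNorm (m μ : Measure X) : ℝ≥0∞ := essSup (μ.rnDeriv m) m

/-- `μ` is a probability measure, absolutely continuous with bounded density. -/
structure HasBoundedDensity (m μ : Measure X) : Prop where
  isProbabilityMeasure : IsProbabilityMeasure μ
  absolutelyContinuous : μ ≪ m
  bounded : densityNorm m μ < ∞

/-- `C` is a profile function of `m` for the exponent `q` in the bounded interpolation property. -/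
def HasBIPProfile (m : Measure X) (q : ℝ) (C : ℝ → ℝ) : Prop :=
  ∀ D : ℝ, 0 < D → 1 ≤ C D ∧
    ∀ μ₀ μ₁ : Measure X, HasBoundedDensity m μ₀ → HasBoundedDensity m μ₁ →
      Metric.ediam (μ₀.support ∪ μ₁.support) < ENNReal.ofReal D →
      ∃ π : Measure (Curve X), IsOptGeo q μ₀ μ₁ π ∧
        ∀ t : I, π.map (fun γ => γ t) ≪ m ∧
          densityNorm m (π.map (fun γ => γ t)) ≤
            ENNReal.ofReal (C D) * max (densityNorm m μ₀) (densityNorm m μ₁)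

/-- The bounded interpolation property. -/
def IsBIPSpace (m : Measure X) : Prop :=
  ∀ q : ℝ, 1 < q → ∃ C : ℝ → ℝ, HasBIPProfile m q C

/-- `π ∈ Geod_q(X)`, where `C` is the profile function for `q`. -/
def InGeod (m : Measure X) (q : ℝ) (C : ℝ → ℝ) (π : Measure (Curve X)) : Prop :=
  ∃ (D : ℝ) (μ₀ μ₁ : Measure X), 0 < D ∧ HasBoundedDensity m μ₀ ∧ HasBoundedDensity m μ₁ ∧
    Metric.ediam (μ₀.support ∪ μ₁.support) ≤ ENNReal.ofReal D ∧ IsOptGeo q μ₀ μ₁ π ∧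
    ∀ t : I, π.map (fun γ => γ t) ≤
      (ENNReal.ofReal (C D) * max (densityNorm m μ₀) (densityNorm m μ₁)) • m

end BIPSpaces

end

open BIPSpaces

noncomputable section

namespace BIPSpaces

/-! ### Functions of time with an absolutely continuous representative -/

section CurveBound

/-! The bridge between plans and curves is `HasCurveBound`. Test plans remain test plans when
conditioned on a set of curves or when their curves are stopped outside a time interval. Hence, for
G in L^p, (∗) for all test plans amounts to a statement about single curves: along almost every
curve of every test plan, f∘γ has an absolutely continuous representative, correct at both
endpoints, with derivative at most G(γ_t)|γ̇_t|. Such bounds pass to countable infima, to products,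
and to the times where two functions agree. This yields existence, pointwise minimality and locality
of |Df|_p and a Leibniz rule, and with them the calculus of the local class.

The core is (2), in `HasBIPProfile.isWeakUpperGradient`. Cut a q-test plan π living in a ball into
short time steps, and on each step [s,t] join (e_s)π to (e_t)π by a plan π' of Geod_q. The profile
bounds the compression of π' independently of the step, and optimality bounds its q-energy by that
of π. Then (∗) for π' and Young's inequality control the growth of ∫F(γ_t)dπ, with F a positive part
of f + K, by an integral of G^p along π' and the energy. The integral of G^p along π' is compared
with the one along π by replacing G^p with a Lipschitz function close to it in L¹(m). Only the
marginals at s and t enter, so the pieces π' are never glued, and the estimates telescope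
(`interpolation_step`, `lintegral_eval_le_add_youngAlong`). Sending the step and then the L¹ error
to zero, conditioning on sets of curves and optimizing over rational Young weights gives the bound
along almost every curve of π.

Geodesics of a plan in Geod_q have bounded length, so the plan is a test plan for every exponent
(`InGeod.isTestPlan`). Thus a p₁-gradient lying in L^{p₂} satisfies (∗) on Geod for the second
exponent, which is c) by (2); testing the minimum of the two gradients in the same way gives b).
Finally, b) and c) are equivalent to the local statement on any space: the functions ηf^k are
bounded with bounded support, so they lie in every L^p, and conversely a local function whose
gradient is globally L^p is Sobolev. -/

lemma ae_unitInterval_iff {P : ℝ → Prop} :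
    (∀ᵐ t : I, P t) ↔ ∀ᵐ x : ℝ, x ∈ Icc (0 : ℝ) 1 → P x := by
  rw [← ae_restrict_iff' measurableSet_Icc, ae_restrict_iff_subtype measurableSet_Icc]
  rfl

lemma setLIntegral_unitInterval (s t : I) (h : I → ℝ≥0∞) :
    ∫⁻ r in Icc s t, h r = ∫⁻ x in Icc (s : ℝ) t, IccExtend zero_le_one h x := by
  have := setLIntegral_subtype (μ := volume) (measurableSet_Icc (a := (0 : ℝ)) (b := 1))
    (Icc s t) (IccExtend zero_le_one h)
  simp only [IccExtend_val] at this
  rw [show (volume : Measure I) = Measure.comap Subtype.val volume from rfl, this]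
  congr 2
  ext x
  constructor
  · rintro ⟨y, hy, rfl⟩
    exact hy
  · intro hx
    exact ⟨⟨x, s.2.1.trans hx.1, hx.2.trans t.2.2⟩, hx, rfl⟩

lemma Icc_zero_one_eq_univ : Icc (0 : I) 1 = univ :=
  eq_univ_of_forall fun t => ⟨t.2.1, t.2.2⟩

/-- `F` has an absolutely continuous representative, with the same values at the endpoints, whose
derivative is bounded by `h`. -/
def HasCurveBound (F : I → ℝ) (h : I → ℝ≥0∞) : Prop :=
  ∃ u : ℝ → ℝ, AbsolutelyContinuousOnInterval u 0 1 ∧ (∀ᵐ t : I, F t = u t) ∧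
    F 0 = u 0 ∧ F 1 = u 1 ∧ ∀ᵐ t : I, ENNReal.ofReal |deriv u t| ≤ h t

lemma ofReal_abs_sub_le_lintegral_of_deriv_le {u : ℝ → ℝ}
    (hu : AbsolutelyContinuousOnInterval u 0 1) {h : I → ℝ≥0∞}
    (hd : ∀ᵐ t : I, ENNReal.ofReal |deriv u t| ≤ h t) {s t : I} (hst : s ≤ t) :
    ENNReal.ofReal |u t - u s| ≤ ∫⁻ r in Icc s t, h r := by
  have hst' : (s : ℝ) ≤ t := hst
  have hsub : uIcc (s : ℝ) t ⊆ uIcc 0 1 := by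
    rw [uIcc_of_le hst', uIcc_of_le zero_le_one]
    exact Icc_subset_Icc s.2.1 t.2.2
  have hu' := hu.mono hsub
  rw [← hu'.integral_deriv_eq_sub, intervalIntegral.integral_of_le hst',
    ← integral_Icc_eq_integral_Ioc, ← Real.enorm_eq_ofReal_abs, setLIntegral_unitInterval]
  refine (enorm_integral_le_lintegral_enorm _).trans ?_
  refine lintegral_mono_ae ?_
  rw [ae_restrict_iff' measurableSet_Icc]
  have hd' : ∀ᵐ t : I, ENNReal.ofReal |deriv u t| ≤ IccExtend zero_le_one h t := by
    simpa using hd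
  rw [ae_unitInterval_iff (P := fun x => ENNReal.ofReal |deriv u x| ≤ IccExtend zero_le_one h x)]
    at hd'
  filter_upwards [hd'] with x hx hxs
  rw [Real.enorm_eq_ofReal_abs]
  exact hx ⟨s.2.1.trans hxs.1, hxs.2.trans t.2.2⟩

lemma HasCurveBound.ofReal_abs_sub_le {F : I → ℝ} {h : I → ℝ≥0∞} (hF : HasCurveBound F h) :
    ENNReal.ofReal |F 1 - F 0| ≤ ∫⁻ r, h r := by
  obtain ⟨u, hu, -, h0, h1, hd⟩ := hF
  have := ofReal_abs_sub_le_lintegral_of_deriv_le hu hd (zero_le_one (α := I))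
  rwa [Icc_zero_one_eq_univ, Measure.restrict_univ, Icc.coe_zero, Icc.coe_one, ← h0, ← h1] at this

lemma HasCurveBound.mono_ae {F : I → ℝ} {h k : I → ℝ≥0∞} (hF : HasCurveBound F h)
    (hk : ∀ᵐ t : I, h t ≤ k t) : HasCurveBound F k := by
  obtain ⟨u, hu, hFu, h0, h1, hd⟩ := hF
  refine ⟨u, hu, hFu, h0, h1, ?_⟩
  filter_upwards [hd, hk] with t h1 h2 using h1.trans h2

lemma ae_differentiableAt_unitInterval {u : ℝ → ℝ}
    (hu : AbsolutelyContinuousOnInterval u 0 1) : ∀ᵐ t : I, DifferentiableAt ℝ u t := by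
  rw [ae_unitInterval_iff (P := fun x => DifferentiableAt ℝ u x)]
  simpa [uIcc_of_le] using hu.ae_differentiableAt

lemma eqOn_of_ae_eq_unitInterval {u v : ℝ → ℝ}
    (hu : AbsolutelyContinuousOnInterval u 0 1) (hv : AbsolutelyContinuousOnInterval v 0 1)
    (huv : ∀ᵐ t : I, u t = v t) : EqOn u v (Icc 0 1) := by
  have hu' := hu.continuousOn
  have hv' := hv.continuousOn
  rw [uIcc_of_le zero_le_one] at hu' hv'
  refine Measure.eqOn_Icc_of_ae_eq volume zero_ne_one ?_ hu' hv'
  rw [ae_unitInterval_iff (P := fun x => u x = v x)] at huv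
  exact (ae_restrict_iff' measurableSet_Icc).2 huv

lemma ae_mem_Ioo_unitInterval : ∀ᵐ t : I, (t : ℝ) ∈ Ioo (0 : ℝ) 1 := by
  rw [ae_unitInterval_iff (P := fun x => x ∈ Ioo (0 : ℝ) 1)]
  have h0 : ∀ᵐ x : ℝ, x ≠ 0 := by simp [ae_iff, measure_singleton]
  have h1 : ∀ᵐ x : ℝ, x ≠ 1 := by simp [ae_iff, measure_singleton]
  filter_upwards [h0, h1] with x hx0 hx1 hx
  exact ⟨lt_of_le_of_ne hx.1 hx0.symm, lt_of_le_of_ne hx.2 hx1⟩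

lemma ae_deriv_eq_of_ae_eq_unitInterval {u v : ℝ → ℝ}
    (hu : AbsolutelyContinuousOnInterval u 0 1) (hv : AbsolutelyContinuousOnInterval v 0 1)
    (huv : ∀ᵐ t : I, u t = v t) : ∀ᵐ t : I, deriv u t = deriv v t := by
  have h := eqOn_of_ae_eq_unitInterval hu hv huv
  filter_upwards [ae_mem_Ioo_unitInterval] with t ht
  refine EventuallyEq.deriv_eq ?_
  filter_upwards [Icc_mem_nhds ht.1 ht.2] with x hx using h hx

/-- The continuous representatives for different indices agree almost everywhere, hence on all of
[0,1], so one derivative obeys all the bounds; countability allows a common null set. -/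
lemma HasCurveBound.iInf {ι : Type*} [Countable ι] [Nonempty ι] {F : I → ℝ}
    {h : ι → I → ℝ≥0∞} (hF : ∀ i, HasCurveBound F (h i)) :
    HasCurveBound F (fun t => ⨅ i, h i t) := by
  choose u hu hFu h0 h1 hd using hF
  let i₀ : ι := Classical.arbitrary ι
  refine ⟨u i₀, hu i₀, hFu i₀, h0 i₀, h1 i₀, ?_⟩
  have key : ∀ i, ∀ᵐ t : I, ENNReal.ofReal |deriv (u i₀) t| ≤ h i t := by
    intro i
    have : ∀ᵐ t : I, u i₀ t = u i t := by
      filter_upwards [hFu i₀, hFu i] with t a b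
      rw [← a, b]
    filter_upwards [ae_deriv_eq_of_ae_eq_unitInterval (hu i₀) (hu i) this, hd i] with t a b
    rwa [a]
  filter_upwards [ae_all_iff.2 key] with t ht
  exact le_iInf ht

/-- A zero of w with nonzero derivative is isolated from the right in the zero set, and a set of
reals has only countably many such points. -/
lemma ae_deriv_eq_zero_of_eq_zero (w : ℝ → ℝ) :
    ∀ᵐ x : ℝ, w x = 0 → DifferentiableAt ℝ w x → deriv w x = 0 := by
  let s : Set ℝ := {x | w x = 0}
  have hc := countable_setOfPred_isolated_right_within (s := s)
  filter_upwards [hc.ae_notMem volume] with x hx hwx hdx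
  by_contra hne
  refine hx ⟨hwx, ?_⟩
  have := hdx.hasDerivAt.eventually_ne (c := 0) hne
  have h2 : ∀ᶠ z in 𝓝[>] x, w z ≠ 0 := nhdsWithin_mono x (fun z hz => ne_of_gt hz) this
  rw [inter_comm, nhdsWithin_inter', inf_principal_eq_bot]
  exact h2

/-- The source of all locality: at almost every time where the two functions agree, their
representatives have the same derivative, so the smaller of the two bounds applies there. -/
lemma HasCurveBound.of_eq_on {F₁ F₂ : I → ℝ} {h₁ h₂ k : I → ℝ≥0∞} (hF₁ : HasCurveBound F₁ h₁)
    (hF₂ : HasCurveBound F₂ h₂) (hk₁ : ∀ᵐ t : I, F₁ t ≠ F₂ t → h₁ t ≤ k t)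
    (hk₂ : ∀ᵐ t : I, F₁ t = F₂ t → min (h₁ t) (h₂ t) ≤ k t) : HasCurveBound F₁ k := by
  obtain ⟨u, hu, hFu, h0, h1, hd⟩ := hF₁
  obtain ⟨v, hv, hFv, -, -, hd'⟩ := hF₂
  refine ⟨u, hu, hFu, h0, h1, ?_⟩
  have hz : ∀ᵐ t : I, (u - v) t = 0 → DifferentiableAt ℝ (u - v) t → deriv (u - v) t = 0 := by
    rw [ae_unitInterval_iff
      (P := fun t => (u - v) t = 0 → DifferentiableAt ℝ (u - v) t → deriv (u - v) t = 0)]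
    filter_upwards [ae_deriv_eq_zero_of_eq_zero (u - v)] with x hx _ using hx
  filter_upwards [hFu, hFv, hd, hd', hk₁, hk₂, hz, ae_differentiableAt_unitInterval hu,
    ae_differentiableAt_unitInterval hv] with t a b c d e f g du dv
  by_cases hEq : F₁ t = F₂ t
  · have h3 := g (by simp [← a, ← b, hEq]) (du.sub dv)
    rw [deriv_sub du dv, sub_eq_zero] at h3
    refine le_trans (le_min c ?_) (f hEq)
    rwa [h3]
  · exact c.trans (e hEq)

lemma hasCurveBound_const (c : ℝ) (h : I → ℝ≥0∞) : HasCurveBound (fun _ => c) h := by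
  refine ⟨fun _ => c, ?_, by simp, rfl, rfl, by simp⟩
  exact (LipschitzWith.const c).lipschitzOnWith.absolutelyContinuousOnInterval

lemma HasCurveBound.mul {F₁ F₂ : I → ℝ} {h₁ h₂ : I → ℝ≥0∞} (hF₁ : HasCurveBound F₁ h₁)
    (hF₂ : HasCurveBound F₂ h₂) :
    HasCurveBound (fun t => F₁ t * F₂ t)
      (fun t => ENNReal.ofReal |F₁ t| * h₂ t + ENNReal.ofReal |F₂ t| * h₁ t) := by
  obtain ⟨u, hu, hFu, h0, h1, hd⟩ := hF₁
  obtain ⟨v, hv, hFv, h0', h1', hd'⟩ := hF₂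
  refine ⟨u * v, hu.mul hv, ?_, by simp [h0, h0'], by simp [h1, h1'], ?_⟩
  · filter_upwards [hFu, hFv] with t a b
    simp [a, b]
  filter_upwards [hFu, hFv, hd, hd', ae_differentiableAt_unitInterval hu,
    ae_differentiableAt_unitInterval hv] with t a b c d du dv
  rw [deriv_mul du dv]
  refine (ENNReal.ofReal_le_ofReal (abs_add_le _ _)).trans ?_
  rw [ENNReal.ofReal_add (abs_nonneg _) (abs_nonneg _), abs_mul, abs_mul,
    ENNReal.ofReal_mul (abs_nonneg _), ENNReal.ofReal_mul (abs_nonneg _), a, b, add_comm]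
  rw [mul_comm (ENNReal.ofReal |deriv u t|)]
  gcongr

lemma absolutelyContinuousOnInterval_of_dist_le {Y : Type*} [PseudoMetricSpace Y] {u : ℝ → Y}
    {H : ℝ → ℝ} {a b : ℝ} (hH : AbsolutelyContinuousOnInterval H a b)
    (h : ∀ x ∈ uIcc a b, ∀ y ∈ uIcc a b, dist (u x) (u y) ≤ dist (H x) (H y)) :
    AbsolutelyContinuousOnInterval u a b := by
  rw [absolutelyContinuousOnInterval_iff] at hH ⊢
  intro ε hε
  obtain ⟨δ, hδ, hE⟩ := hH ε hε
  refine ⟨δ, hδ, fun E hEd hlen => lt_of_le_of_lt (Finset.sum_le_sum fun i hi => ?_)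
    (hE E hEd hlen)⟩
  exact h _ (hEd.1 i hi).1 _ (hEd.1 i hi).2

lemma abs_deriv_le_of_dist_le {u H : ℝ → ℝ} {a b x k : ℝ} (hx : x ∈ Ioo a b)
    (hu : DifferentiableAt ℝ u x) (hH : HasDerivAt H k x)
    (h : ∀ y ∈ Icc a b, |u y - u x| ≤ |H y - H x|) : |deriv u x| ≤ |k| := by
  have h1 := (hasDerivAt_iff_tendsto_slope.1 hu.hasDerivAt).abs
  have h2 := (hasDerivAt_iff_tendsto_slope.1 hH).abs
  refine le_of_tendsto_of_tendsto h1 h2 ?_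
  have : ∀ᶠ y in 𝓝[≠] x, y ∈ Icc a b := nhdsWithin_le_nhds (Icc_mem_nhds hx.1 hx.2)
  filter_upwards [this] with y hy
  rw [slope_def_field, slope_def_field, abs_div, abs_div]
  exact div_le_div_of_nonneg_right (h y hy) (abs_nonneg _)

/-- On T the function F is a 1-Lipschitz function of the primitive H of h. Extending that function
from H(T) to the line and composing with H produces the representative. The endpoints must lie in T
because the values there have to be kept. -/
lemma hasCurveBound_of_increments {F : I → ℝ} {h : I → ℝ≥0∞} (hm : Measurable h)
    (hfin : ∫⁻ t, h t ≠ ∞) {T : Set I} (h0 : 0 ∈ T) (h1 : 1 ∈ T) (hT : ∀ᵐ t : I, t ∈ T)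
    (hF : ∀ s ∈ T, ∀ t ∈ T, s ≤ t → ENNReal.ofReal |F t - F s| ≤ ∫⁻ r in Icc s t, h r) :
    HasCurveBound F h := by
  set h' : ℝ → ℝ≥0∞ := IccExtend zero_le_one h with hh'
  have hm' : Measurable h' := hm.comp continuous_projIcc.measurable
  have hfin' : ∫⁻ x in Icc (0 : ℝ) 1, h' x ≠ ∞ := by
    rw [← setLIntegral_univ, ← Icc_zero_one_eq_univ, setLIntegral_unitInterval] at hfin
    exact hfin
  have hint : IntervalIntegrable (fun x => (h' x).toReal) volume 0 1 := by
    rw [intervalIntegrable_iff_integrableOn_Icc_of_le zero_le_one]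
    exact integrable_toReal_of_lintegral_ne_top hm'.aemeasurable hfin'
  have hlt : ∀ᵐ x : ℝ, x ∈ Icc (0 : ℝ) 1 → h' x < ∞ :=
    (ae_restrict_iff' measurableSet_Icc).1 (ae_lt_top hm' hfin')
  set H : ℝ → ℝ := fun x => ∫ r in (0 : ℝ)..x, (h' r).toReal with hHdef
  have hHac : AbsolutelyContinuousOnInterval H 0 1 :=
    hint.absolutelyContinuousOnInterval_intervalIntegral (by simp)
  have hHsub : ∀ s t : I, s ≤ t → ENNReal.ofReal (H t - H s) = ∫⁻ r in Icc s t, h r := by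
    intro s t hst
    have hst' : (s : ℝ) ≤ t := hst
    have hsubs : Icc (s : ℝ) t ⊆ Icc 0 1 := Icc_subset_Icc s.2.1 t.2.2
    have i1 : IntervalIntegrable (fun x => (h' x).toReal) volume 0 t :=
      hint.mono_set (by rw [uIcc_of_le t.2.1, uIcc_of_le zero_le_one]
                        exact Icc_subset_Icc le_rfl t.2.2)
    have i2 : IntervalIntegrable (fun x => (h' x).toReal) volume 0 s :=
      hint.mono_set (by rw [uIcc_of_le s.2.1, uIcc_of_le zero_le_one]
                        exact Icc_subset_Icc le_rfl s.2.2)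
    rw [hHdef]
    simp only
    rw [intervalIntegral.integral_interval_sub_left i1 i2, intervalIntegral.integral_of_le hst',
      ← integral_Icc_eq_integral_Ioc, setLIntegral_unitInterval,
      integral_toReal hm'.aemeasurable.restrict, ENNReal.ofReal_toReal]
    · exact ((lintegral_mono_set hsubs).trans_lt hfin'.lt_top).ne
    · rw [ae_restrict_iff' measurableSet_Icc]
      filter_upwards [hlt] with x hx hxs using hx (hsubs hxs)
  have hHmono : ∀ s t : I, s ≤ t → H s ≤ H t := by
    intro s t hst
    have hst' : (s : ℝ) ≤ t := hst
    rw [hHdef]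
    simp only
    refine intervalIntegral.integral_mono_interval le_rfl s.2.1 hst' ?_ ?_
    · exact Eventually.of_forall fun _ => ENNReal.toReal_nonneg
    · exact hint.mono_set (by rw [uIcc_of_le t.2.1, uIcc_of_le zero_le_one]
                              exact Icc_subset_Icc le_rfl t.2.2)
  have hFH : ∀ s ∈ T, ∀ t ∈ T, |F t - F s| ≤ |H t - H s| := by
    have aux : ∀ s ∈ T, ∀ t ∈ T, s ≤ t → |F t - F s| ≤ |H t - H s| := by
      intro s hs t ht hst
      have := hF s hs t ht hst
      rw [← hHsub s t hst] at this
      have h3 := (ENNReal.ofReal_le_ofReal_iff (sub_nonneg.2 (hHmono s t hst))).1 this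
      exact h3.trans (le_abs_self _)
    intro s hs t ht
    rcases le_total s t with hst | hst
    · exact aux s hs t ht hst
    · rw [abs_sub_comm, abs_sub_comm (H t)]
      exact aux t ht s hs hst
  -- `F = φ ∘ H` on `T` with `φ` 1-Lipschitz
  let G : I → ℝ := fun t => H t
  have hlip : LipschitzOnWith 1 (fun y => F (Function.invFunOn G T y)) (G '' T) := by
    refine LipschitzOnWith.of_dist_le_mul ?_
    intro x hx y hy
    have hx1 := Function.invFunOn_mem hx
    have hy1 := Function.invFunOn_mem hy
    have hx2 : G _ = x := Function.invFunOn_eq hx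
    have hy2 : G _ = y := Function.invFunOn_eq hy
    rw [NNReal.coe_one, one_mul, Real.dist_eq, Real.dist_eq]
    refine (hFH _ hy1 _ hx1).trans (le_of_eq ?_)
    change |G _ - G _| = _
    rw [hx2, hy2]
  obtain ⟨φ, hφ, hφeq⟩ := hlip.extend_real
  have hFφ : ∀ t ∈ T, F t = φ (H t) := by
    intro t ht
    have hmem : G t ∈ G '' T := mem_image_of_mem _ ht
    rw [← hφeq hmem]
    have hx1 := Function.invFunOn_mem hmem
    have hx2 : G _ = G t := Function.invFunOn_eq hmem
    have : |F t - F _| ≤ |G t - G _| := hFH _ hx1 _ ht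
    rw [hx2, sub_self, abs_zero] at this
    have := abs_eq_zero.1 (le_antisymm this (abs_nonneg _))
    linarith
  have hφH : ∀ x y, |φ (H x) - φ (H y)| ≤ |H x - H y| := by
    intro x y
    simpa [Real.dist_eq] using hφ.dist_le_mul (H x) (H y)
  have hac : AbsolutelyContinuousOnInterval (fun x => φ (H x)) 0 1 :=
    absolutelyContinuousOnInterval_of_dist_le hHac fun x _ y _ => by
      simpa [Real.dist_eq] using hφH x y
  refine ⟨fun x => φ (H x), hac, ?_, by simpa using hFφ 0 h0, by simpa using hFφ 1 h1, ?_⟩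
  · filter_upwards [hT] with t ht using hFφ t ht
  · have hd : ∀ᵐ t : I, HasDerivAt H (h' t).toReal t := by
      rw [ae_unitInterval_iff (P := fun x => HasDerivAt H (h' x).toReal x)]
      have := hint.ae_hasDerivAt_integral
      rw [uIcc_of_le zero_le_one] at this
      filter_upwards [this] with x hx hx1
      exact hx hx1 0 (by simp)
    have hlt' : ∀ᵐ t : I, h' t < ∞ := by
      rw [ae_unitInterval_iff (P := fun x => h' x < ∞)]
      exact hlt
    filter_upwards [hd, hlt', ae_differentiableAt_unitInterval hac, ae_mem_Ioo_unitInterval]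
      with t a b c d
    have := abs_deriv_le_of_dist_le d c a fun y _ => hφH y t
    rw [abs_of_nonneg (a := (h' t).toReal) ENNReal.toReal_nonneg] at this
    refine (ENNReal.ofReal_le_ofReal this).trans ?_
    rw [ENNReal.ofReal_toReal b.ne, hh', IccExtend_val]

end CurveBound

end BIPSpaces

end

noncomputable section

namespace BIPSpaces

variable {X : Type*} [MetricSpace X]

/-! ### Measurability of the speed and of the class of absolutely continuous curves -/

section Speed

lemma speed_eq_iInf_iSup (γ : Curve X) (t : I) :
    speed γ t = ⨅ n : ℕ, ⨆ s : I, ⨆ _ : t < s ∧ dist s t < 1 / ((n : ℝ) + 1),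
      edist (γ s) (γ t) / edist s t := by
  have hb := nhdsWithin_hasBasis (Metric.nhds_basis_ball_inv_nat_succ (x := t)) (Ioi t)
  rw [speed, hb.limsup_eq_iInf_iSup]
  simp only [iInf_pos, mem_inter_iff, Metric.mem_ball, mem_Ioi]
  refine iInf_congr fun n => iSup_congr fun s => ?_
  exact iSup_congr_Prop and_comm fun _ => rfl

lemma measurable_speed [SecondCountableTopology X] :
    Measurable (fun z : Curve X × I => speed z.1 z.2) := by
  simp only [speed_eq_iInf_iSup]
  refine Measurable.iInf fun n => measurable_of_Ioi fun c => ?_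
  have : (fun z : Curve X × I => ⨆ s : I, ⨆ _ : z.2 < s ∧ dist s z.2 < 1 / ((n : ℝ) + 1),
      edist (z.1 s) (z.1 z.2) / edist s z.2) ⁻¹' Ioi c =
      ⋃ s : I, {z | (z.2 < s ∧ dist s z.2 < 1 / ((n : ℝ) + 1)) ∧
        c * edist s z.2 < edist (z.1 s) (z.1 z.2)} := by
    ext z
    simp only [mem_preimage, mem_Ioi, lt_iSup_iff, mem_iUnion, mem_ofPred_eq, exists_prop]
    refine exists_congr fun s => and_congr_right fun hs => ?_
    rw [ENNReal.lt_div_iff_mul_lt (Or.inl (edist_pos.2 hs.1.ne').ne') (Or.inl (edist_ne_top _ _))]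
  rw [this]
  refine IsOpen.measurableSet (isOpen_iUnion fun s => ?_)
  have hset : {z : Curve X × I | (z.2 < s ∧ dist s z.2 < 1 / ((n : ℝ) + 1)) ∧
        c * edist s z.2 < edist (z.1 s) (z.1 z.2)} =
      ({z | z.2 < s} ∩ {z | dist s z.2 < 1 / ((n : ℝ) + 1)}) ∩
        {z | c * edist s z.2 < edist (z.1 s) (z.1 z.2)} := rfl
  rw [hset]
  have ho₁ : IsOpen {z : Curve X × I | z.2 < s} := isOpen_lt continuous_snd continuous_const
  have ho₂ : IsOpen {z : Curve X × I | dist s z.2 < 1 / ((n : ℝ) + 1)} :=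
    isOpen_lt (continuous_const.dist continuous_snd) continuous_const
  refine IsOpen.inter (ho₁.inter ho₂) ?_
  by_cases hc : c = ∞
  · have : {z : Curve X × I | c * edist s z.2 < edist (z.1 s) (z.1 z.2)} = ∅ := by
      ext z
      simp only [mem_ofPred_eq, mem_empty_iff_false, iff_false, not_lt, hc]
      by_cases hsz : s = z.2
      · simp [hsz]
      · rw [ENNReal.top_mul (edist_pos.2 hsz).ne']
        exact le_top
    rw [this]
    exact isOpen_empty
  · have h1 : Continuous fun z : Curve X × I => z.1 s :=
      (continuous_eval_const s).comp continuous_fst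
    have h2 : Continuous fun z : Curve X × I => z.1 z.2 := continuous_eval
    exact isOpen_lt ((ENNReal.continuous_const_mul hc).comp (continuous_const.edist continuous_snd))
      (h1.edist h2)

lemma measurable_speed_curve [SecondCountableTopology X] (γ : Curve X) :
    Measurable (fun t => speed γ t) := by
  have h : Measurable (fun t : I => ((γ, t) : Curve X × I)) := measurable_prodMk_left
  have h2 : Measurable ((fun z : Curve X × I => speed z.1 z.2) ∘
      (fun t : I => ((γ, t) : Curve X × I))) := Measurable.comp measurable_speed h
  simpa only [Function.comp_def] using h2

end Speed

/-! ### Discrete energies and absolute continuity -/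

section AbsolutelyContinuous

lemma lintegral_rpow_le {α : Type*} [MeasurableSpace α] (μ : Measure α) {h : α → ℝ≥0∞}
    (hh : AEMeasurable h μ) {q : ℝ} (hq : 1 < q) :
    (∫⁻ x, h x ∂μ) ^ q ≤ μ univ ^ (q - 1) * ∫⁻ x, h x ^ q ∂μ := by
  have hc : q.HolderConjugate q.conjExponent := Real.HolderConjugate.conjExponent hq
  have := ENNReal.lintegral_mul_le_Lp_mul_Lq μ hc hh (g := fun _ => 1) aemeasurable_const
  simp only [Pi.mul_apply, mul_one, ENNReal.one_rpow, lintegral_one] at this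
  have h2 := ENNReal.rpow_le_rpow this (zero_le_one.trans hq.le)
  rw [ENNReal.mul_rpow_of_nonneg _ _ (zero_le_one.trans hq.le), ← ENNReal.rpow_mul,
    ← ENNReal.rpow_mul, one_div_mul_cancel (zero_lt_one.trans hq).ne', ENNReal.rpow_one] at h2
  refine h2.trans (le_of_eq ?_)
  rw [mul_comm]
  congr 2
  rw [Real.conjExponent]
  have : q - 1 ≠ 0 := (sub_pos.2 hq).ne'
  have : q ≠ 0 := (zero_lt_one.trans hq).ne'
  field_simp

lemma volume_Icc_unitInterval (s t : I) : volume (Icc s t) = ENNReal.ofReal ((t : ℝ) - s) := by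
  rw [← setLIntegral_one, setLIntegral_unitInterval]
  have : IccExtend zero_le_one (fun _ : I => (1 : ℝ≥0∞)) = fun _ => 1 := by
    ext; simp [IccExtend]
  rw [this, setLIntegral_one, Real.volume_Icc]

/-- The discrete `q`-energies of `γ` are bounded by `M`. -/
def DiscreteEnergyLE (q M : ℝ) (γ : Curve X) : Prop :=
  ∀ E ∈ AbsolutelyContinuousOnInterval.disjWithin 0 1,
    ∑ i ∈ Finset.range E.1, dist (γ (projIcc 0 1 zero_le_one (E.2 i).1))
      (γ (projIcc 0 1 zero_le_one (E.2 i).2)) ^ q / |(E.2 i).2 - (E.2 i).1| ^ (q - 1) ≤ M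

/-- Discrete energies are used because each depends on finitely many values of the curve, hence is
continuous for uniform convergence; this is what makes AC^q measurable. -/
lemma isClosed_discreteEnergyLE {q : ℝ} (hq : 1 < q) (M : ℝ) :
    IsClosed {γ : Curve X | DiscreteEnergyLE q M γ} := by
  simp only [DiscreteEnergyLE, ofPred_forall]
  refine isClosed_iInter fun E => isClosed_iInter fun _ => isClosed_le ?_ continuous_const
  refine continuous_finsetSum _ fun i _ => Continuous.div_const ?_ _
  refine Continuous.rpow_const ?_ fun _ => Or.inr (zero_le_one.trans hq.le)
  exact (continuous_eval_const _).dist (continuous_eval_const _)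

/-- By Hölder, an interval of length l and increment d satisfies d^q / l^(q-1) ≤ ∫ |g|^q over it,
and the intervals are disjoint. The bound is taken to be natural so that a countable union over
bounds suffices. -/
lemma IsACq.exists_discreteEnergyLE {q : ℝ} (hq : 1 < q) {γ : Curve X} (h : IsACq q γ) :
    ∃ M : ℕ, DiscreteEnergyLE q M γ := by
  obtain ⟨g, hg, hγ⟩ := h
  have hq0 : 0 < q := zero_lt_one.trans hq
  have hgfin : ∫⁻ t : I, ‖g t‖ₑ ^ q < ∞ := by
    have := lintegral_rpow_enorm_lt_top_of_eLpNorm_lt_top (p := ENNReal.ofReal q) (by simpa)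
      ENNReal.ofReal_ne_top hg.2
    rwa [ENNReal.toReal_ofReal hq0.le] at this
  set k : ℝ → ℝ≥0∞ := IccExtend zero_le_one (fun t => ‖g t‖ₑ ^ q) with hk
  have hkfin : ∫⁻ x in Icc (0 : ℝ) 1, k x < ∞ := by
    rw [← setLIntegral_univ, ← Icc_zero_one_eq_univ, setLIntegral_unitInterval] at hgfin
    exact hgfin
  obtain ⟨M, hM⟩ := exists_nat_ge (∫⁻ x in Icc (0 : ℝ) 1, k x).toReal
  refine ⟨M, fun E hE => le_trans ?_ hM⟩
  have base : ∀ a b : ℝ, a ∈ Icc (0 : ℝ) 1 → b ∈ Icc (0 : ℝ) 1 → a ≤ b →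
      ENNReal.ofReal (dist (γ (projIcc 0 1 zero_le_one a)) (γ (projIcc 0 1 zero_le_one b)) ^ q /
        |b - a| ^ (q - 1)) ≤ ∫⁻ x in Ioc a b, k x := by
    intro a b ha hb hab
    rcases hab.eq_or_lt with rfl | hab'
    · simp [Real.zero_rpow hq0.ne']
    have hl : 0 < b - a := sub_pos.2 hab'
    rw [projIcc_of_mem _ ha, projIcc_of_mem _ hb, abs_of_pos hl]
    have hle : (⟨a, ha⟩ : I) ≤ ⟨b, hb⟩ := hab
    have h1 := hγ ⟨a, ha⟩ ⟨b, hb⟩ hle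
    have h2 : edist (γ ⟨a, ha⟩) (γ ⟨b, hb⟩) ≤ ∫⁻ r in Icc (⟨a, ha⟩ : I) ⟨b, hb⟩, ‖g r‖ₑ := by
      rw [edist_comm, edist_dist]
      refine (ENNReal.ofReal_le_ofReal (h1.trans (le_abs_self _))).trans ?_
      rw [← Real.enorm_eq_ofReal_abs]
      exact enorm_integral_le_lintegral_enorm _
    have h3 := (ENNReal.rpow_le_rpow h2 hq0.le).trans
      (lintegral_rpow_le _ hg.1.enorm.restrict hq)
    rw [Measure.restrict_apply_univ, volume_Icc_unitInterval, setLIntegral_unitInterval] at h3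
    rw [ENNReal.ofReal_div_of_pos (Real.rpow_pos_of_pos hl _)]
    refine ENNReal.div_le_of_le_mul ?_
    rw [← ENNReal.ofReal_rpow_of_nonneg dist_nonneg hq0.le, ← edist_dist,
      ← ENNReal.ofReal_rpow_of_pos hl, mul_comm, setLIntegral_congr Ioc_ae_eq_Icc]
    exact h3
  have base' : ∀ i ∈ Finset.range E.1,
      ENNReal.ofReal (dist (γ (projIcc 0 1 zero_le_one (E.2 i).1))
      (γ (projIcc 0 1 zero_le_one (E.2 i).2)) ^ q / |(E.2 i).2 - (E.2 i).1| ^ (q - 1)) ≤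
        ∫⁻ x in uIoc (E.2 i).1 (E.2 i).2, k x := by
    intro i hi
    obtain ⟨h1, h2⟩ := hE.1 i hi
    rw [uIcc_of_le zero_le_one] at h1 h2
    rcases le_total (E.2 i).1 (E.2 i).2 with h | h
    · rw [uIoc_of_le h]
      exact base _ _ h1 h2 h
    · rw [uIoc_of_ge h, dist_comm, abs_sub_comm]
      exact base _ _ h2 h1 h
  have hpos : ∀ i ∈ Finset.range E.1, 0 ≤ dist (γ (projIcc 0 1 zero_le_one (E.2 i).1))
      (γ (projIcc 0 1 zero_le_one (E.2 i).2)) ^ q / |(E.2 i).2 - (E.2 i).1| ^ (q - 1) :=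
    fun i _ => by positivity
  rw [← ENNReal.ofReal_le_iff_le_toReal hkfin.ne, ENNReal.ofReal_sum_of_nonneg hpos]
  refine (Finset.sum_le_sum base').trans ?_
  rw [← lintegral_biUnion_finset hE.2 (fun i _ => measurableSet_uIoc)]
  refine lintegral_mono_set ?_
  refine (AbsolutelyContinuousOnInterval.biUnion_uIoc_subset_of_mem_disjWithin
    (n := E.1) hE).trans ?_
  rw [uIoc_of_le zero_le_one]
  exact Ioc_subset_Icc_self

lemma DiscreteEnergyLE.absolutelyContinuous {q M : ℝ} (hq : 1 < q) {γ : Curve X}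
    (h : DiscreteEnergyLE q M γ) :
    AbsolutelyContinuousOnInterval (fun x : ℝ => γ (projIcc 0 1 zero_le_one x)) 0 1 := by
  rw [absolutelyContinuousOnInterval_iff]
  intro ε hε
  -- K is a threshold speed: slower increments are bounded by K times their length, faster ones by
  -- K^(1-q) times their discrete energy.
  obtain ⟨K, hK0, hK⟩ : ∃ K : ℝ, 0 < K ∧ K ^ (1 - q) * M < ε / 2 := by
    have h1 : Tendsto (fun K : ℝ => K ^ (-(q - 1)) * M) atTop (𝓝 (0 * M)) :=
      (tendsto_rpow_neg_atTop (sub_pos.2 hq)).mul_const M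
    rw [zero_mul] at h1
    have h2 := (h1.eventually (gt_mem_nhds (half_pos hε))).and (eventually_gt_atTop 0)
    obtain ⟨K, hK, hK0⟩ := h2.exists
    exact ⟨K, hK0, by rwa [neg_sub] at hK⟩
  refine ⟨ε / (2 * K), by positivity, fun E hE hlen => ?_⟩
  have hterm : ∀ d l : ℝ, 0 ≤ d → 0 ≤ l → (l = 0 → d = 0) →
      d ≤ K * l + K ^ (1 - q) * (d ^ q / l ^ (q - 1)) := by
    intro d l hd hl h0
    rcases hl.eq_or_lt with hl' | hl'
    · rw [h0 hl'.symm]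
      positivity
    rcases le_total d (K * l) with h1 | h1
    · have : 0 ≤ K ^ (1 - q) * (d ^ q / l ^ (q - 1)) := by positivity
      linarith
    · have hd' : 0 < d := (mul_pos hK0 hl').trans_le h1
      have h2 : K ^ (q - 1) * l ^ (q - 1) ≤ d ^ (q - 1) := by
        rw [← Real.mul_rpow hK0.le hl]
        exact Real.rpow_le_rpow (by positivity) h1 (sub_pos.2 hq).le
      have h3 : d ≤ K ^ (1 - q) * (d ^ q / l ^ (q - 1)) := by
        have e1 : K ^ (1 - q) = (K ^ (q - 1))⁻¹ := by
          rw [← Real.rpow_neg hK0.le, neg_sub]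
        have e2 : d ^ q = d * d ^ (q - 1) := by
          rw [← Real.rpow_one_add' hd (by linarith)]
          congr 1
          ring
        have p1 : 0 < K ^ (q - 1) := Real.rpow_pos_of_pos hK0 _
        have p2 : 0 < l ^ (q - 1) := Real.rpow_pos_of_pos hl' _
        rw [e1, e2, inv_mul_eq_div, div_div, le_div_iff₀ (mul_pos p2 p1), mul_comm (l ^ _)]
        exact mul_le_mul_of_nonneg_left h2 hd
      have : 0 ≤ K * l := by positivity
      linarith
  have hsum := Finset.sum_le_sum fun i (_ : i ∈ Finset.range E.1) =>
    hterm (dist (γ (projIcc 0 1 zero_le_one (E.2 i).1)) (γ (projIcc 0 1 zero_le_one (E.2 i).2)))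
      |(E.2 i).2 - (E.2 i).1| dist_nonneg (abs_nonneg _) (fun h0 => by
        rw [abs_eq_zero, sub_eq_zero] at h0
        rw [h0, dist_self])
  rw [Finset.sum_add_distrib, ← Finset.mul_sum, ← Finset.mul_sum] at hsum
  have hlen' : ∑ i ∈ Finset.range E.1, |(E.2 i).2 - (E.2 i).1| < ε / (2 * K) := by
    refine lt_of_eq_of_lt (Finset.sum_congr rfl fun i _ => ?_) hlen
    rw [dist_comm, Real.dist_eq]
  have h5 : K * ∑ i ∈ Finset.range E.1, |(E.2 i).2 - (E.2 i).1| < ε / 2 := by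
    have := mul_lt_mul_of_pos_left hlen' hK0
    have e : K * (ε / (2 * K)) = ε / 2 := by field_simp
    rwa [e] at this
  have h6 := mul_le_mul_of_nonneg_left (h E hE) (Real.rpow_nonneg hK0.le (1 - q))
  linarith

lemma absolutelyContinuousOnInterval_dist {Y : Type*} [PseudoMetricSpace Y] {u : ℝ → Y} {a b : ℝ}
    (hu : AbsolutelyContinuousOnInterval u a b) (x : Y) :
    AbsolutelyContinuousOnInterval (fun r => dist (u r) x) a b := by
  rw [absolutelyContinuousOnInterval_iff] at hu ⊢
  intro ε hε
  obtain ⟨δ, hδ, h⟩ := hu ε hε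
  refine ⟨δ, hδ, fun E hE hlen => lt_of_le_of_lt (Finset.sum_le_sum fun i _ => ?_) (h E hE hlen)⟩
  rw [Real.dist_eq]
  exact abs_dist_sub_le _ _ _

/-- The distance to x is 1-Lipschitz, so difference quotients only decrease. The speed is a limit
from the right, which is vacuous at t = 1. -/
lemma ofReal_abs_deriv_dist_le_speed (γ : Curve X) (x : X) {t : I} (ht : t < 1)
    (hd : DifferentiableAt ℝ (fun r : ℝ => dist (γ (projIcc 0 1 zero_le_one r)) x) t) :
    ENNReal.ofReal |deriv (fun r : ℝ => dist (γ (projIcc 0 1 zero_le_one r)) x) t| ≤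
      speed γ t := by
  set ψ : ℝ → ℝ := fun r : ℝ => dist (γ (projIcc 0 1 zero_le_one r)) x with hψ
  have hψI : ∀ s : I, ψ s = dist (γ s) x := fun s => by simp [hψ]
  have hne : (𝓝[>] t).NeBot := nhdsGT_neBot_of_exists_gt ⟨1, ht⟩
  have h1 := hasDerivAt_iff_tendsto_slope.1 hd.hasDerivAt
  have h2 : Tendsto (fun s : I => (s : ℝ)) (𝓝[>] t) (𝓝[≠] (t : ℝ)) := by
    refine tendsto_nhdsWithin_iff.2 ⟨(continuous_subtype_val.tendsto t).mono_left
      nhdsWithin_le_nhds, ?_⟩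
    filter_upwards [self_mem_nhdsWithin] with s hs
    exact fun h => (ne_of_gt hs) (Subtype.ext h)
  have h3 : Tendsto (fun s : I => ENNReal.ofReal |slope ψ t s|) (𝓝[>] t)
      (𝓝 (ENNReal.ofReal |deriv ψ t|)) := ENNReal.tendsto_ofReal (h1.comp h2).abs
  rw [← h3.limsup_eq, speed]
  refine limsup_le_limsup ?_
  filter_upwards [self_mem_nhdsWithin] with s hs
  have hst : (0 : ℝ) < s - t := sub_pos.2 hs
  rw [slope_def_field, abs_div, abs_of_pos hst, ENNReal.ofReal_div_of_pos hst, edist_dist,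
    edist_dist, Subtype.dist_eq, Real.dist_eq, abs_of_pos hst]
  gcongr
  rw [hψI, hψI]
  exact abs_dist_sub_le _ _ _

/-- The fundamental theorem of calculus is applied to the scalar function r ↦ d(γ_r, γ_s), which
vanishes at r = s. -/
lemma edist_le_lintegral_speed {γ : Curve X}
    (h : AbsolutelyContinuousOnInterval (fun x : ℝ => γ (projIcc 0 1 zero_le_one x)) 0 1)
    {s t : I} (hst : s ≤ t) : edist (γ s) (γ t) ≤ ∫⁻ r in Icc s t, speed γ r := by
  have hac := absolutelyContinuousOnInterval_dist h (γ s)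
  have := ofReal_abs_sub_le_lintegral_of_deriv_le hac (h := speed γ) ?_ hst
  · simp only [projIcc_val, dist_self, sub_zero, abs_of_nonneg dist_nonneg] at this
    rwa [edist_comm, edist_dist]
  · filter_upwards [ae_differentiableAt_unitInterval hac, ae_mem_Ioo_unitInterval] with r hr hr1
    exact ofReal_abs_deriv_dist_le_speed γ (γ s) hr1.2 hr

lemma tendsto_straddle {ψ : ℝ → ℝ} {d x : ℝ} (hd : HasDerivAt ψ d x) {a b : ℕ → ℝ}
    (ha : Tendsto a atTop (𝓝 x)) (hb : Tendsto b atTop (𝓝 x))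
    (hab : ∀ᶠ n in atTop, a n ≤ x ∧ x < b n) :
    Tendsto (fun n => (ψ (b n) - ψ (a n)) / (b n - a n)) atTop (𝓝 d) := by
  rw [Metric.tendsto_nhds]
  intro ε hε
  have h := (hasDerivAt_iff_isLittleO.1 hd).def (half_pos hε)
  filter_upwards [ha.eventually h, hb.eventually h, hab] with n h1 h2 h3
  have hl : 0 < b n - a n := by linarith [h3.1, h3.2]
  simp only [Real.norm_eq_abs, smul_eq_mul] at h1 h2
  rw [abs_of_nonpos (by linarith : a n - x ≤ 0)] at h1
  rw [abs_of_nonneg (by linarith : 0 ≤ b n - x)] at h2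
  rw [Real.dist_eq]
  have e : (ψ (b n) - ψ (a n)) / (b n - a n) - d =
      ((ψ (b n) - ψ x - (b n - x) * d) - (ψ (a n) - ψ x - (a n - x) * d)) / (b n - a n) := by
    field_simp
    ring
  rw [e, abs_div, abs_of_pos hl, div_lt_iff₀ hl]
  have := abs_sub (ψ (b n) - ψ x - (b n - x) * d) (ψ (a n) - ψ x - (a n - x) * d)
  have h4 := mul_pos hε hl
  nlinarith

end AbsolutelyContinuous

end BIPSpaces

end

noncomputable section

namespace BIPSpaces

variable {X : Type*} [MetricSpace X]

/-! ### Curves of bounded discrete energy are in AC^q -/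

section AbsolutelyContinuousEnergy

/-- The step function whose value on `[k/n, (k+1)/n)` is `c k`. -/
def stepFun (n : ℕ) (c : ℕ → ℝ≥0∞) (t : I) : ℝ≥0∞ :=
  ∑ k ∈ Finset.range n,
    {t : I | (t : ℝ) ∈ Ico ((k : ℝ) / n) ((k + 1) / n)}.indicator (fun _ => c k) t

lemma measurableSet_coe_mem_Ico (a b : ℝ) : MeasurableSet {t : I | (t : ℝ) ∈ Ico a b} :=
  measurable_subtype_coe measurableSet_Ico

lemma measurable_stepFun (n : ℕ) (c : ℕ → ℝ≥0∞) : Measurable (stepFun n c) :=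
  Finset.measurable_sum _ fun _ _ =>
    measurable_const.indicator (measurableSet_coe_mem_Ico _ _)

lemma lintegral_stepFun_le (n : ℕ) (c : ℕ → ℝ≥0∞) :
    ∫⁻ t, stepFun n c t ≤ ∑ k ∈ Finset.range n, c k * ENNReal.ofReal (1 / n) := by
  unfold stepFun
  rw [lintegral_finsetSum _ fun k _ =>
    measurable_const.indicator (measurableSet_coe_mem_Ico _ _)]
  refine Finset.sum_le_sum fun k _ => ?_
  rw [lintegral_indicator_const (measurableSet_coe_mem_Ico _ _)]
  gcongr
  have h1 : volume {t : I | (t : ℝ) ∈ Ico ((k : ℝ) / n) ((k + 1) / n)} =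
      volume (Subtype.val '' {t : I | (t : ℝ) ∈ Ico ((k : ℝ) / n) ((k + 1) / n)}) :=
    (volume_image_subtype_coe measurableSet_Icc _).symm
  rw [h1]
  refine (measure_mono (t := Ico ((k : ℝ) / n) ((k + 1) / n)) ?_).trans ?_
  · rintro _ ⟨t, ht, rfl⟩
    exact ht
  · rw [Real.volume_Ico]
    refine ENNReal.ofReal_le_ofReal (le_of_eq ?_)
    ring

lemma le_stepFun {n : ℕ} (hn : 0 < n) (c : ℕ → ℝ≥0∞) {t : I} (ht : t < 1) :
    c ⌊(n : ℝ) * t⌋₊ ≤ stepFun n c t := by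
  have hn' : (0 : ℝ) < n := Nat.cast_pos.2 hn
  have ht' : (t : ℝ) < 1 := ht
  have h0 : (0 : ℝ) ≤ n * t := mul_nonneg hn'.le t.2.1
  have hlt : ⌊(n : ℝ) * t⌋₊ < n := by
    rw [Nat.floor_lt h0]
    nlinarith
  unfold stepFun
  refine le_trans ?_ (Finset.single_le_sum (fun _ _ => zero_le) (Finset.mem_range.2 hlt))
  rw [indicator_of_mem]
  refine ⟨?_, ?_⟩
  · rw [div_le_iff₀ hn', mul_comm (t : ℝ)]
    exact Nat.floor_le h0
  · rw [lt_div_iff₀ hn', mul_comm]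
    exact Nat.lt_floor_add_one _

lemma uniform_partition_mem_disjWithin (n : ℕ) :
    ((n, fun k : ℕ => ((k : ℝ) / n, ((k : ℝ) + 1) / n)) : ℕ × (ℕ → ℝ × ℝ)) ∈
      AbsolutelyContinuousOnInterval.disjWithin 0 1 := by
  rcases n.eq_zero_or_pos with rfl | hn
  · simp [AbsolutelyContinuousOnInterval.disjWithin]
  have hn' : (0 : ℝ) < n := Nat.cast_pos.2 hn
  refine ⟨fun i hi => ?_, ?_⟩
  · have hi' : (i : ℝ) + 1 ≤ n := by exact_mod_cast Finset.mem_range.1 hi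
    rw [uIcc_of_le zero_le_one]
    refine ⟨⟨by positivity, ?_⟩, ⟨by positivity, ?_⟩⟩
    · rw [div_le_one hn']
      linarith
    · rw [div_le_one hn']
      exact hi'
  · intro i _ j _ hij
    rw [Function.onFun, Set.disjoint_left]
    intro x hx hy
    simp only [] at hx hy
    rw [uIoc_of_le (by gcongr; linarith), mem_Ioc, div_lt_iff₀ hn', le_div_iff₀ hn'] at hx hy
    have h1 : (i : ℝ) < j + 1 := by linarith
    have h2 : (j : ℝ) < i + 1 := by linarith
    have h1' : i < j + 1 := by exact_mod_cast h1
    have h2' : j < i + 1 := by exact_mod_cast h2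
    omega

lemma tendsto_floor_div (t : ℝ) (ht : 0 ≤ t) :
    Tendsto (fun n : ℕ => (⌊(n : ℝ) * t⌋₊ : ℝ) / n) atTop (𝓝 t) := by
  have := (tendsto_nat_floor_mul_div_atTop (R := ℝ) ht).comp tendsto_natCast_atTop_atTop
  simpa [Function.comp_def, mul_comm] using this

/-- The quotients of the distance to x over the cells ⌊nt⌋/n, (⌊nt⌋+1)/n containing t converge to
its derivative and are dominated by the mean speeds of γ on those cells. -/
lemma ofReal_abs_deriv_dist_rpow_le_liminf {q : ℝ} (hq : 1 < q) (γ : Curve X) (x : X) {t : I}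
    (ht : t < 1)
    (hd : DifferentiableAt ℝ (fun r : ℝ => dist (γ (projIcc 0 1 zero_le_one r)) x) t) :
    ENNReal.ofReal |deriv (fun r : ℝ => dist (γ (projIcc 0 1 zero_le_one r)) x) t| ^ q ≤
      liminf (fun n : ℕ => stepFun n (fun k => ENNReal.ofReal
        (n * dist (γ (projIcc 0 1 zero_le_one ((k : ℝ) / n)))
          (γ (projIcc 0 1 zero_le_one (((k : ℝ) + 1) / n)))) ^ q) t) atTop := by
  set ψ : ℝ → ℝ := fun r : ℝ => dist (γ (projIcc 0 1 zero_le_one r)) x with hψ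
  have ha := tendsto_floor_div t t.2.1
  have hb : Tendsto (fun n : ℕ => ((⌊(n : ℝ) * t⌋₊ : ℝ) + 1) / n) atTop (𝓝 (t : ℝ)) := by
    have := ha.add (tendsto_one_div_atTop_nhds_zero_nat (𝕜 := ℝ))
    rw [add_zero] at this
    refine this.congr fun n => ?_
    rw [add_div]
  have hab : ∀ᶠ n : ℕ in atTop, (⌊(n : ℝ) * t⌋₊ : ℝ) / n ≤ t ∧
      (t : ℝ) < ((⌊(n : ℝ) * t⌋₊ : ℝ) + 1) / n := by
    filter_upwards [eventually_gt_atTop 0] with n hn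
    have hn' : (0 : ℝ) < n := Nat.cast_pos.2 hn
    refine ⟨?_, ?_⟩
    · rw [div_le_iff₀ hn', mul_comm (t : ℝ)]
      exact Nat.floor_le (mul_nonneg hn'.le t.2.1)
    · rw [lt_div_iff₀ hn', mul_comm]
      exact Nat.lt_floor_add_one _
  have h1 := tendsto_straddle hd.hasDerivAt ha hb hab
  have h2 := (ENNReal.continuous_rpow_const (y := q)).continuousAt.tendsto.comp
    (ENNReal.tendsto_ofReal h1.abs)
  rw [← h2.liminf_eq]
  refine liminf_le_liminf ?_
  filter_upwards [eventually_gt_atTop 0] with n hn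
  have hn' : (0 : ℝ) < n := Nat.cast_pos.2 hn
  refine le_trans ?_ (le_stepFun hn _ ht)
  refine ENNReal.rpow_le_rpow (ENNReal.ofReal_le_ofReal ?_) (zero_le_one.trans hq.le)
  have e : ((⌊(n : ℝ) * t⌋₊ : ℝ) + 1) / n - (⌊(n : ℝ) * t⌋₊ : ℝ) / n = (n : ℝ)⁻¹ := by
    rw [← sub_div, add_sub_cancel_left, one_div]
  rw [e, div_inv_eq_mul, abs_mul, abs_of_pos hn', mul_comm]
  refine mul_le_mul_of_nonneg_left ?_ hn'.le
  rw [abs_sub_comm]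
  exact abs_dist_sub_le _ _ _

/-- The admissible g is the supremum of the derivatives of the distances to a countable dense set.
Fatou's lemma, applied to the mean speeds on uniform partitions, bounds the integral of g^q by M. -/
lemma DiscreteEnergyLE.isACq [SecondCountableTopology X] {q M : ℝ} (hq : 1 < q) {γ : Curve X}
    (h : DiscreteEnergyLE q M γ) : IsACq q γ := by
  have hq0 : 0 < q := zero_lt_one.trans hq
  have hne : Nonempty X := ⟨γ 0⟩
  have hac := h.absolutelyContinuous hq
  set ψ : ℕ → ℝ → ℝ := fun j r => dist (γ (projIcc 0 1 zero_le_one r))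
    (TopologicalSpace.denseSeq X j) with hψ
  have hψac : ∀ j, AbsolutelyContinuousOnInterval (ψ j) 0 1 :=
    fun j => absolutelyContinuousOnInterval_dist hac _
  set g : I → ℝ≥0∞ := fun t => ⨆ j, ENNReal.ofReal |deriv (ψ j) t| with hg
  have hgm : Measurable g := Measurable.iSup fun j =>
    ENNReal.measurable_ofReal.comp ((continuous_abs.measurable.comp (measurable_deriv (ψ j))).comp
      measurable_subtype_coe)
  set S : ℕ → I → ℝ≥0∞ := fun n => stepFun n (fun k => ENNReal.ofReal
        (n * dist (γ (projIcc 0 1 zero_le_one ((k : ℝ) / n)))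
          (γ (projIcc 0 1 zero_le_one (((k : ℝ) + 1) / n)))) ^ q) with hS
  have hgS : ∀ᵐ t : I, g t ^ q ≤ liminf (fun n => S n t) atTop := by
    filter_upwards [ae_all_iff.2 fun j => ae_differentiableAt_unitInterval (hψac j),
      ae_mem_Ioo_unitInterval] with t ht ht1
    have hle : g t ≤ (liminf (fun n => S n t) atTop) ^ q⁻¹ := by
      refine iSup_le fun j => ?_
      rw [← ENNReal.rpow_inv_le_iff (inv_pos.2 hq0), inv_inv]
      exact ofReal_abs_deriv_dist_rpow_le_liminf hq γ _ ht1.2 (ht j)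
    rwa [← ENNReal.rpow_inv_le_iff (inv_pos.2 hq0), inv_inv] at hle
  have hSint : ∀ n, 0 < n → ∫⁻ t, S n t ≤ ENNReal.ofReal M := by
    intro n hn
    have hn' : (0 : ℝ) < n := Nat.cast_pos.2 hn
    refine (lintegral_stepFun_le n _).trans ?_
    have hM := h _ (uniform_partition_mem_disjWithin n)
    refine le_trans (le_of_eq ?_) (ENNReal.ofReal_le_ofReal hM)
    rw [ENNReal.ofReal_sum_of_nonneg fun i _ => by positivity]
    refine Finset.sum_congr rfl fun k _ => ?_
    rw [ENNReal.ofReal_rpow_of_nonneg (by positivity) hq0.le,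
      ← ENNReal.ofReal_mul (by positivity)]
    congr 1
    have e : ((k : ℝ) + 1) / n - k / n = (n : ℝ)⁻¹ := by
      rw [← sub_div, add_sub_cancel_left, one_div]
    simp only []
    rw [e, abs_of_pos (inv_pos.2 hn'), Real.mul_rpow hn'.le dist_nonneg, Real.inv_rpow hn'.le,
      div_inv_eq_mul, Real.rpow_sub_one hn'.ne']
    field_simp
  have hgq : ∫⁻ t, g t ^ q ≤ ENNReal.ofReal M := by
    calc ∫⁻ t, g t ^ q ≤ ∫⁻ t, liminf (fun n => S n t) atTop := lintegral_mono_ae hgS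
      _ ≤ liminf (fun n => ∫⁻ t, S n t) atTop :=
        lintegral_liminf_le fun n => measurable_stepFun _ _
      _ ≤ ENNReal.ofReal M := by
        refine liminf_le_of_le (by isBoundedDefault) fun b hb => ?_
        obtain ⟨n, hn1, hn2⟩ := (hb.and (eventually_gt_atTop 0)).exists
        exact hn1.trans (hSint n hn2)
  have hgtop : ∀ᵐ t : I, g t < ∞ := by
    have := ae_lt_top (hgm.pow_const q) (hgq.trans_lt ENNReal.ofReal_lt_top).ne
    filter_upwards [this] with t ht
    by_contra hcon
    rw [not_lt, top_le_iff] at hcon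
    rw [hcon, ENNReal.top_rpow_of_pos hq0] at ht
    exact lt_irrefl _ ht
  have hmem : MemLp (fun t => (g t).toReal) (ENNReal.ofReal q) (volume : Measure I) := by
    refine ⟨hgm.ennreal_toReal.aestronglyMeasurable, ?_⟩
    rw [eLpNorm_lt_top_iff_lintegral_rpow_enorm_lt_top (by simpa) ENNReal.ofReal_ne_top,
      ENNReal.toReal_ofReal hq0.le]
    refine lt_of_le_of_lt (lintegral_mono fun t => ?_) (hgq.trans_lt ENNReal.ofReal_lt_top)
    gcongr
    rw [Real.enorm_eq_ofReal ENNReal.toReal_nonneg]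
    exact ENNReal.ofReal_toReal_le
  refine ⟨_, hmem, fun s t hst => ?_⟩
  have hgint : ∫⁻ r in Icc s t, g r ≠ ∞ := by
    refine ne_top_of_le_ne_top ?_ (setLIntegral_le_lintegral _ _)
    intro hcon
    have h1 := lintegral_rpow_le (volume : Measure I) hgm.aemeasurable hq
    rw [hcon, ENNReal.top_rpow_of_pos hq0, measure_univ, ENNReal.one_rpow, one_mul,
      top_le_iff] at h1
    exact (hgq.trans_lt ENNReal.ofReal_lt_top).ne h1
  rw [integral_toReal hgm.aemeasurable.restrict (ae_restrict_of_ae hgtop)]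
  refine le_of_forall_pos_le_add fun ε hε => ?_
  -- For a dense point x within ε/2 of γ_s, the increment of d(·, x) differs from d(γ_t, γ_s) by at
  -- most ε.
  obtain ⟨j, hj⟩ := (TopologicalSpace.denseRange_denseSeq X).exists_dist_lt (γ s) (half_pos hε)
  have hle := ofReal_abs_sub_le_lintegral_of_deriv_le (hψac j) (h := g)
    (Eventually.of_forall fun t => le_iSup (fun j => ENNReal.ofReal |deriv (ψ j) t|) j) hst
  have hle2 := (ENNReal.ofReal_le_iff_le_toReal hgint).1 hle
  simp only [hψ, projIcc_val] at hle2
  have h3 := le_abs_self (dist (γ t) (TopologicalSpace.denseSeq X j) -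
    dist (γ s) (TopologicalSpace.denseSeq X j))
  have h4 := dist_triangle_right (γ t) (γ s) (TopologicalSpace.denseSeq X j)
  linarith

lemma measurableSet_isACq [SecondCountableTopology X] {q : ℝ} (hq : 1 < q) :
    MeasurableSet {γ : Curve X | IsACq q γ} := by
  have : {γ : Curve X | IsACq q γ} = ⋃ M : ℕ, {γ | DiscreteEnergyLE q M γ} := by
    ext γ
    simp only [mem_ofPred_eq, mem_iUnion]
    exact ⟨fun h => h.exists_discreteEnergyLE hq, fun ⟨M, h⟩ => h.isACq hq⟩
  rw [this]
  exact MeasurableSet.iUnion fun M => (isClosed_discreteEnergyLE hq M).measurableSet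

lemma lintegral_speed_le_kineticEnergy (q : ℝ) (γ : Curve X) :
    ∫⁻ t, speed γ t ^ q ≤ kineticEnergy q γ := by
  unfold kineticEnergy
  split_ifs
  · exact le_rfl
  · exact le_top

/-- The energy is infinite off AC^q, whose complement is measurable, so that complement must be
null; measurability of the energy itself is not needed. -/
lemma ae_isACq_of_lintegral_kineticEnergy [SecondCountableTopology X] {q : ℝ} (hq : 1 < q)
    {π : Measure (Curve X)} (h : ∫⁻ γ, kineticEnergy q γ ∂π < ∞) : ∀ᵐ γ ∂π, IsACq q γ := by
  have hmeas := (measurableSet_isACq (X := X) hq).compl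
  have h1 : ∫⁻ γ, {γ : Curve X | IsACq q γ}ᶜ.indicator (fun _ => ∞) γ ∂π ≤
      ∫⁻ γ, kineticEnergy q γ ∂π := by
    refine lintegral_mono fun γ => ?_
    by_cases hγ : IsACq q γ
    · rw [indicator_of_notMem (by simpa using hγ)]
      exact zero_le
    · simp [kineticEnergy, hγ]
  rw [lintegral_indicator_const hmeas] at h1
  by_contra hcon
  rw [ae_iff] at hcon
  have : π {γ : Curve X | IsACq q γ}ᶜ ≠ 0 := hcon
  rw [ENNReal.top_mul this, top_le_iff] at h1
  exact h.ne h1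

lemma IsACq.edist_le [SecondCountableTopology X] {q : ℝ} (hq : 1 < q) {γ : Curve X}
    (h : IsACq q γ) {s t : I} (hst : s ≤ t) : edist (γ s) (γ t) ≤ ∫⁻ r in Icc s t, speed γ r := by
  obtain ⟨M, hM⟩ := h.exists_discreteEnergyLE hq
  exact edist_le_lintegral_speed (hM.absolutelyContinuous hq) hst

end AbsolutelyContinuousEnergy

end BIPSpaces

end

noncomputable section

namespace BIPSpaces

set_option linter.unusedSectionVars false

/-! ### Operations on test plans -/

section Clamp

variable {X : Type*} [MetricSpace X] {q : ℝ}

lemma continuous_eval_at (t : I) : Continuous (fun γ : Curve X => γ t) := continuous_eval_const t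

/-- The time change that is constant before `s` and after `t`. -/
def clampMap (s t : I) : C(I, I) :=
  ⟨fun r => max s (min t r), by fun_prop⟩

/-- The curve `γ` stopped outside the time interval `[s, t]`. -/
def clampCurve (s t : I) (γ : Curve X) : Curve X := γ.comp (clampMap s t)

lemma clampCurve_apply (s t : I) (γ : Curve X) (r : I) :
    clampCurve s t γ r = γ (max s (min t r)) := rfl

lemma measurable_clampCurve (s t : I) : Measurable (clampCurve s t : Curve X → Curve X) :=
  (ContinuousMap.continuous_precomp (clampMap s t)).measurable

/-- Before s and from t on, the stopped curve is constant on a right neighbourhood of r; in between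
it agrees there with γ. -/
lemma speed_clampCurve_le {s t : I} (γ : Curve X) (r : I) :
    speed (clampCurve s t γ) r ≤ (Icc s t).indicator (speed γ) r := by
  have hzero : (∀ᶠ r' in 𝓝[>] r, clampCurve s t γ r' = clampCurve s t γ r) →
      speed (clampCurve s t γ) r ≤ (Icc s t).indicator (speed γ) r := by
    intro h
    refine le_trans (le_of_le_of_eq (limsup_le_limsup (v := fun _ => 0) ?_) ?_) zero_le
    · filter_upwards [h] with r' hr'
      simp [hr']
    · exact limsup_const_bot
  rcases lt_or_ge r s with hrs | hrs
  · refine hzero ?_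
    filter_upwards [nhdsWithin_le_nhds (Iio_mem_nhds hrs)] with r' hr'
    rw [clampCurve_apply, clampCurve_apply, max_eq_left ((min_le_right _ _).trans hrs.le),
      max_eq_left ((min_le_right _ _).trans (le_of_lt hr'))]
  rcases lt_or_ge r t with hrt | hrt
  · rw [indicator_of_mem (show r ∈ Icc s t from ⟨hrs, hrt.le⟩)]
    refine limsup_le_limsup ?_
    filter_upwards [nhdsWithin_le_nhds (Iio_mem_nhds hrt), self_mem_nhdsWithin] with r' h1 h2
    rw [clampCurve_apply, clampCurve_apply, min_eq_right hrt.le, max_eq_right hrs,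
      min_eq_right (le_of_lt h1), max_eq_right (hrs.trans (le_of_lt h2))]
  · refine hzero ?_
    filter_upwards [self_mem_nhdsWithin] with r' hr'
    rw [clampCurve_apply, clampCurve_apply, min_eq_left hrt,
      min_eq_left (hrt.trans (le_of_lt hr'))]

lemma IsACq.clampCurve {s t : I} {γ : Curve X} (h : IsACq q γ) (hq : 1 < q) :
    IsACq q (clampCurve s t γ) := by
  obtain ⟨g, hg, hγ⟩ := h
  refine ⟨fun r => ‖g r‖, hg.norm, fun a b hab => ?_⟩
  have hint : Integrable g := hg.integrable (by simpa using hq.le)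
  have hnonneg : 0 ≤ ∫ r in Icc a b, ‖g r‖ := integral_nonneg fun _ => norm_nonneg _
  rw [clampCurve_apply, clampCurve_apply]
  by_cases hcase : b ≤ s ∨ t ≤ a
  · have : max s (min t b) = max s (min t a) := by
      rcases hcase with h | h
      · rw [max_eq_left ((min_le_right _ _).trans h),
          max_eq_left ((min_le_right _ _).trans (hab.trans h))]
      · rw [min_eq_left h, min_eq_left (h.trans hab)]
    rw [this, dist_self]
    exact hnonneg
  · push Not at hcase
    refine (hγ _ _ (max_le_max le_rfl (min_le_min le_rfl hab))).trans ?_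
    refine (le_abs_self _).trans ?_
    rw [← Real.norm_eq_abs]
    refine (norm_integral_le_integral_norm _).trans ?_
    refine setIntegral_mono_set hint.norm.integrableOn
      (Eventually.of_forall fun _ => norm_nonneg _) (LE.le.eventuallyLE ?_)
    refine Icc_subset_Icc ?_ ?_
    · rw [min_eq_right hcase.2.le]
      exact le_max_right _ _
    · exact max_le hcase.1.le (min_le_right _ _)

lemma kineticEnergy_clampCurve_le {s t : I} (hq : 1 < q) (γ : Curve X) :
    kineticEnergy q (clampCurve s t γ) ≤ kineticEnergy q γ := by
  by_cases h : IsACq q γ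
  · rw [kineticEnergy, kineticEnergy, if_pos h, if_pos (h.clampCurve hq)]
    refine lintegral_mono fun r => ENNReal.rpow_le_rpow ?_ (zero_le_one.trans hq.le)
    exact (speed_clampCurve_le γ r).trans (indicator_le_self' (fun _ _ => zero_le) r)
  · rw [kineticEnergy, kineticEnergy, if_neg h]
    exact le_top

end Clamp

variable {X : Type*} [MetricSpace X] [MeasurableSpace X] [BorelSpace X]

/-! ### Restricting, stopping and evaluating test plans -/

section Plans

lemma measurable_eval_at (t : I) : Measurable (fun γ : Curve X => γ t) :=
  (continuous_eval_at t).measurable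

lemma measurable_eval [SecondCountableTopology X] :
    Measurable (fun z : Curve X × I => z.1 z.2) := by
  have h : Continuous (fun z : Curve X × I => z.1 z.2) := continuous_eval
  exact h.measurable

variable {m : Measure X} {q : ℝ} {π : Measure (Curve X)}

lemma IsTestPlan.restrict (h : IsTestPlan m q π) {Γ : Set (Curve X)} (hΓ : π Γ ≠ 0) :
    IsTestPlan m q ((π Γ)⁻¹ • π.restrict Γ) := by
  have hp := h.isProbabilityMeasure
  obtain ⟨C, hC⟩ := h.compression
  refine ⟨?_, ⟨(π Γ)⁻¹.toNNReal * C, fun t => ?_⟩, ?_⟩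
  · exact ⟨by simp [ENNReal.inv_mul_cancel hΓ (measure_ne_top π Γ)]⟩
  · have hfin : (π Γ)⁻¹ ≠ ∞ := ENNReal.inv_ne_top.2 hΓ
    rw [Measure.map_smul, mul_smul]
    have h1 : (π.restrict Γ).map (fun γ => γ t) ≤ C • m :=
      (Measure.map_mono Measure.restrict_le_self (measurable_eval_at t)).trans (hC t)
    rw [Measure.le_iff]
    intro s hs
    have h2 := Measure.le_iff.1 h1 s hs
    simp only [Measure.smul_apply, smul_eq_mul, ENNReal.smul_def, ENNReal.coe_toNNReal hfin] at h2 ⊢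
    gcongr
  · rw [lintegral_smul_measure]
    refine ENNReal.mul_lt_top (ENNReal.inv_ne_top.2 hΓ).lt_top ?_
    exact (lintegral_mono' Measure.restrict_le_self le_rfl).trans_lt h.energy

lemma IsTestPlan.clamp (h : IsTestPlan m q π) (hq : 1 < q) (s t : I) :
    IsTestPlan m q (π.map (clampCurve s t)) := by
  have hp := h.isProbabilityMeasure
  obtain ⟨C, hC⟩ := h.compression
  refine ⟨Measure.isProbabilityMeasure_map (measurable_clampCurve s t).aemeasurable,
    ⟨C, fun r => ?_⟩, ?_⟩
  · rw [Measure.map_map (measurable_eval_at r) (measurable_clampCurve s t)]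
    exact hC _
  · refine (lintegral_map_le _ _).trans_lt (lt_of_le_of_lt (lintegral_mono fun γ => ?_) h.energy)
    exact kineticEnergy_clampCurve_le hq γ

lemma IsTestPlan.ae_edist_le [SecondCountableTopology X] (h : IsTestPlan m q π) (hq : 1 < q) :
    ∀ᵐ γ ∂π, ∀ s t : I, s ≤ t → edist (γ s) (γ t) ≤ ∫⁻ r in Icc s t, speed γ r := by
  filter_upwards [ae_isACq_of_lintegral_kineticEnergy hq h.energy] with γ hγ s t hst
  exact hγ.edist_le hq hst

lemma IsTestPlan.lintegral_speed_lt_top (h : IsTestPlan m q π) :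
    ∫⁻ γ, (∫⁻ t, speed γ t ^ q) ∂π < ∞ :=
  (lintegral_mono fun γ => lintegral_speed_le_kineticEnergy q γ).trans_lt h.energy

lemma lintegral_lintegral_eval_le [SecondCountableTopology X] [SFinite π] {C : ℝ≥0}
    (hC : ∀ t : I, π.map (fun γ => γ t) ≤ C • m) {φ : X → ℝ≥0∞} (hφ : Measurable φ) :
    ∫⁻ γ, (∫⁻ t : I, φ (γ t)) ∂π ≤ C * ∫⁻ x, φ x ∂m := by
  have hφm : Measurable (Function.uncurry fun (γ : Curve X) (t : I) => φ (γ t)) :=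
    hφ.comp measurable_eval
  rw [lintegral_lintegral_swap hφm.aemeasurable]
  calc ∫⁻ t : I, (∫⁻ γ, φ (γ t) ∂π) ≤ ∫⁻ _ : I, C * ∫⁻ x, φ x ∂m := by
        refine lintegral_mono fun t => ?_
        rw [← lintegral_map hφ (measurable_eval_at t)]
        refine (lintegral_mono' (hC t) le_rfl).trans (le_of_eq ?_)
        rw [lintegral_smul_measure]
        rfl
    _ = C * ∫⁻ x, φ x ∂m := by simp

/-- By compression and Fubini, almost every curve spends no time in an m-null set. Hence (∗) does
not depend on the representative of G. -/
lemma IsTestPlan.ae_ae_of_ae [SecondCountableTopology X] (h : IsTestPlan m q π) {P : X → Prop}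
    (hP : ∀ᵐ x ∂m, P x) : ∀ᵐ γ ∂π, ∀ᵐ t : I, P (γ t) := by
  have hp := h.isProbabilityMeasure
  obtain ⟨C, hC⟩ := h.compression
  have hmeas := measurableSet_toMeasurable m {x | ¬ P x}
  set N := toMeasurable m {x | ¬ P x} with hN
  have hN0 : m N = 0 := by rw [hN, measure_toMeasurable]; exact hP
  have h1 := lintegral_lintegral_eval_le hC (measurable_one.indicator hmeas)
  rw [lintegral_indicator_one hmeas, hN0, mul_zero, nonpos_iff_eq_zero] at h1
  have hmφ : Measurable (fun z : Curve X × I => N.indicator (1 : X → ℝ≥0∞) (z.1 z.2)) :=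
    (measurable_one.indicator hmeas).comp measurable_eval
  rw [lintegral_eq_zero_iff hmφ.lintegral_prod_right'] at h1
  filter_upwards [h1] with γ hγ
  have hmγ : Measurable (fun t : I => N.indicator (1 : X → ℝ≥0∞) (γ t)) :=
    (measurable_one.indicator hmeas).comp γ.continuous.measurable
  rw [Pi.zero_apply, lintegral_eq_zero_iff hmγ] at hγ
  filter_upwards [hγ] with t ht
  by_contra hcon
  have : γ t ∈ N := subset_toMeasurable m _ hcon
  simp [indicator_of_mem this] at ht

end Plans

/-! ### From fixed pairs of times to whole curves -/

section CurvewiseBounds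

variable [SecondCountableTopology X] {π : Measure (Curve X)}

lemma measurable_setLIntegral_uIcc {h : Curve X → I → ℝ≥0∞}
    (hh : Measurable (Function.uncurry h)) (s : I) :
    Measurable (fun z : Curve X × I => ∫⁻ r in Icc (min s z.2) (max s z.2), h z.1 r) := by
  have hset : MeasurableSet {y : (Curve X × I) × I | y.2 ∈ Icc (min s y.1.2) (max s y.1.2)} := by
    have m1 : Measurable fun y : (Curve X × I) × I => min s y.1.2 :=
      measurable_const.min (measurable_snd.comp measurable_fst)
    have m2 : Measurable fun y : (Curve X × I) × I => max s y.1.2 :=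
      measurable_const.max (measurable_snd.comp measurable_fst)
    have m3 : Measurable fun y : (Curve X × I) × I => y.2 := measurable_snd
    have s1 : MeasurableSet {y : (Curve X × I) × I | min s y.1.2 ≤ y.2} := measurableSet_le m1 m3
    have s2 : MeasurableSet {y : (Curve X × I) × I | y.2 ≤ max s y.1.2} := measurableSet_le m3 m2
    exact s1.inter s2
  have hmeas : Measurable fun y : (Curve X × I) × I => h y.1.1 y.2 :=
    hh.comp ((measurable_fst.comp measurable_fst).prodMk measurable_snd)
  have := (hmeas.indicator hset).lintegral_prod_right' (ν := (volume : Measure I))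
  convert this using 2 with z
  rw [← lintegral_indicator measurableSet_Icc]
  rfl

lemma setLIntegral_Icc_add_Icc {s r t : I} (hsr : s ≤ r) (hrt : r ≤ t) (h : I → ℝ≥0∞) :
    (∫⁻ x in Icc s r, h x) + ∫⁻ x in Icc r t, h x = ∫⁻ x in Icc s t, h x := by
  rw [← setLIntegral_congr (Ioc_ae_eq_Icc (a := r) (b := t)),
    ← lintegral_union measurableSet_Ioc, Icc_union_Ioc_eq_Icc hsr hrt]
  rw [Set.disjoint_left]
  intro x hx hx'
  exact absurd hx.2 (not_le.2 hx'.1)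

/-- The null set in the hypothesis depends on s and t. By Fubini, for almost every curve the bound
holds between almost every time and all points of a countable dense set Q; two such times are then
compared through a point of Q between them. -/
lemma ae_hasCurveBound [SFinite π] {f : X → ℝ} (hf : Measurable f) {h : Curve X → I → ℝ≥0∞}
    (hh : Measurable (Function.uncurry h)) (hfin : ∀ᵐ γ ∂π, ∫⁻ t, h γ t ≠ ∞)
    (hle : ∀ s t : I, s ≤ t →
      ∀ᵐ γ ∂π, ENNReal.ofReal |f (γ t) - f (γ s)| ≤ ∫⁻ r in Icc s t, h γ r) :
    ∀ᵐ γ ∂π, HasCurveBound (fun t => f (γ t)) (h γ) := by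
  let P : I → Curve X → I → Prop := fun s γ t =>
    ENNReal.ofReal |f (γ t) - f (γ s)| ≤ ∫⁻ r in Icc (min s t) (max s t), h γ r
  have hP : ∀ s t, ∀ᵐ γ ∂π, P s γ t := by
    intro s t
    rcases le_total s t with hst | hst
    · simp only [P, min_eq_left hst, max_eq_right hst]
      exact hle s t hst
    · simp only [P, min_eq_right hst, max_eq_left hst]
      filter_upwards [hle t s hst] with γ hγ
      rwa [abs_sub_comm]
  have hPm : ∀ s, MeasurableSet {z : Curve X × I | P s z.1 z.2} := by
    intro s
    refine measurableSet_le ?_ (measurable_setLIntegral_uIcc hh s)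
    refine ENNReal.measurable_ofReal.comp (continuous_abs.measurable.comp ?_)
    exact (hf.comp measurable_eval).sub (hf.comp ((measurable_eval_at s).comp measurable_fst))
  have hP' : ∀ s, ∀ᵐ γ ∂π, ∀ᵐ t : I, P s γ t := by
    intro s
    rw [Measure.ae_ae_comm (hPm s)]
    exact Eventually.of_forall fun t => hP s t
  -- The points 0 and 1 are added so that they belong to the good set of times.
  let Q : Set I := {0, 1} ∪ range (TopologicalSpace.denseSeq I)
  have hQc : Q.Countable := ((countable_singleton 1).insert 0).union (countable_range _)
  have hQd : Dense Q := (TopologicalSpace.denseRange_denseSeq I).mono subset_union_right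
  have h1 : ∀ᵐ γ ∂π, ∀ s ∈ Q, ∀ t ∈ Q, P s γ t :=
    (ae_ball_iff hQc).2 fun s _ => (ae_ball_iff hQc).2 fun t _ => hP s t
  have h2 : ∀ᵐ γ ∂π, ∀ s ∈ Q, ∀ᵐ t : I, P s γ t := (ae_ball_iff hQc).2 fun s _ => hP' s
  filter_upwards [h1, h2, hfin] with γ hγ1 hγ2 hγ3
  have hm : Measurable (h γ) := hh.of_uncurry_left
  refine hasCurveBound_of_increments (T := {t | ∀ s ∈ Q, P s γ t}) hm hγ3
    (fun s hs => hγ1 s hs 0 (by simp [Q])) (fun s hs => hγ1 s hs 1 (by simp [Q]))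
    ((ae_ball_iff hQc).2 hγ2) ?_
  intro s hs t ht hst
  rcases hst.eq_or_lt with rfl | hlt
  · simp
  obtain ⟨r, hrQ, hr1, hr2⟩ := hQd.exists_between hlt
  have e1 := hs r hrQ
  have e2 := ht r hrQ
  simp only [P, min_eq_right hr1.le, max_eq_left hr1.le] at e1
  simp only [P, min_eq_left hr2.le, max_eq_right hr2.le] at e2
  rw [← setLIntegral_Icc_add_Icc hr1.le hr2.le]
  refine le_trans ?_ (add_le_add e1 e2)
  rw [← ENNReal.ofReal_add (abs_nonneg _) (abs_nonneg _)]
  refine ENNReal.ofReal_le_ofReal ?_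
  rw [abs_sub_comm (f (γ s)), add_comm]
  exact abs_sub_le _ _ _

end CurvewiseBounds

end BIPSpaces

end

noncomputable section

namespace BIPSpaces

set_option linter.unusedSectionVars false

variable {X : Type*} [MetricSpace X] [MeasurableSpace X] [BorelSpace X]

/-! ### Weak upper gradients along curves -/

section WeakUpperGradients

/-- The integrand `G(γ_t) |γ̇_t|`. -/
def gradAlong (G : X → ℝ) (γ : Curve X) (t : I) : ℝ≥0∞ := ENNReal.ofReal (G (γ t)) * speed γ t

variable [SecondCountableTopology X] {m : Measure X} {p q : ℝ} {π : Measure (Curve X)}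
  {f u v G H : X → ℝ}

lemma measurable_gradAlong (hG : Measurable G) :
    Measurable (Function.uncurry (gradAlong G : Curve X → I → ℝ≥0∞)) :=
  (ENNReal.measurable_ofReal.comp (hG.comp measurable_eval)).mul measurable_speed

lemma lintegral_ofReal_rpow_lt_top (hp : 0 < p) (hG : MemLp G (ENNReal.ofReal p) m) :
    ∫⁻ x, ENNReal.ofReal (G x) ^ p ∂m < ∞ := by
  have := lintegral_rpow_enorm_lt_top_of_eLpNorm_lt_top (p := ENNReal.ofReal p) (by simpa)
      ENNReal.ofReal_ne_top hG.2
  rw [ENNReal.toReal_ofReal hp.le] at this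
  refine lt_of_le_of_lt (lintegral_mono fun x => ?_) this
  gcongr
  rw [Real.enorm_eq_ofReal_abs]
  exact ENNReal.ofReal_le_ofReal (le_abs_self _)

lemma IsTestPlan.ae_lintegral_speed_lt_top (h : IsTestPlan m q π) :
    ∀ᵐ γ ∂π, ∫⁻ t, speed γ t ^ q < ∞ := by
  have hm : Measurable (fun γ : Curve X => ∫⁻ t, speed γ t ^ q) :=
    (measurable_speed.pow_const q).lintegral_prod_right'
  exact ae_lt_top hm h.lintegral_speed_lt_top.ne

lemma IsTestPlan.ae_ae_speed_lt_top (h : IsTestPlan m q π) (hq : 1 < q) :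
    ∀ᵐ γ ∂π, ∀ᵐ t, speed γ t < ∞ := by
  filter_upwards [h.ae_lintegral_speed_lt_top] with γ hγ
  filter_upwards [ae_lt_top ((measurable_speed_curve γ).pow_const q) hγ.ne] with t ht
  by_contra hcon
  rw [not_lt, top_le_iff] at hcon
  rw [hcon, ENNReal.top_rpow_of_pos (zero_lt_one.trans hq)] at ht
  exact lt_irrefl _ ht

/-- Young's inequality splits the integrand into G^p, integrable by compression, and |γ̇|^q,
integrable by the energy bound. -/
lemma IsTestPlan.ae_lintegral_gradAlong_ne_top (hp : 1 < p)
    (h : IsTestPlan m p.conjExponent π) (hGm : Measurable G)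
    (hG : MemLp G (ENNReal.ofReal p) m) : ∀ᵐ γ ∂π, ∫⁻ t, gradAlong G γ t ≠ ∞ := by
  have hprob := h.isProbabilityMeasure
  have hpq := Real.HolderConjugate.conjExponent hp
  obtain ⟨C, hC⟩ := h.compression
  have hφ : Measurable fun x => ENNReal.ofReal (G x) ^ p :=
    (ENNReal.measurable_ofReal.comp hGm).pow_const p
  have h1 := (lintegral_lintegral_eval_le hC hφ).trans_lt
    (ENNReal.mul_lt_top ENNReal.coe_lt_top (lintegral_ofReal_rpow_lt_top hpq.pos hG))
  have hm : Measurable (fun γ : Curve X => ∫⁻ t, ENNReal.ofReal (G (γ t)) ^ p) :=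
    (hφ.comp measurable_eval).lintegral_prod_right'
  filter_upwards [ae_lt_top hm h1.ne, h.ae_lintegral_speed_lt_top] with γ hγ1 hγ2
  have hmγ : Measurable fun t : I => ENNReal.ofReal (G (γ t)) ^ p :=
    hφ.comp γ.continuous.measurable
  refine ne_top_of_le_ne_top (b := ∫⁻ t, (ENNReal.ofReal (G (γ t)) ^ p / ENNReal.ofReal p +
    speed γ t ^ p.conjExponent / ENNReal.ofReal p.conjExponent)) ?_
    (lintegral_mono fun t => ENNReal.young_inequality _ _ hpq)
  rw [lintegral_add_left (hmγ.div_const _)]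
  simp only [div_eq_mul_inv]
  rw [lintegral_mul_const _ hmγ, lintegral_mul_const _ ((measurable_speed_curve γ).pow_const _)]
  refine (ENNReal.add_lt_top.2 ⟨ENNReal.mul_lt_top hγ1 ?_, ENNReal.mul_lt_top hγ2 ?_⟩).ne
  · exact (ENNReal.inv_ne_top.2 (by simpa using hpq.pos)).lt_top
  · exact (ENNReal.inv_ne_top.2 (by simpa using hpq.symm.pos)).lt_top

lemma IsTestPlan.planInequality_congr (h : IsTestPlan m q π) (hGH : G =ᵐ[m] H)
    (hG : PlanInequality π f G) : PlanInequality π f H := by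
  refine hG.trans (le_of_eq (lintegral_congr_ae ?_))
  filter_upwards [h.ae_ae_of_ae hGH] with γ hγ
  refine lintegral_congr_ae ?_
  filter_upwards [hγ] with t ht
  rw [ht]

/-- Restricting in time and to sets of curves turns the integral inequality for all test plans into
an inequality along almost every curve. -/
lemma ae_le_lintegral_gradAlong (hq : 1 < q) (hπ : IsTestPlan m q π) (hf : Measurable f)
    (hG : ∀ π : Measure (Curve X), IsTestPlan m q π → PlanInequality π f G) (s t : I)
    (hst : s ≤ t) :
    ∀ᵐ γ ∂π, ENNReal.ofReal |f (γ t) - f (γ s)| ≤ ∫⁻ r in Icc s t, gradAlong G γ r := by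
  have hprob := hπ.isProbabilityMeasure
  have hmeas : Measurable fun γ : Curve X => ENNReal.ofReal |f (γ t) - f (γ s)| :=
    ENNReal.measurable_ofReal.comp (continuous_abs.measurable.comp
      ((hf.comp (measurable_eval_at t)).sub (hf.comp (measurable_eval_at s))))
  refine ae_le_of_forall_setLIntegral_le_of_sigmaFinite hmeas fun Γ _ _ => ?_
  by_cases hΓ0 : π Γ = 0
  · simp [Measure.restrict_eq_zero.2 hΓ0]
  -- The tested plan is π conditioned on Γ, with its curves stopped outside [s,t]; the normalizing
  -- factor cancels from both sides.
  have h1 := hG _ ((hπ.restrict hΓ0).clamp hq s t)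
  unfold PlanInequality at h1
  have hmeas' : Measurable fun γ : Curve X => ENNReal.ofReal |f (γ 1) - f (γ 0)| :=
    ENNReal.measurable_ofReal.comp (continuous_abs.measurable.comp
      ((hf.comp (measurable_eval_at 1)).sub (hf.comp (measurable_eval_at 0))))
  rw [lintegral_map hmeas' (measurable_clampCurve s t)] at h1
  have h2 := h1.trans (lintegral_map_le _ _)
  rw [lintegral_smul_measure, lintegral_smul_measure, smul_eq_mul, smul_eq_mul,
    ENNReal.mul_le_mul_iff_right (ENNReal.inv_ne_zero.2 (measure_ne_top π Γ))
      (ENNReal.inv_ne_top.2 hΓ0)] at h2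
  have e0 : ∀ γ : Curve X, clampCurve s t γ 0 = γ s := fun γ => by
    rw [clampCurve_apply, max_eq_left ((min_le_right t 0).trans (unitInterval.nonneg' (t := s)))]
  have e1 : ∀ γ : Curve X, clampCurve s t γ 1 = γ t := fun γ => by
    rw [clampCurve_apply, min_eq_left (unitInterval.le_one' (t := t)), max_eq_right hst]
  simp only [e0, e1] at h2
  refine h2.trans (lintegral_mono fun γ => ?_)
  rw [← lintegral_indicator measurableSet_Icc]
  refine lintegral_mono fun r => ?_
  refine (mul_le_mul' le_rfl (speed_clampCurve_le γ r)).trans ?_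
  by_cases hr : r ∈ Icc s t
  · rw [indicator_of_mem hr, indicator_of_mem hr, clampCurve_apply, min_eq_right hr.2,
      max_eq_right hr.1]
    rfl
  · simp [indicator_of_notMem hr]

/-- Passage from plans to curves. G is only almost everywhere measurable, so a measurable
representative is used and exchanged back at the end. -/
lemma IsWeakUpperGradient.ae_hasCurveBound (hp : 1 < p) (hf : Measurable f)
    (hG : IsWeakUpperGradient m p f G) (hπ : IsTestPlan m p.conjExponent π) :
    ∀ᵐ γ ∂π, HasCurveBound (fun t => f (γ t)) (gradAlong G γ) := by
  have hprob := hπ.isProbabilityMeasure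
  have hq : 1 < p.conjExponent := (Real.HolderConjugate.conjExponent hp).symm.lt
  set G' := hG.memLp.1.mk G with hG'
  have hGG' : G =ᵐ[m] G' := hG.memLp.1.ae_eq_mk
  have hG'm : Measurable G' := hG.memLp.1.stronglyMeasurable_mk.measurable
  have h1 := BIPSpaces.ae_hasCurveBound hf (measurable_gradAlong hG'm)
    (hπ.ae_lintegral_gradAlong_ne_top hp hG'm (hG.memLp.ae_eq hGG'))
    (ae_le_lintegral_gradAlong hq hπ hf fun π' h' =>
      h'.planInequality_congr hGG' (hG.le π' h'))
  filter_upwards [h1, hπ.ae_ae_of_ae hGG'] with γ hγ1 hγ2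
  refine hγ1.mono_ae ?_
  filter_upwards [hγ2] with t ht
  rw [gradAlong, gradAlong, ht]

lemma planInequality_of_ae_hasCurveBound
    (h : ∀ᵐ γ ∂π, HasCurveBound (fun t => f (γ t)) (gradAlong G γ)) : PlanInequality π f G := by
  refine lintegral_mono_ae ?_
  filter_upwards [h] with γ hγ using hγ.ofReal_abs_sub_le

lemma isWeakUpperGradient_const (c : ℝ) : IsWeakUpperGradient m p (fun _ => c) 0 :=
  ⟨EventuallyLE.rfl, MemLp.zero, fun π _ => by simp [PlanInequality]⟩

lemma IsWeakUpperGradient.mono_increments (hG : IsWeakUpperGradient m p f G)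
    (huf : ∀ x y, |u x - u y| ≤ |f x - f y|) : IsWeakUpperGradient m p u G := by
  refine ⟨hG.nonneg, hG.memLp, fun π hπ => le_trans (lintegral_mono fun γ => ?_) (hG.le π hπ)⟩
  exact ENNReal.ofReal_le_ofReal (huf _ _)

/-- Weak upper gradients localize: on the set where `u = v` a weak upper gradient of `u` can be
lowered to one of `v`. -/
lemma IsWeakUpperGradient.of_eq_on (hp : 1 < p) (hu : Measurable u) (hv : Measurable v)
    (hG : IsWeakUpperGradient m p u G) (hH : IsWeakUpperGradient m p v H) :
    IsWeakUpperGradient m p u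
      (fun x => G x - {x | u x = v x}.indicator (fun x => max (G x - H x) 0) x) := by
  -- This is min(G, H) on {u = v} and G elsewhere.
  set K : X → ℝ := fun x => G x - {x | u x = v x}.indicator (fun x => max (G x - H x) 0) x with hK
  have hKeq : ∀ x, u x = v x → K x = min (G x) (H x) := by
    intro x hx
    simp only [hK]
    rw [indicator_of_mem (show x ∈ {x | u x = v x} from hx)]
    rcases le_total (G x) (H x) with h | h
    · rw [max_eq_right (by linarith), min_eq_left h, sub_zero]
    · rw [max_eq_left (by linarith), min_eq_right h]
      ring
  have hKne : ∀ x, u x ≠ v x → K x = G x := by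
    intro x hx
    simp only [hK]
    rw [indicator_of_notMem (show x ∉ {x | u x = v x} from hx), sub_zero]
  have hq : 1 < p.conjExponent := (Real.HolderConjugate.conjExponent hp).symm.lt
  have hset : MeasurableSet {x | u x = v x} := measurableSet_eq_fun hu hv
  have hK0 : 0 ≤ᵐ[m] K := by
    filter_upwards [hG.nonneg, hH.nonneg] with x h1 h2
    by_cases hx : u x = v x
    · rw [hKeq x hx]
      exact le_min h1 h2
    · rw [hKne x hx]
      exact h1
  refine ⟨hK0, ?_, fun π hπ => ?_⟩
  · refine hG.memLp.of_le ?_ ?_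
    · refine hG.memLp.1.sub (AEStronglyMeasurable.indicator ?_ hset)
      exact ((hG.memLp.1.aemeasurable.sub hH.memLp.1.aemeasurable).max
        aemeasurable_const).aestronglyMeasurable
    · filter_upwards [hG.nonneg, hK0] with x h1 h2
      rw [Real.norm_of_nonneg h1, Real.norm_of_nonneg h2]
      by_cases hx : u x = v x
      · rw [hKeq x hx]
        exact min_le_left _ _
      · rw [hKne x hx]
  · refine planInequality_of_ae_hasCurveBound ?_
    filter_upwards [hG.ae_hasCurveBound hp hu hπ, hH.ae_hasCurveBound hp hv hπ] with γ h1 h2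
    refine h1.of_eq_on h2 (Eventually.of_forall fun t ht => ?_)
      (Eventually.of_forall fun t ht => ?_)
    · rw [gradAlong, gradAlong, hKne _ ht]
    · rw [gradAlong, gradAlong, gradAlong, hKeq _ ht]
      rcases le_total (G (γ t)) (H (γ t)) with h | h
      · rw [min_eq_left h]
        exact min_le_left _ _
      · rw [min_eq_right h]
        exact min_le_right _ _

lemma IsWeakUpperGradient.iInf (hp : 1 < p) (hf : Measurable f) {G : ℕ → X → ℝ}
    (hG : ∀ n, IsWeakUpperGradient m p f (G n)) :
    IsWeakUpperGradient m p f (fun x => ⨅ n, G n x) := by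
  have hq : 1 < p.conjExponent := (Real.HolderConjugate.conjExponent hp).symm.lt
  have hpos := ae_all_iff.2 fun n => (hG n).nonneg
  have h0 : 0 ≤ᵐ[m] fun x => ⨅ n, G n x := by
    filter_upwards [hpos] with x hx using le_ciInf hx
  refine ⟨h0, ?_, fun π hπ => planInequality_of_ae_hasCurveBound ?_⟩
  · refine (hG 0).memLp.of_le
      (AEMeasurable.iInf fun n => (hG n).memLp.1.aemeasurable).aestronglyMeasurable ?_
    filter_upwards [h0, hpos] with x h1 h2
    rw [Real.norm_of_nonneg h1, Real.norm_of_nonneg (h2 0)]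
    exact ciInf_le ⟨0, by rintro _ ⟨n, rfl⟩; exact h2 n⟩ 0
  · filter_upwards [ae_all_iff.2 fun n => (hG n).ae_hasCurveBound hp hf hπ,
      hπ.ae_ae_speed_lt_top hq] with γ h1 h2
    refine (HasCurveBound.iInf h1).mono_ae ?_
    filter_upwards [h2] with t ht
    simp only [gradAlong]
    rw [ENNReal.ofReal_iInf, ENNReal.iInf_mul fun h => absurd h ht.ne]

/-- The pointwise infimum of a minimizing sequence is again a weak upper gradient and has norm at
most that of each term, so no weak compactness is required. -/
lemma exists_isMinimalWeakUpperGradient (hp : 1 < p) (h : InSobolevClass m p f) :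
    ∃ G, IsMinimalWeakUpperGradient m p f G := by
  obtain ⟨hf, G₀, hG₀⟩ := h
  set S : Set ℝ≥0∞ := (fun G => eLpNorm G (ENNReal.ofReal p) m) '' {G | IsWeakUpperGradient m p f G}
  have hS : S.Nonempty := ⟨_, G₀, hG₀, rfl⟩
  obtain ⟨a, -, ha, haS⟩ := exists_seq_tendsto_sInf hS (OrderBot.bddBelow S)
  choose G hG hGa using haS
  refine ⟨fun x => ⨅ n, G n x, IsWeakUpperGradient.iInf hp hf hG, fun G' hG' => ?_⟩
  have hle : ∀ n, eLpNorm (fun x => ⨅ n, G n x) (ENNReal.ofReal p) m ≤ a n := by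
    intro n
    rw [← hGa n]
    refine eLpNorm_mono_ae ?_
    filter_upwards [ae_all_iff.2 fun n => (hG n).nonneg] with x hx
    rw [Real.norm_of_nonneg (le_ciInf hx), Real.norm_of_nonneg (hx n)]
    exact ciInf_le ⟨0, by rintro _ ⟨n, rfl⟩; exact hx n⟩ n
  refine (ge_of_tendsto' ha hle).trans (sInf_le ⟨G', hG', rfl⟩)

lemma isMinimalWeakUpperGradient_minGrad (hp : 1 < p) (h : InSobolevClass m p f) :
    IsMinimalWeakUpperGradient m p f (minGrad m p f) := by
  have hex := exists_isMinimalWeakUpperGradient hp h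
  rw [minGrad, dif_pos hex]
  exact hex.choose_spec

lemma isWeakUpperGradient_minGrad (hp : 1 < p) (h : InSobolevClass m p f) :
    IsWeakUpperGradient m p f (minGrad m p f) :=
  (isMinimalWeakUpperGradient_minGrad hp h).1

lemma ae_eq_of_le_of_eLpNorm_le (hp : 0 < p) (hG : MemLp G (ENNReal.ofReal p) m)
    (hH : MemLp H (ENNReal.ofReal p) m) (h0 : 0 ≤ᵐ[m] H) (hle : H ≤ᵐ[m] G)
    (hn : eLpNorm G (ENNReal.ofReal p) m ≤ eLpNorm H (ENNReal.ofReal p) m) : H =ᵐ[m] G := by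
  have hp0 : ENNReal.ofReal p ≠ 0 := by simpa
  rw [eLpNorm_eq_lintegral_rpow_enorm_toReal hp0 ENNReal.ofReal_ne_top,
    eLpNorm_eq_lintegral_rpow_enorm_toReal hp0 ENNReal.ofReal_ne_top,
    ENNReal.toReal_ofReal hp.le, ENNReal.rpow_le_rpow_iff (by positivity)] at hn
  have hfin : ∫⁻ x, ‖H x‖ₑ ^ p ∂m ≠ ∞ := by
    have := lintegral_rpow_enorm_lt_top_of_eLpNorm_lt_top hp0 ENNReal.ofReal_ne_top hH.2
    rw [ENNReal.toReal_ofReal hp.le] at this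
    exact this.ne
  have h1 : (fun x => ‖H x‖ₑ ^ p) =ᵐ[m] fun x => ‖G x‖ₑ ^ p := by
    refine ae_eq_of_ae_le_of_lintegral_le ?_ hfin (hG.1.enorm.pow_const p) hn
    filter_upwards [h0, hle] with x hx1 hx2
    refine ENNReal.rpow_le_rpow ?_ hp.le
    rw [Real.enorm_eq_ofReal hx1, Real.enorm_eq_ofReal (hx1.trans hx2)]
    exact ENNReal.ofReal_le_ofReal hx2
  filter_upwards [h0, hle, h1] with x hx1 hx2 hx3
  have hx3' := (ENNReal.rpow_left_injective hp.ne') hx3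
  rw [Real.enorm_eq_ofReal hx1, Real.enorm_eq_ofReal (hx1.trans hx2)] at hx3'
  exact (ENNReal.ofReal_eq_ofReal_iff hx1 (hx1.trans hx2)).1 hx3'

/-- Locality of the minimal weak upper gradient. -/
lemma minGrad_le_of_eq_on (hp : 1 < p) (hu : InSobolevClass m p u) (hv : Measurable v)
    (hH : IsWeakUpperGradient m p v H) : ∀ᵐ x ∂m, u x = v x → minGrad m p u x ≤ H x := by
  have hmin := isMinimalWeakUpperGradient_minGrad hp hu
  have hK := hmin.1.of_eq_on hp hu.1 hv hH
  -- The lowered gradient lies below the minimal one and has no smaller norm, so they coincide and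
  -- the subtracted term vanishes.
  have h1 := ae_eq_of_le_of_eLpNorm_le (zero_lt_one.trans hp) hmin.1.memLp hK.memLp hK.nonneg
    (Eventually.of_forall fun x => by
      simp only [sub_le_self_iff]
      exact indicator_nonneg (fun _ _ => le_max_right _ _) _) (hmin.2 _ hK)
  filter_upwards [h1] with x hx hux
  rw [indicator_of_mem (show x ∈ {x | u x = v x} from hux), sub_eq_self] at hx
  have := le_max_left (minGrad m p u x - H x) 0
  linarith

lemma minGrad_le (hp : 1 < p) (hf : Measurable f) (hG : IsWeakUpperGradient m p f G) :
    minGrad m p f ≤ᵐ[m] G := by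
  filter_upwards [minGrad_le_of_eq_on hp ⟨hf, G, hG⟩ hf hG] with x hx using hx rfl

lemma minGrad_nonneg (hp : 1 < p) (h : InSobolevClass m p f) : 0 ≤ᵐ[m] minGrad m p f :=
  (isWeakUpperGradient_minGrad hp h).nonneg

lemma minGrad_eq_of_eq_on (hp : 1 < p) (hu : InSobolevClass m p u) (hv : InSobolevClass m p v) :
    ∀ᵐ x ∂m, u x = v x → minGrad m p u x = minGrad m p v x := by
  filter_upwards [minGrad_le_of_eq_on hp hu hv.1 (isWeakUpperGradient_minGrad hp hv),
    minGrad_le_of_eq_on hp hv hu.1 (isWeakUpperGradient_minGrad hp hu)] with x h1 h2 hx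
  exact le_antisymm (h1 hx) (h2 hx.symm)

lemma minGrad_le_zero_of_eq_const (hp : 1 < p) (hu : InSobolevClass m p u) (c : ℝ) :
    ∀ᵐ x ∂m, u x = c → minGrad m p u x ≤ 0 :=
  minGrad_le_of_eq_on hp hu measurable_const (isWeakUpperGradient_const c)

end WeakUpperGradients

end BIPSpaces

end

noncomputable section

namespace BIPSpaces

set_option linter.unusedSectionVars false

/-! ### Lipschitz cutoffs and the local Sobolev class -/

section Cutoff

variable {X : Type*} [MetricSpace X]

/-- The Lipschitz cutoff function that is `1` on the ball of radius `R` and vanishes outside the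
ball of radius `R + 1`. -/
def bump (x₀ : X) (R : ℝ) (x : X) : ℝ := max 0 (min 1 (R + 1 - dist x x₀))

lemma bump_eq_one {x₀ x : X} {R : ℝ} (h : dist x x₀ ≤ R) : bump x₀ R x = 1 := by
  rw [bump, min_eq_left (by linarith), max_eq_right zero_le_one]

lemma isLipBS_bump (x₀ : X) (R : ℝ) : IsLipBS (bump x₀ R) := by
  refine ⟨⟨1, ?_⟩, (Metric.isBounded_closedBall (x := x₀) (r := R + 1)).subset fun x hx => ?_⟩
  · have h1 : LipschitzWith 1 fun x : X => R + 1 - dist x x₀ := by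
      refine LipschitzWith.of_dist_le_mul fun x y => ?_
      rw [Real.dist_eq, NNReal.coe_one, one_mul, sub_sub_sub_cancel_left, dist_comm x y]
      exact abs_dist_sub_le _ _ _
    exact (h1.const_min 1).const_max 0
  · by_contra hcon
    rw [Metric.mem_closedBall, not_le] at hcon
    refine hx ?_
    rw [bump, max_eq_left ((min_le_right _ _).trans (by linarith))]

lemma IsLipBS.exists_bound {η : X → ℝ} (h : IsLipBS η) : ∃ B : ℝ, ∀ x, |η x| ≤ B := by
  obtain ⟨⟨L, hL⟩, hb⟩ := h
  rcases (Function.support η).eq_empty_or_nonempty with he | ⟨x₀, -⟩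
  · refine ⟨0, fun x => ?_⟩
    rw [Function.support_eq_empty_iff.1 he]
    simp
  · obtain ⟨R, hR⟩ := hb.subset_closedBall x₀
    refine ⟨max 0 (|η x₀| + L * R), fun x => ?_⟩
    by_cases hx : η x = 0
    · rw [hx, abs_zero]
      exact le_max_left _ _
    · refine le_max_of_le_right ?_
      have h1 := hL.dist_le_mul x x₀
      rw [Real.dist_eq] at h1
      have h2 : dist x x₀ ≤ R := hR hx
      have h3 := mul_le_mul_of_nonneg_left h2 L.2
      have h4 := abs_sub_abs_le_abs_sub (η x) (η x₀)
      have h5 : (L : ℝ) * dist x x₀ ≤ L * R := h3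
      linarith

lemma IsLipBS.continuous {η : X → ℝ} (h : IsLipBS η) : Continuous η :=
  h.1.choose_spec.continuous

lemma abs_trunc_le {k : ℝ} (hk : 0 < k) (a : ℝ) : |min k (max a (-k))| ≤ k :=
  abs_le.2 ⟨le_min (by linarith) (le_max_right _ _), min_le_left _ _⟩

lemma abs_trunc_sub_trunc_le (k a b : ℝ) :
    |min k (max a (-k)) - min k (max b (-k))| ≤ |a - b| := by
  refine (abs_min_sub_min_le_max _ _ _ _).trans (max_le (by simp) ?_)
  exact (abs_max_sub_max_le_max _ _ _ _).trans (max_le le_rfl (by simp))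

lemma trunc_eq_self {k a : ℝ} (h : |a| < k) : min k (max a (-k)) = a := by
  have := abs_lt.1 h
  rw [max_eq_left this.1.le, min_eq_right this.2.le]

lemma cutoff_eq_self {η f : X → ℝ} {k : ℝ} {x : X} (hη : η x = 1) (hf : |f x| < k) :
    cutoff η k f x = f x := by
  rw [cutoff, hη, one_mul, trunc_eq_self hf]

lemma abs_cutoff_le {η f : X → ℝ} {k B : ℝ} (hk : 0 < k) (hη : ∀ x, |η x| ≤ B) (x : X) :
    |cutoff η k f x| ≤ B * k := by
  rw [cutoff, abs_mul]
  exact mul_le_mul (hη x) (abs_trunc_le hk _) (abs_nonneg _) ((abs_nonneg _).trans (hη x))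

lemma bump_bound (x₀ : X) (R : ℝ) (x : X) : |bump x₀ R x| ≤ 1 := by
  rw [bump, abs_of_nonneg (le_max_left _ _)]
  exact max_le zero_le_one (min_le_left _ _)

end Cutoff

variable {X : Type*} [MetricSpace X] [MeasurableSpace X] [BorelSpace X]
  {m : Measure X} {p p₁ p₂ : ℝ} {f u v G H : X → ℝ}

/-! ### Leibniz rule, gluing of local gradients, and passage to global gradients -/

section LocalClass

lemma measurable_trunc (hf : Measurable f) (k : ℝ) :
    Measurable fun x => min k (max (f x) (-k)) :=
  measurable_const.min (hf.max measurable_const)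

lemma measurable_cutoff {η : X → ℝ} (hη : IsLipBS η) (hf : Measurable f) (k : ℝ) :
    Measurable (cutoff η k f) :=
  hη.continuous.measurable.mul (measurable_trunc hf k)

lemma memLp_indicator_const_of_isBounded (hfin : BoundedlyFinite m) {s : Set X}
    (hs : MeasurableSet s) (hb : Bornology.IsBounded s) (c : ℝ) (r : ℝ≥0∞) :
    MemLp (s.indicator fun _ => c) r m :=
  memLp_indicator_const r hs c (Or.inr (hfin s hb).ne)

lemma memLp_cutoff (hfin : BoundedlyFinite m) {η : X → ℝ} (hη : IsLipBS η) (hf : Measurable f)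
    {k : ℝ} (hk : 0 < k) (r : ℝ≥0∞) : MemLp (cutoff η k f) r m := by
  obtain ⟨B, hB⟩ := hη.exists_bound
  have hs : MeasurableSet (Function.support η) := measurableSet_support hη.continuous.measurable
  refine (memLp_indicator_const_of_isBounded hfin hs hη.2 (B * k) r).mono'
    (measurable_cutoff hη hf k).aestronglyMeasurable (Eventually.of_forall fun x => ?_)
  by_cases hx : x ∈ Function.support η
  · rw [indicator_of_mem hx]
    exact abs_cutoff_le hk hB x
  · rw [indicator_of_notMem hx, cutoff, Function.notMem_support.1 hx, zero_mul, norm_zero]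

variable [SecondCountableTopology X]

/-- The Leibniz rule for the product with a Lipschitz function of bounded support. -/
lemma IsWeakUpperGradient.mul_lipschitz (hp : 1 < p) (hfin : BoundedlyFinite m)
    (hf : Measurable f) {K : ℝ} (hK : ∀ x, |f x| ≤ K) (hG : IsWeakUpperGradient m p f G)
    {η : X → ℝ} {L : ℝ≥0} (hη : LipschitzWith L η)
    (hb : Bornology.IsBounded (Function.support η)) :
    IsWeakUpperGradient m p (fun x => η x * f x)
      ((Function.support η).indicator fun x => |η x| * G x + L * K) := by
  have hq : 1 < p.conjExponent := (Real.HolderConjugate.conjExponent hp).symm.lt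
  have hηm : Measurable η := hη.continuous.measurable
  have hs : MeasurableSet (Function.support η) := measurableSet_support hηm
  obtain ⟨B, hB⟩ := IsLipBS.exists_bound ⟨⟨L, hη⟩, hb⟩
  refine ⟨?_, ?_, fun π hπ => planInequality_of_ae_hasCurveBound ?_⟩
  · filter_upwards [hG.nonneg] with x hx
    by_cases hxs : x ∈ Function.support η
    · rw [indicator_of_mem hxs]
      have hK0 : 0 ≤ K := (abs_nonneg _).trans (hK x)
      have hx' : 0 ≤ G x := hx
      exact add_nonneg (mul_nonneg (abs_nonneg _) hx') (mul_nonneg L.2 hK0)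
    · rw [indicator_of_notMem hxs]
      rfl
  · have h1 : MemLp (fun x => B * G x) (ENNReal.ofReal p) m := hG.memLp.const_mul B
    have h2 := memLp_indicator_const_of_isBounded hfin hs hb (L * K) (ENNReal.ofReal p)
    refine (h1.norm.add h2.norm).of_le ?_ (Eventually.of_forall fun x => ?_)
    · refine AEStronglyMeasurable.indicator ?_ hs
      exact ((continuous_abs.measurable.comp hηm).aestronglyMeasurable.mul hG.memLp.1).add
        aestronglyMeasurable_const
    · have e : ∀ a b : ℝ, ‖‖a‖ + ‖b‖‖ = ‖a‖ + ‖b‖ := fun a b =>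
        Real.norm_of_nonneg (by positivity)
      simp only [Pi.add_apply]
      rw [e]
      by_cases hx : x ∈ Function.support η
      · rw [indicator_of_mem hx, indicator_of_mem hx]
        refine (norm_add_le _ _).trans (add_le_add ?_ le_rfl)
        rw [norm_mul, norm_mul, Real.norm_eq_abs, abs_abs]
        gcongr
        exact (hB x).trans (le_abs_self _)
      · rw [indicator_of_notMem hx, norm_zero]
        positivity
  · filter_upwards [hG.ae_hasCurveBound hp hf hπ, hπ.ae_edist_le hq,
      hπ.ae_lintegral_speed_lt_top, hπ.ae_ae_of_ae hG.nonneg] with γ h1 h2 h3 h0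
    have h4 : HasCurveBound (fun t => η (γ t)) (fun t => L * speed γ t) := by
      refine hasCurveBound_of_increments (T := univ) ((measurable_speed_curve γ).const_mul _) ?_
        (mem_univ _) (mem_univ _) (by simp) fun s _ t _ hst => ?_
      · rw [lintegral_const_mul _ (measurable_speed_curve γ)]
        refine ENNReal.mul_ne_top ENNReal.coe_ne_top fun hcon => ?_
        have h5 := lintegral_rpow_le (volume : Measure I)
          (measurable_speed_curve γ).aemeasurable hq
        rw [hcon, ENNReal.top_rpow_of_pos (zero_lt_one.trans hq), measure_univ, ENNReal.one_rpow,
          one_mul, top_le_iff] at h5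
        exact h3.ne h5
      · rw [lintegral_const_mul _ (measurable_speed_curve γ), ← Real.dist_eq, ← edist_dist]
        refine (hη (γ t) (γ s)).trans ?_
        rw [edist_comm]
        gcongr
        exact h2 s t hst
    -- Comparison with the zero function: at almost every time where ηf vanishes its derivative is
    -- zero, so the gradient may be cut off outside the support of η.
    refine (h4.mul h1).of_eq_on (hasCurveBound_const 0 0) ?_ (Eventually.of_forall fun t ht => ?_)
    · filter_upwards [h0] with t ht0 ht
      have hx : γ t ∈ Function.support η := fun h0 => ht (by rw [h0, zero_mul])
      have hLK : 0 ≤ (L : ℝ) * K := mul_nonneg L.2 ((abs_nonneg _).trans (hK (γ t)))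
      rw [gradAlong, gradAlong, indicator_of_mem hx,
        ENNReal.ofReal_add (mul_nonneg (abs_nonneg _) ht0) hLK, add_mul,
        ENNReal.ofReal_mul (abs_nonneg _), ENNReal.ofReal_mul (NNReal.coe_nonneg L), mul_assoc,
        mul_assoc, ENNReal.ofReal_coe_nnreal]
      refine add_le_add le_rfl ?_
      rw [mul_left_comm]
      gcongr
      exact hK _
    · simp

lemma InSobolevClassLoc.cutoff (h : InSobolevClassLoc m p f) {k : ℝ} (hk : 0 < k) {η : X → ℝ}
    (hη : IsLipBS η) : InSobolevClass m p (cutoff η k f) := by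
  obtain ⟨-, G, -, -, hG⟩ := h
  exact (hG k hk η hη).1

/-- On the set where the cutoff function is `1`, the gradient of the cutoff is controlled by its
value where `|f| < k`. -/
lemma minGrad_cutoff_le_zero (hp : 1 < p) {k : ℝ} (hk : 0 < k) {η : X → ℝ}
    (h : InSobolevClass m p (cutoff η k f)) :
    ∀ᵐ x ∂m, η x = 1 → ¬ |f x| < k → minGrad m p (BIPSpaces.cutoff η k f) x ≤ 0 := by
  filter_upwards [minGrad_le_zero_of_eq_const hp h k, minGrad_le_zero_of_eq_const hp h (-k)]
    with x h1 h2 hη hf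
  rw [not_lt, le_abs] at hf
  rcases hf with hf | hf
  · refine h1 ?_
    rw [BIPSpaces.cutoff, hη, one_mul, min_eq_left (le_max_of_le_left hf)]
  · refine h2 ?_
    rw [BIPSpaces.cutoff, hη, one_mul, max_eq_right (by linarith), min_eq_right (by linarith)]

lemma exists_nat_dist_le_abs_lt (x₀ x : X) (f : X → ℝ) :
    ∃ n : ℕ, 0 < (n : ℝ) ∧ dist x x₀ ≤ n ∧ |f x| < n := by
  obtain ⟨n, hn⟩ := exists_nat_gt (max (dist x x₀) |f x|)
  have h1 := (le_max_left _ _).trans_lt hn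
  exact ⟨n, dist_nonneg.trans_lt h1, h1.le, (le_max_right _ _).trans_lt hn⟩

lemma IsLocalGradient.nonneg (hp : 1 < p) (x₀ : X) (h : InSobolevClassLoc m p f)
    (hG : IsLocalGradient m p f G) : 0 ≤ᵐ[m] G := by
  have h1 : ∀ n : ℕ, ∀ᵐ x ∂m, 0 < (n : ℝ) → bump x₀ n x = 1 → |f x| < n → 0 ≤ G x := by
    intro n
    by_cases hn : 0 < (n : ℝ)
    · filter_upwards [hG.2 n hn _ (isLipBS_bump x₀ n),
        minGrad_nonneg hp (h.cutoff hn (isLipBS_bump x₀ n))] with x hx1 hx2 _ hx3 hx4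
      rw [hx1 hx3 hx4]
      exact hx2
    · exact Eventually.of_forall fun x hx => absurd hx hn
  filter_upwards [ae_all_iff.2 h1] with x hx
  obtain ⟨n, hn0, hn1, hn2⟩ := exists_nat_dist_le_abs_lt x₀ x f
  exact hx n hn0 (bump_eq_one hn1) hn2

/-- The defining property of G covers only |f| < k; where |f| ≥ k the cutoff takes the values ±k on
{η = 1}, and its gradient vanishes there. -/
lemma IsLocalGradient.minGrad_cutoff_le (hp : 1 < p) (x₀ : X) (h : InSobolevClassLoc m p f)
    (hG : IsLocalGradient m p f G) {k : ℝ} (hk : 0 < k) {η : X → ℝ} (hη : IsLipBS η) :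
    ∀ᵐ x ∂m, η x = 1 → minGrad m p (BIPSpaces.cutoff η k f) x ≤ G x := by
  filter_upwards [hG.2 k hk η hη, minGrad_cutoff_le_zero hp hk (h.cutoff hk hη),
    hG.nonneg hp x₀ h] with x h1 h2 h3 hx
  by_cases hf : |f x| < k
  · exact (h1 hx hf).ge
  · exact (h2 hx hf).trans h3

/-- Local gradients for two exponents agree if the gradients of all the cutoffs do. -/
lemma IsLocalGradient.ae_eq (x₀ : X) (hG : IsLocalGradient m p₁ f G)
    (hH : IsLocalGradient m p₂ f H)
    (h : ∀ k : ℝ, 0 < k → ∀ η : X → ℝ, IsLipBS η →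
      minGrad m p₁ (cutoff η k f) =ᵐ[m] minGrad m p₂ (cutoff η k f)) : G =ᵐ[m] H := by
  have h1 : ∀ n : ℕ, ∀ᵐ x ∂m, 0 < (n : ℝ) → bump x₀ n x = 1 → |f x| < n → G x = H x := by
    intro n
    by_cases hn : 0 < (n : ℝ)
    · filter_upwards [hG.2 n hn _ (isLipBS_bump x₀ n), hH.2 n hn _ (isLipBS_bump x₀ n),
        h n hn _ (isLipBS_bump x₀ n)] with x hx1 hx2 hx3 _ hx4 hx5
      rw [hx1 hx4 hx5, hx2 hx4 hx5, hx3]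
    · exact Eventually.of_forall fun x hx => absurd hx hn
  filter_upwards [ae_all_iff.2 h1] with x hx
  obtain ⟨n, hn0, hn1, hn2⟩ := exists_nat_dist_le_abs_lt x₀ x f
  exact hx n hn0 (bump_eq_one hn1) hn2

/-- The gradients of the cutoffs at integer radius and level n are glued by using, at x, the index
N(x). Locality makes the result agree with the gradient of any other cutoff wherever that one also
equals f. -/
lemma exists_isLocalGradient (hp : 1 < p) (x₀ : X) (h : InSobolevClassLoc m p f) :
    ∃ G, IsLocalGradient m p f G := by
  have hcut := fun (k : ℝ) (hk : 0 < k) (η : X → ℝ) (hη : IsLipBS η) => h.cutoff hk hη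
  obtain ⟨hf, G, hGloc, -, hG⟩ := h
  -- N exceeds both d(x, x₀) and |f(x)|, so the cutoff with radius and level N(x) equals f at x; the
  -- summand 1 also keeps the level positive.
  let N : X → ℕ := fun x => ⌊dist x x₀⌋₊ + ⌊|f x|⌋₊ + 1
  have hNm : Measurable N :=
    ((Nat.measurable_floor.comp (measurable_id.dist measurable_const)).add
      (Nat.measurable_floor.comp (continuous_abs.measurable.comp hf))).add_const 1
  have hNb : ∀ x, bump x₀ (N x) x = 1 := by
    intro x
    refine bump_eq_one ?_
    have h1 := Nat.lt_floor_add_one (dist x x₀)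
    simp only [N]
    push_cast
    have h2 : (0 : ℝ) ≤ ⌊|f x|⌋₊ := Nat.cast_nonneg _
    linarith
  have hNf : ∀ x, |f x| < N x := by
    intro x
    have h1 := Nat.lt_floor_add_one |f x|
    simp only [N]
    push_cast
    have h2 : (0 : ℝ) ≤ ⌊dist x x₀⌋₊ := Nat.cast_nonneg _
    linarith
  have hNpos : ∀ x, 0 < (N x : ℝ) := fun x => (abs_nonneg _).trans_lt (hNf x)
  let g : ℕ → X → ℝ := fun n => minGrad m p (cutoff (bump x₀ n) n f)
  have hgm : ∀ n : ℕ, 0 < (n : ℝ) → AEStronglyMeasurable (g n) m := fun n hn =>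
    (isWeakUpperGradient_minGrad hp (hcut n hn _ (isLipBS_bump x₀ n))).memLp.1
  have hG₀m : AEStronglyMeasurable (fun x => g (N x) x) m := by
    classical
    -- Measurable representatives are needed before inserting n = N(x). The value at n = 0 is
    -- irrelevant since N is positive.
    let g' : ℕ → X → ℝ := fun n => if hn : 0 < (n : ℝ) then (hgm n hn).mk (g n) else 0
    have hg'm : ∀ n, Measurable (g' n) := by
      intro n
      by_cases hn : 0 < (n : ℝ)
      · simp only [g', dif_pos hn]
        exact (hgm n hn).stronglyMeasurable_mk.measurable
      · simp only [g', dif_neg hn]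
        exact measurable_const
    have hm2 : Measurable fun z : ℕ × X => g' z.1 z.2 :=
      measurable_from_prod_countable_right hg'm
    have hm3 : Measurable fun x => g' (N x) x := hm2.comp (hNm.prodMk measurable_id)
    refine ⟨_, hm3.stronglyMeasurable, ?_⟩
    have h1 : ∀ n : ℕ, ∀ᵐ x ∂m, 0 < (n : ℝ) → g n x = g' n x := by
      intro n
      by_cases hn : 0 < (n : ℝ)
      · filter_upwards [(hgm n hn).ae_eq_mk] with x hx _
        simp only [g', dif_pos hn]
        exact hx
      · exact Eventually.of_forall fun x hx => absurd hx hn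
    filter_upwards [ae_all_iff.2 h1] with x hx
    exact hx (N x) (hNpos x)
  refine ⟨fun x => g (N x) x, fun s hs => ?_, fun k hk η hη => ?_⟩
  · refine (hGloc s hs).of_le hG₀m.restrict (ae_restrict_of_ae ?_)
    have h1 : ∀ n : ℕ, ∀ᵐ x ∂m, 0 < (n : ℝ) → bump x₀ n x = 1 → 0 ≤ g n x ∧ g n x ≤ G x := by
      intro n
      by_cases hn : 0 < (n : ℝ)
      · filter_upwards [(hG n hn _ (isLipBS_bump x₀ n)).2,
          minGrad_nonneg hp (hcut n hn _ (isLipBS_bump x₀ n))] with x hx1 hx2 _ hx3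
        refine ⟨hx2, (hx1 hx3).trans ?_⟩
        rw [hx3, abs_one, one_mul]
      · exact Eventually.of_forall fun x hx => absurd hx hn
    filter_upwards [ae_all_iff.2 h1] with x hx
    obtain ⟨h2, h3⟩ := hx (N x) (hNpos x) (hNb x)
    rw [Real.norm_of_nonneg h2]
    exact h3.trans (le_abs_self _)
  · have h1 : ∀ n : ℕ, ∀ᵐ x ∂m, 0 < (n : ℝ) → cutoff (bump x₀ n) n f x = cutoff η k f x →
        g n x = minGrad m p (cutoff η k f) x := by
      intro n
      by_cases hn : 0 < (n : ℝ)
      · filter_upwards [minGrad_eq_of_eq_on hp (hcut n hn _ (isLipBS_bump x₀ n))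
          (hcut k hk η hη)] with x hx _ using hx
      · exact Eventually.of_forall fun x hx => absurd hx hn
    filter_upwards [ae_all_iff.2 h1] with x hx hx1 hx2
    refine hx (N x) (hNpos x) ?_
    rw [cutoff_eq_self (hNb x) (hNf x), cutoff_eq_self hx1 hx2]

lemma isLocalGradient_localGrad (hp : 1 < p) (x₀ : X) (h : InSobolevClassLoc m p f) :
    IsLocalGradient m p f (localGrad m p f) := by
  have hex := exists_isLocalGradient hp x₀ h
  rw [localGrad, dif_pos hex]
  exact hex.choose_spec

lemma InSobolevClass.cutoff (hp : 1 < p) (hfin : BoundedlyFinite m) (h : InSobolevClass m p f)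
    {k : ℝ} (hk : 0 < k) {η : X → ℝ} (hη : IsLipBS η) :
    InSobolevClass m p (BIPSpaces.cutoff η k f) := by
  obtain ⟨hf, G, hG⟩ := h
  obtain ⟨⟨L, hL⟩, hb⟩ := id hη
  exact ⟨measurable_cutoff hη hf k, _,
    (hG.mono_increments fun x y => abs_trunc_sub_trunc_le k (f x) (f y)).mul_lipschitz hp hfin
      (measurable_trunc hf k) (fun x => abs_trunc_le hk (f x)) hL hb⟩

lemma InSobolevClass.isLocalGradient_minGrad (hp : 1 < p) (hfin : BoundedlyFinite m)
    (h : InSobolevClass m p f) : IsLocalGradient m p f (minGrad m p f) := by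
  refine ⟨fun s _ => (isWeakUpperGradient_minGrad hp h).memLp.restrict s, fun k hk η hη => ?_⟩
  filter_upwards [minGrad_eq_of_eq_on hp h (h.cutoff hp hfin hk hη)] with x hx h1 h2
  exact hx (cutoff_eq_self h1 h2).symm

lemma InSobolevClass.inSobolevClassLoc (hp : 1 < p) (hfin : BoundedlyFinite m)
    (h : InSobolevClass m p f) : InSobolevClassLoc m p f := by
  have hmin := isWeakUpperGradient_minGrad hp h
  refine ⟨h.1, minGrad m p f, fun s _ => hmin.memLp.restrict s, hmin.nonneg, fun k hk η hη =>
    ⟨h.cutoff hp hfin hk hη, ?_⟩⟩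
  filter_upwards [minGrad_le_of_eq_on hp (h.cutoff hp hfin hk hη) (measurable_trunc h.1 k)
    (hmin.mono_increments fun x y => abs_trunc_sub_trunc_le k (f x) (f y))] with x hx hx1
  rw [hx1, abs_one, one_mul]
  exact hx (by rw [BIPSpaces.cutoff, hx1, one_mul])

lemma InSobolevClass.localGrad_ae_eq (hp : 1 < p) (x₀ : X) (hfin : BoundedlyFinite m)
    (h : InSobolevClass m p f) : localGrad m p f =ᵐ[m] minGrad m p f :=
  (isLocalGradient_localGrad hp x₀ (h.inSobolevClassLoc hp hfin)).ae_eq x₀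
    (h.isLocalGradient_minGrad hp hfin) fun _ _ _ _ => EventuallyEq.rfl

/-- A function of the local class whose gradient is globally in `L^p` is in the Sobolev class. -/
lemma IsLocalGradient.isWeakUpperGradient (hp : 1 < p) (x₀ : X) (h : InSobolevClassLoc m p f)
    (hG : IsLocalGradient m p f G) (hGp : MemLp G (ENNReal.ofReal p) m) :
    IsWeakUpperGradient m p f G := by
  refine ⟨hG.nonneg hp x₀ h, hGp, fun π hπ => ?_⟩
  have h1 : ∀ n : ℕ, 0 < (n : ℝ) → ∀ᵐ γ ∂π, (∀ t, dist (γ t) x₀ ≤ n) → |f (γ 0)| < n →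
      |f (γ 1)| < n → ENNReal.ofReal |f (γ 1) - f (γ 0)| ≤ ∫⁻ t, gradAlong G γ t := by
    intro n hn
    have hc := h.cutoff hn (isLipBS_bump x₀ n)
    filter_upwards [(isWeakUpperGradient_minGrad hp hc).ae_hasCurveBound hp hc.1 hπ,
      hπ.ae_ae_of_ae (hG.minGrad_cutoff_le hp x₀ h hn (isLipBS_bump x₀ n))] with γ h1 h2 h3 h4 h5
    have h6 := h1.ofReal_abs_sub_le
    rw [cutoff_eq_self (bump_eq_one (h3 0)) h4, cutoff_eq_self (bump_eq_one (h3 1)) h5] at h6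
    refine h6.trans (lintegral_mono_ae ?_)
    filter_upwards [h2] with t ht
    unfold gradAlong
    gcongr
    exact ht (bump_eq_one (h3 t))
  have h2 : ∀ᵐ γ ∂π, ∀ n : ℕ, 0 < (n : ℝ) → (∀ t, dist (γ t) x₀ ≤ n) → |f (γ 0)| < n →
      |f (γ 1)| < n → ENNReal.ofReal |f (γ 1) - f (γ 0)| ≤ ∫⁻ t, gradAlong G γ t := by
    refine ae_all_iff.2 fun n => ?_
    by_cases hn : 0 < (n : ℝ)
    · filter_upwards [h1 n hn] with γ hγ _ using hγ
    · exact Eventually.of_forall fun x hx => absurd hx hn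
  refine lintegral_mono_ae ?_
  filter_upwards [h2] with γ hγ
  -- Each curve is compact, so some integer cutoff is 1 along all of it and leaves f unchanged at
  -- both endpoints.
  obtain ⟨R, hR⟩ := (isCompact_range γ.continuous).isBounded.subset_closedBall x₀
  obtain ⟨n, hn⟩ := exists_nat_gt (max R (max |f (γ 0)| |f (γ 1)|))
  have n0 : |f (γ 0)| < n := ((le_max_left _ _).trans (le_max_right _ _)).trans_lt hn
  refine hγ n ((abs_nonneg _).trans_lt n0) (fun t => ?_) n0
    (((le_max_right _ _).trans (le_max_right _ _)).trans_lt hn)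
  exact (hR (mem_range_self t)).trans ((le_max_left _ _).trans hn.le)

end LocalClass

end BIPSpaces

end

noncomputable section

namespace BIPSpaces

set_option linter.unusedSectionVars false

variable {X : Type*} [MetricSpace X] [MeasurableSpace X] [BorelSpace X]
  {m : Measure X} {p p₁ p₂ : ℝ} {f u v G H : X → ℝ}

/-! ### Local and global independence of the exponent -/

section PIndependence

variable [SecondCountableTopology X]

/-- The local gradient controls a cutoff only where η = 1. Taking a bump χ equal to 1 on a ball
containing the support of η, one writes ηf^k = η·(χf^k), and the Leibniz rule gives the bound |η|G +
Lk on that support. -/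
lemma InSobolevClassLoc.memLp_minGrad_cutoff (hp : 1 < p₁) (x₀ : X)
    (hfin : BoundedlyFinite m) (h : InSobolevClassLoc m p₁ f) (hG : IsLocalGradient m p₁ f G)
    (hGp : MemLpLoc m p₂ G) {k : ℝ} (hk : 0 < k) {η : X → ℝ} (hη : IsLipBS η) :
    MemLp (minGrad m p₁ (BIPSpaces.cutoff η k f)) (ENNReal.ofReal p₂) m := by
  obtain ⟨⟨L, hL⟩, hb⟩ := id hη
  obtain ⟨R, hR⟩ := hb.subset_closedBall x₀
  obtain ⟨B, hB⟩ := hη.exists_bound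
  have hχ := isLipBS_bump x₀ R
  have hu := h.cutoff hk hχ
  have hbd : ∀ x, |BIPSpaces.cutoff (bump x₀ R) k f x| ≤ k := fun x => by
    simpa using abs_cutoff_le hk (bump_bound x₀ R) x
  have hw := (isWeakUpperGradient_minGrad hp hu).mul_lipschitz hp hfin hu.1 hbd hL hb
  have hprod : (fun x => η x * BIPSpaces.cutoff (bump x₀ R) k f x) = BIPSpaces.cutoff η k f := by
    ext x
    by_cases hx : η x = 0
    · simp [BIPSpaces.cutoff, hx]
    · have : dist x x₀ ≤ R := hR hx
      rw [BIPSpaces.cutoff, BIPSpaces.cutoff, bump_eq_one this, one_mul]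
  rw [hprod] at hw
  have hc := h.cutoff hk hη
  have hs : MeasurableSet (Metric.closedBall x₀ R) := Metric.isClosed_closedBall.measurableSet
  have h1 : MemLp ((Metric.closedBall x₀ R).indicator fun x => B * ‖G x‖) (ENNReal.ofReal p₂) m :=
    (memLp_indicator_iff_restrict hs).2 ((hGp _ Metric.isBounded_closedBall).norm.const_mul B)
  have h2 := memLp_indicator_const_of_isBounded hfin hs Metric.isBounded_closedBall (L * k)
    (ENNReal.ofReal p₂)
  refine (h1.add h2).mono' (isWeakUpperGradient_minGrad hp hc).memLp.1 ?_
  filter_upwards [minGrad_le hp hc.1 hw, minGrad_nonneg hp hc,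
    hG.minGrad_cutoff_le hp x₀ h hk hχ] with x hx1 hx2 hx3
  rw [Real.norm_of_nonneg hx2]
  refine hx1.trans ?_
  simp only [Pi.add_apply]
  by_cases hx : x ∈ Function.support η
  · have hxR := hR hx
    rw [indicator_of_mem hx, indicator_of_mem hxR, indicator_of_mem hxR]
    refine add_le_add ?_ le_rfl
    have h4 := (hx3 (bump_eq_one hxR)).trans (le_abs_self _)
    exact (mul_le_mul_of_nonneg_left h4 (abs_nonneg _)).trans
      (mul_le_mul_of_nonneg_right (hB x) (abs_nonneg _))
  · rw [indicator_of_notMem hx]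
    have hB0 : 0 ≤ B := (abs_nonneg _).trans (hB x)
    refine add_nonneg (indicator_nonneg (fun y _ => ?_) _) (indicator_nonneg (fun y _ => ?_) _)
    · exact mul_nonneg hB0 (norm_nonneg _)
    · exact mul_nonneg (NNReal.coe_nonneg L) hk.le

lemma localPIndependence_of_gradientsAgree (x₀ : X) (hfin : BoundedlyFinite m)
    (hb : GradientsAgree m) (hc : SobolevUpgrade m) : LocalPIndependence m := by
  intro p₁ p₂ hp₁ hp₂ f hf hG
  have hloc := isLocalGradient_localGrad hp₁ x₀ hf
  have hcut : ∀ k : ℝ, 0 < k → ∀ η : X → ℝ, IsLipBS η → InSobolevSpace m p₁ (cutoff η k f) ∧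
      InSobolevSpace m p₂ (cutoff η k f) := by
    intro k hk η hη
    have h1 : InSobolevSpace m p₁ (cutoff η k f) :=
      ⟨hf.cutoff hk hη, memLp_cutoff hfin hη hf.1 hk _⟩
    exact ⟨h1, hc p₁ p₂ hp₁ hp₂ _ h1 (memLp_cutoff hfin hη hf.1 hk _)
      (hf.memLp_minGrad_cutoff hp₁ x₀ hfin hloc hG hk hη)⟩
  have hagree : ∀ k : ℝ, 0 < k → ∀ η : X → ℝ, IsLipBS η →
      minGrad m p₁ (cutoff η k f) =ᵐ[m] minGrad m p₂ (cutoff η k f) :=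
    fun k hk η hη => hb p₁ p₂ hp₁ hp₂ _ (hcut k hk η hη).1 (hcut k hk η hη).2
  have hf₂ : InSobolevClassLoc m p₂ f := by
    refine ⟨hf.1, localGrad m p₁ f, hG, hloc.nonneg hp₁ x₀ hf, fun k hk η hη =>
      ⟨(hcut k hk η hη).2.1, ?_⟩⟩
    filter_upwards [hloc.minGrad_cutoff_le hp₁ x₀ hf hk hη, hagree k hk η hη] with x h1 h2 hx
    rw [← h2, hx, abs_one, one_mul]
    exact h1 hx
  exact ⟨hf₂, hloc.ae_eq x₀ (isLocalGradient_localGrad hp₂ x₀ hf₂) hagree⟩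

lemma MemLpLoc.mono_exponent (hfin : BoundedlyFinite m) (h12 : p₂ ≤ p₁) (h : MemLpLoc m p₁ G) :
    MemLpLoc m p₂ G := by
  intro s hs
  have : IsFiniteMeasure (m.restrict s) := ⟨by simpa using hfin s hs⟩
  exact (h s hs).mono_exponent (ENNReal.ofReal_le_ofReal h12)

/-- The local statement needs the gradient in L^{p₂}_loc. For p₂ ≤ p₁ this is automatic, as bounded
sets have finite measure; the other case follows by symmetry. -/
lemma LocalPIndependence.gradientsAgree (x₀ : X) (hfin : BoundedlyFinite m)
    (h : LocalPIndependence m) : GradientsAgree m := by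
  have key : ∀ p₁ p₂ : ℝ, 1 < p₁ → 1 < p₂ → p₂ ≤ p₁ → ∀ f : X → ℝ, InSobolevSpace m p₁ f →
      InSobolevSpace m p₂ f → minGrad m p₁ f =ᵐ[m] minGrad m p₂ f := by
    intro p₁ p₂ hp₁ hp₂ h12 f hf₁ hf₂
    have e₁ := hf₁.1.localGrad_ae_eq hp₁ x₀ hfin
    have e₂ := hf₂.1.localGrad_ae_eq hp₂ x₀ hfin
    have hloc := (isLocalGradient_localGrad hp₁ x₀ (hf₁.1.inSobolevClassLoc hp₁ hfin)).1
    exact e₁.symm.trans ((h p₁ p₂ hp₁ hp₂ f (hf₁.1.inSobolevClassLoc hp₁ hfin)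
      (hloc.mono_exponent hfin h12)).2.trans e₂)
  intro p₁ p₂ hp₁ hp₂ f hf₁ hf₂
  rcases le_total p₂ p₁ with h12 | h12
  · exact key p₁ p₂ hp₁ hp₂ h12 f hf₁ hf₂
  · exact (key p₂ p₁ hp₂ hp₁ h12 f hf₂ hf₁).symm

lemma LocalPIndependence.sobolevUpgrade (x₀ : X) (hfin : BoundedlyFinite m)
    (h : LocalPIndependence m) : SobolevUpgrade m := by
  intro p₁ p₂ hp₁ hp₂ f hf hfp hgp
  have e₁ := hf.1.localGrad_ae_eq hp₁ x₀ hfin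
  have hgp' : MemLp (localGrad m p₁ f) (ENNReal.ofReal p₂) m := hgp.ae_eq e₁.symm
  obtain ⟨h1, h2⟩ := h p₁ p₂ hp₁ hp₂ f (hf.1.inSobolevClassLoc hp₁ hfin)
    (fun s _ => hgp'.restrict s)
  exact ⟨⟨hf.1.1, _, (isLocalGradient_localGrad hp₂ x₀ h1).isWeakUpperGradient hp₂ x₀ h1
    (hgp'.ae_eq h2)⟩, hfp⟩

lemma localPIndependence_iff (x₀ : X) (hfin : BoundedlyFinite m) :
    LocalPIndependence m ↔ GradientsAgree m ∧ SobolevUpgrade m :=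
  ⟨fun h => ⟨h.gradientsAgree x₀ hfin, h.sobolevUpgrade x₀ hfin⟩,
    fun h => localPIndependence_of_gradientsAgree x₀ hfin h.1 h.2⟩

end PIndependence

end BIPSpaces

end

noncomputable section

namespace BIPSpaces

set_option linter.unusedSectionVars false

variable {X : Type*} [MetricSpace X] [MeasurableSpace X] [BorelSpace X]
  {m : Measure X} {p q : ℝ} {f G : X → ℝ}

/-! ### Lipschitz approximation of integrable functions -/

section LipschitzApproximation

/-- The Lipschitz regularization `x ↦ inf_y (ψ(y) + n d(x,y))`. -/
def infConv (ψ : X → ℝ≥0∞) (n : ℕ) (x : X) : ℝ≥0∞ := ⨅ y, (ψ y + n * edist x y)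

lemma infConv_le (ψ : X → ℝ≥0∞) (n : ℕ) (x : X) : infConv ψ n x ≤ ψ x :=
  (iInf_le _ x).trans (by simp)

lemma infConv_le_add (ψ : X → ℝ≥0∞) (n : ℕ) (x y : X) :
    infConv ψ n x ≤ infConv ψ n y + n * edist x y := by
  unfold infConv
  rw [ENNReal.iInf_add]
  refine le_iInf fun z => (iInf_le _ z).trans ?_
  rw [add_assoc, ← mul_add, add_comm (edist y z)]
  gcongr
  exact edist_triangle _ _ _

lemma measurable_infConv (ψ : X → ℝ≥0∞) (n : ℕ) : Measurable (infConv ψ n) := by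
  refine measurable_of_Iio fun c => IsOpen.measurableSet ?_
  have : infConv ψ n ⁻¹' Iio c = ⋃ y, {x | ψ y + n * edist x y < c} := by
    ext x
    simp [infConv, iInf_lt_iff]
  rw [this]
  refine isOpen_iUnion fun y => isOpen_lt ?_ continuous_const
  exact continuous_const.add ((ENNReal.continuous_const_mul (ENNReal.natCast_ne_top n)).comp
    (continuous_id.edist continuous_const))

lemma monotone_infConv (ψ : X → ℝ≥0∞) : Monotone (infConv ψ) := by
  intro i j hij x
  unfold infConv
  refine iInf_mono fun y => ?_
  gcongr

/-- Near x lower semicontinuity keeps ψ above any level below ψ(x); away from x the penalty n·d(x,y)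
exceeds that level for large n. -/
lemma iSup_infConv {ψ : X → ℝ≥0∞} (hψ : LowerSemicontinuous ψ) (x : X) :
    ⨆ n, infConv ψ n x = ψ x := by
  refine le_antisymm (iSup_le fun n => infConv_le ψ n x) (le_of_forall_lt fun c hc => ?_)
  obtain ⟨c', hcc', hc'⟩ := exists_between hc
  obtain ⟨r, hr, hball⟩ := EMetric.mem_nhds_iff.1 (hψ x c' hc')
  obtain ⟨n, hn⟩ := ENNReal.exists_nat_mul_gt hr.ne' hc'.ne_top
  refine hcc'.trans_le (le_trans ?_ (le_iSup _ n))
  refine le_iInf fun y => ?_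
  by_cases hy : edist x y < r
  · have : c' < ψ y := hball (by rwa [Metric.mem_eball, edist_comm])
    exact this.le.trans le_self_add
  · refine hn.le.trans (le_trans ?_ le_add_self)
    gcongr
    exact not_lt.1 hy

lemma isLocallyFiniteMeasure_of_boundedlyFinite (hfin : BoundedlyFinite m) :
    IsLocallyFiniteMeasure m :=
  ⟨fun x => ⟨Metric.ball x 1, Metric.ball_mem_nhds x one_pos, hfin _ Metric.isBounded_ball⟩⟩

/-- A lower semicontinuous majorant ψ of g, within ε/2 in L¹, is approximated from below by its
inf-convolutions, using monotone convergence. The error function e is (ψ - g) + (ψ - φ) and works in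
both directions. -/
lemma exists_lipschitz_approx [SecondCountableTopology X] (hfin : BoundedlyFinite m)
    {g : X → ℝ≥0∞} (hg : Measurable g) (hgi : ∫⁻ x, g x ∂m ≠ ∞) {ε : ℝ≥0∞} (hε : ε ≠ 0) :
    ∃ (φ e : X → ℝ≥0∞) (n : ℕ), Measurable φ ∧ Measurable e ∧
      (∀ x y, φ x ≤ φ y + n * edist x y) ∧ (∀ x, g x ≤ φ x + e x) ∧ (∀ x, φ x ≤ g x + e x) ∧
      ∫⁻ x, e x ∂m ≤ ε := by
  have := isLocallyFiniteMeasure_of_boundedlyFinite hfin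
  have hε2 : ε / 2 ≠ 0 := (ENNReal.half_pos hε).ne'
  by_cases hεt : ε = ∞
  · exact ⟨0, g, 0, measurable_zero, hg, by simp, by simp, by simp, by simp [hεt]⟩
  obtain ⟨ψ, hgψ, hψ, hψi⟩ := exists_le_lowerSemicontinuous_lintegral_ge m g hg hε2
  have hψm : Measurable ψ := hψ.measurable
  have hε2t : ε / 2 ≠ ∞ := (ENNReal.half_le_self.trans_lt (lt_top_iff_ne_top.2 hεt)).ne
  have hψt : ∫⁻ x, ψ x ∂m ≠ ∞ := (hψi.trans_lt (ENNReal.add_lt_top.2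
    ⟨hgi.lt_top, hε2t.lt_top⟩)).ne
  have hsup : ∫⁻ x, ψ x ∂m = ⨆ n, ∫⁻ x, infConv ψ n x ∂m := by
    rw [← lintegral_iSup (measurable_infConv ψ) (monotone_infConv ψ)]
    simp only [iSup_infConv hψ]
  obtain ⟨n, hn⟩ : ∃ n, ∫⁻ x, ψ x ∂m ≤ (∫⁻ x, infConv ψ n x ∂m) + ε / 2 := by
    by_cases h0 : ∫⁻ x, ψ x ∂m = 0
    · exact ⟨0, by simp [h0]⟩
    have hlt : (∫⁻ x, ψ x ∂m) - ε / 2 < ⨆ n, ∫⁻ x, infConv ψ n x ∂m := by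
      rw [← hsup]
      exact ENNReal.sub_lt_self hψt h0 hε2
    obtain ⟨n, hn⟩ := lt_iSup_iff.1 hlt
    exact ⟨n, tsub_le_iff_right.1 hn.le⟩
  refine ⟨infConv ψ n, fun x => (ψ x - g x) + (ψ x - infConv ψ n x), n, measurable_infConv ψ n,
    (hψm.sub hg).add (hψm.sub (measurable_infConv ψ n)), infConv_le_add ψ n, fun x => ?_,
    fun x => ?_, ?_⟩
  · refine (hgψ x).trans ?_
    rw [add_left_comm, add_tsub_cancel_of_le (infConv_le ψ n x)]
    exact le_add_self
  · refine (infConv_le ψ n x).trans ?_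
    rw [← add_assoc, add_tsub_cancel_of_le (hgψ x)]
    exact le_self_add
  · have hψg : Measurable fun x => ψ x - g x := hψm.sub hg
    simp only []
    rw [lintegral_add_left hψg, lintegral_sub hg hgi (Eventually.of_forall hgψ),
      lintegral_sub (measurable_infConv ψ n)
        (ne_top_of_le_ne_top hψt (lintegral_mono (infConv_le ψ n)))
        (Eventually.of_forall (infConv_le ψ n))]
    calc _ ≤ ε / 2 + ε / 2 := add_le_add (tsub_le_iff_left.2 hψi) (tsub_le_iff_left.2 hn)
      _ = ε := ENNReal.add_halves ε

end LipschitzApproximation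

/-! ### Bounded densities and geodesic plans -/

section Geodesics

lemma sigmaFinite_of_boundedlyFinite [SecondCountableTopology X] (hfin : BoundedlyFinite m) :
    SigmaFinite m := by
  have := isLocallyFiniteMeasure_of_boundedlyFinite hfin
  infer_instance

lemma le_densityNorm_smul [SigmaFinite m] {μ : Measure X} [IsFiniteMeasure μ] (h : μ ≪ m) :
    μ ≤ densityNorm m μ • m := by
  calc μ = m.withDensity (μ.rnDeriv m) := (Measure.withDensity_rnDeriv_eq μ m h).symm
    _ ≤ m.withDensity (fun _ => densityNorm m μ) :=
      withDensity_mono (ENNReal.ae_le_essSup _)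
    _ = densityNorm m μ • m := withDensity_const _

lemma densityNorm_le [SigmaFinite m] {μ : Measure X} {c : ℝ≥0∞} (h : μ ≤ c • m) :
    densityNorm m μ ≤ c := by
  refine essSup_le_of_ae_le c ?_
  refine ae_le_of_forall_setLIntegral_le_of_sigmaFinite (Measure.measurable_rnDeriv _ _)
    fun s hs _ => ?_
  rw [setLIntegral_const]
  exact (Measure.setLIntegral_rnDeriv_le s).trans (h s)

lemma hasBoundedDensity_of_le [SigmaFinite m] {μ : Measure X} [IsProbabilityMeasure μ] {c : ℝ≥0∞}
    (hc : c ≠ ∞) (h : μ ≤ c • m) : HasBoundedDensity m μ := by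
  refine ⟨inferInstance, fun s hs => ?_, (densityNorm_le h).trans_lt hc.lt_top⟩
  have := h s
  simp only [Measure.smul_apply, hs, smul_zero] at this
  exact nonpos_iff_eq_zero.1 this

lemma IsGeodesic.edist_eq {γ : Curve X} (h : IsGeodesic γ) (s t : I) :
    edist (γ s) (γ t) = edist s t * edist (γ 0) (γ 1) := by
  rw [edist_dist, h s t, ENNReal.ofReal_mul (abs_nonneg _), edist_dist, edist_dist,
    Subtype.dist_eq, Real.dist_eq]

lemma IsGeodesic.speed_le {γ : Curve X} (h : IsGeodesic γ) (t : I) :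
    speed γ t ≤ edist (γ 0) (γ 1) := by
  refine limsup_le_of_le (by isBoundedDefault) ?_
  filter_upwards with s
  rw [h.edist_eq]
  exact ENNReal.div_le_of_le_mul (by rw [mul_comm])

lemma IsGeodesic.edist_le {γ : Curve X} (h : IsGeodesic γ) (t : I) :
    edist (γ t) (γ 0) ≤ edist (γ 0) (γ 1) := by
  rw [h.edist_eq, edist_dist t 0, Subtype.dist_eq, Real.dist_eq]
  refine mul_le_of_le_one_left' (ENNReal.ofReal_le_one.2 ?_)
  rw [Icc.coe_zero, sub_zero, abs_of_nonneg t.2.1]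
  exact t.2.2

lemma IsGeodesic.isACq {γ : Curve X} (h : IsGeodesic γ) (q : ℝ) : IsACq q γ := by
  refine ⟨fun _ => dist (γ 0) (γ 1), memLp_const _, fun s t hst => ?_⟩
  have hst' : (s : ℝ) ≤ t := hst
  rw [setIntegral_const, measureReal_def, volume_Icc_unitInterval,
    ENNReal.toReal_ofReal (sub_nonneg.2 hst'), smul_eq_mul, h t s,
    abs_of_nonneg (sub_nonneg.2 hst')]

lemma IsGeodesic.kineticEnergy_le {γ : Curve X} (h : IsGeodesic γ) (hq : 0 ≤ q) :
    kineticEnergy q γ ≤ edist (γ 0) (γ 1) ^ q := by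
  rw [kineticEnergy, if_pos (h.isACq q)]
  refine (lintegral_mono fun t => ENNReal.rpow_le_rpow (h.speed_le t) hq).trans ?_
  simp

lemma IsOptGeo.map_zero [SecondCountableTopology X] {μ₀ μ₁ : Measure X} {π : Measure (Curve X)}
    (h : IsOptGeo q μ₀ μ₁ π) : π.map (fun γ => γ 0) = μ₀ := by
  rw [← h.optimal.1.2.1, Measure.map_map measurable_fst
    ((measurable_eval_at 0).prodMk (measurable_eval_at 1))]
  rfl

lemma IsOptGeo.map_one [SecondCountableTopology X] {μ₀ μ₁ : Measure X} {π : Measure (Curve X)}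
    (h : IsOptGeo q μ₀ μ₁ π) : π.map (fun γ => γ 1) = μ₁ := by
  rw [← h.optimal.1.2.2, Measure.map_map measurable_snd
    ((measurable_eval_at 0).prodMk (measurable_eval_at 1))]
  rfl

/-- The plans of `Geod_q` are test plans for every exponent. -/
lemma InGeod.isTestPlan [SecondCountableTopology X] {C : ℝ → ℝ} {π : Measure (Curve X)}
    (h : InGeod m q C π) {r : ℝ} (hr : 0 ≤ r) : IsTestPlan m r π := by
  obtain ⟨D, μ₀, μ₁, -, h₀, h₁, hD, hopt, hmap⟩ := h
  have hprob := hopt.isProbabilityMeasure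
  set c := ENNReal.ofReal (C D) * max (densityNorm m μ₀) (densityNorm m μ₁) with hc
  have hct : c ≠ ∞ := ENNReal.mul_ne_top ENNReal.ofReal_ne_top (max_lt h₀.bounded h₁.bounded).ne
  refine ⟨hprob, ⟨c.toNNReal, fun t => ?_⟩, ?_⟩
  · refine (hmap t).trans (le_of_eq ?_)
    rw [← ENNReal.coe_toNNReal hct]
    rfl
  · have e0 : ∀ᵐ γ ∂π, γ 0 ∈ μ₀.support := by
      have := Measure.support_mem_ae (μ := μ₀)
      rw [← hopt.map_zero] at this
      rw [← hopt.map_zero]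
      exact ae_of_ae_map (measurable_eval_at 0).aemeasurable this
    have e1 : ∀ᵐ γ ∂π, γ 1 ∈ μ₁.support := by
      have := Measure.support_mem_ae (μ := μ₁)
      rw [← hopt.map_one] at this
      rw [← hopt.map_one]
      exact ae_of_ae_map (measurable_eval_at 1).aemeasurable this
    calc ∫⁻ γ, kineticEnergy r γ ∂π ≤ ∫⁻ _, ENNReal.ofReal D ^ r ∂π := by
          refine lintegral_mono_ae ?_
          filter_upwards [e0, e1, hopt.geodesic] with γ h0 h1 hγ
          refine (hγ.kineticEnergy_le hr).trans (ENNReal.rpow_le_rpow ?_ hr)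
          exact (Metric.edist_le_ediam_of_mem (mem_union_left _ h0) (mem_union_right _ h1)).trans hD
      _ < ∞ := by
          rw [lintegral_const, measure_univ, mul_one]
          exact ENNReal.rpow_lt_top_of_nonneg hr ENNReal.ofReal_ne_top

end Geodesics

end BIPSpaces

end

noncomputable section

namespace BIPSpaces

set_option linter.unusedSectionVars false

variable {X : Type*} [MetricSpace X] [MeasurableSpace X] [BorelSpace X]
  [SecondCountableTopology X] {m : Measure X} {p q : ℝ} {f G : X → ℝ} {C : ℝ → ℝ}

/-! ### Polygonal interpolation of test plans by geodesic plans -/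

section Interpolation

lemma exists_geodesic_interpolation [SigmaFinite m] (hC : HasBIPProfile m q C) {x₀ : X} {R : ℝ}
    (hR : 0 ≤ R) {μ₀ μ₁ : Measure X} [IsProbabilityMeasure μ₀] [IsProbabilityMeasure μ₁]
    {c : ℝ≥0∞} (hc : c ≠ ∞) (h₀ : μ₀ ≤ c • m) (h₁ : μ₁ ≤ c • m)
    (hb₀ : ∀ᵐ x ∂μ₀, x ∈ Metric.closedBall x₀ R) (hb₁ : ∀ᵐ x ∂μ₁, x ∈ Metric.closedBall x₀ R) :
    ∃ π : Measure (Curve X), IsOptGeo q μ₀ μ₁ π ∧ InGeod m q C π ∧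
      ∀ t : I, π.map (fun γ => γ t) ≤ (ENNReal.ofReal (C (2 * R + 1)) * c) • m := by
  -- Supports in the ball have diameter at most 2R; the extra 1 gives the strict inequality required
  -- by the profile.
  have hD : 0 < 2 * R + 1 := by linarith
  have d₀ := hasBoundedDensity_of_le hc h₀
  have d₁ := hasBoundedDensity_of_le hc h₁
  have hdiam : Metric.ediam (μ₀.support ∪ μ₁.support) < ENNReal.ofReal (2 * R + 1) := by
    have hsub : μ₀.support ∪ μ₁.support ⊆ Metric.closedBall x₀ R :=
      union_subset (Measure.support_subset_of_isClosed Metric.isClosed_closedBall hb₀)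
        (Measure.support_subset_of_isClosed Metric.isClosed_closedBall hb₁)
    refine lt_of_le_of_lt (Metric.ediam_le fun x hx y hy => ?_)
      ((ENNReal.ofReal_lt_ofReal_iff hD).2 (lt_add_one (2 * R)))
    rw [edist_dist]
    refine ENNReal.ofReal_le_ofReal ?_
    have h1 : dist x x₀ ≤ R := hsub hx
    have h2 : dist y x₀ ≤ R := hsub hy
    have h3 := dist_triangle_right x y x₀
    linarith
  obtain ⟨-, h⟩ := hC _ hD
  obtain ⟨π, hopt, hπ⟩ := h μ₀ μ₁ d₀ d₁ hdiam
  have hprob := hopt.isProbabilityMeasure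
  have hle : ∀ t : I, π.map (fun γ => γ t) ≤
      (ENNReal.ofReal (C (2 * R + 1)) * max (densityNorm m μ₀) (densityNorm m μ₁)) • m := by
    intro t
    have : IsProbabilityMeasure (π.map (fun γ => γ t)) :=
      Measure.isProbabilityMeasure_map (measurable_eval_at t).aemeasurable
    refine (le_densityNorm_smul (hπ t).1).trans (Measure.le_iff.2 fun s _ => ?_)
    simp only [Measure.smul_apply, smul_eq_mul]
    gcongr
    exact (hπ t).2
  refine ⟨π, hopt, ⟨_, μ₀, μ₁, hD, d₀, d₁, hdiam.le, hopt, hle⟩, fun t => ?_⟩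
  refine (hle t).trans (Measure.le_iff.2 fun s _ => ?_)
  simp only [Measure.smul_apply, smul_eq_mul]
  gcongr
  exact max_le (densityNorm_le h₀) (densityNorm_le h₁)

/-- Additive bounds for short time steps give the bound for all time steps. -/
lemma le_add_of_short_steps {Ψ : I → ℝ≥0∞} {Φ : I → I → ℝ≥0∞}
    (hΦ : ∀ s r t, s ≤ r → r ≤ t → Φ s r + Φ r t = Φ s t) {δ : ℝ} (hδ : 0 < δ)
    (h : ∀ s t : I, s < t → (t : ℝ) - s ≤ δ → Ψ t ≤ Ψ s + Φ s t) (s t : I) (hst : s ≤ t) :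
    Ψ t ≤ Ψ s + Φ s t := by
  have key : ∀ (n : ℕ) (s t : I), s ≤ t → (t : ℝ) - s ≤ n * δ → Ψ t ≤ Ψ s + Φ s t := by
    intro n
    induction n with
    | zero =>
      intro s t hst hn
      have : (t : ℝ) ≤ s := by simpa using hn
      rw [le_antisymm (show t ≤ s from this) hst]
      exact le_self_add
    | succ n ih =>
      intro s t hst hn
      by_cases hsmall : (t : ℝ) - s ≤ δ
      · rcases hst.eq_or_lt with rfl | hlt
        · exact le_self_add
        · exact h s t hlt hsmall
      · push Not at hsmall
        let r : I := ⟨s + δ, add_nonneg s.2.1 hδ.le, by linarith [t.2.2]⟩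
        have hsr : s < r := by
          change (s : ℝ) < s + δ
          linarith
        have hrt : r ≤ t := by
          change (s : ℝ) + δ ≤ t
          linarith
        have h1 := h s r hsr (by change (s : ℝ) + δ - s ≤ δ; linarith)
        have h2 := ih r t hrt (by
          change (t : ℝ) - (s + δ) ≤ n * δ
          push_cast at hn
          linarith)
        rw [← hΦ s r t hsr.le hrt, ← add_assoc]
        exact h2.trans (by gcongr)
  obtain ⟨n, hn⟩ := exists_nat_ge (((t : ℝ) - s) / δ)
  exact key n s t hst ((div_le_iff₀ hδ).1 hn)

/-- Young's inequality for Λa and b/(Λl). With l the duration of a step and b the length of the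
geodesic, b/l is its speed in the original time. -/
lemma young_scaled (hpq : p.HolderConjugate q) {Λ l : ℝ≥0∞} (hΛ : Λ ≠ 0) (hΛ' : Λ ≠ ∞)
    (hl : l ≠ 0) (hl' : l ≠ ∞) (a b : ℝ≥0∞) :
    a * b ≤ l * (Λ ^ p / ENNReal.ofReal p * a ^ p +
      Λ⁻¹ ^ q / ENNReal.ofReal q * (l⁻¹ ^ q * b ^ q)) := by
  have h := ENNReal.young_inequality (Λ * a) (Λ⁻¹ * (l⁻¹ * b)) hpq
  rw [ENNReal.mul_rpow_of_nonneg _ _ hpq.nonneg, ENNReal.mul_rpow_of_nonneg _ _ hpq.symm.nonneg,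
    ENNReal.mul_rpow_of_nonneg _ _ hpq.symm.nonneg] at h
  have e : a * b = l * (Λ * a * (Λ⁻¹ * (l⁻¹ * b))) := by
    calc a * b = (l * l⁻¹) * (Λ * Λ⁻¹) * (a * b) := by
          rw [ENNReal.mul_inv_cancel hl hl', ENNReal.mul_inv_cancel hΛ hΛ', one_mul, one_mul]
      _ = _ := by ring
  rw [e]
  refine mul_le_mul' le_rfl (h.trans (le_of_eq ?_))
  simp only [div_eq_mul_inv]
  ring

lemma le_one_add_rpow (hq : 1 < q) (x : ℝ≥0∞) : x ≤ 1 + x ^ q := by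
  rcases le_total x 1 with h | h
  · exact h.trans le_self_add
  · refine le_trans ?_ le_add_self
    calc x = x ^ (1 : ℝ) := (ENNReal.rpow_one x).symm
      _ ≤ x ^ q := ENNReal.rpow_le_rpow_of_exponent_le h hq.le

lemma mul_inv_rpow_mul_rpow_sub_one {l : ℝ≥0∞} (hl : l ≠ 0) (hl' : l ≠ ∞) (q : ℝ) :
    l * (l⁻¹ ^ q * l ^ (q - 1)) = 1 := by
  rw [ENNReal.inv_rpow, ← ENNReal.rpow_neg, ← ENNReal.rpow_add _ _ hl hl']
  calc l * l ^ (-q + (q - 1)) = l ^ (1 : ℝ) * l ^ (-q + (q - 1)) := by rw [ENNReal.rpow_one]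
    _ = 1 := by
      rw [← ENNReal.rpow_add _ _ hl hl', show (1 : ℝ) + (-q + (q - 1)) = 0 by ring,
        ENNReal.rpow_zero]

variable {π π' : Measure (Curve X)}

lemma lintegral_eval_le {φ g e : X → ℝ≥0∞} (hg : Measurable g) (he : Measurable e)
    (hφ : ∀ x, φ x ≤ g x + e x) {M ε : ℝ≥0∞} (heε : ∫⁻ x, e x ∂m ≤ ε) (t : I)
    (hM : π.map (fun γ => γ t) ≤ M • m) :
    ∫⁻ γ, φ (γ t) ∂π ≤ (∫⁻ γ, g (γ t) ∂π) + M * ε := by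
  calc ∫⁻ γ, φ (γ t) ∂π ≤ ∫⁻ γ, (g (γ t) + e (γ t)) ∂π := lintegral_mono fun γ => hφ _
    _ = (∫⁻ γ, g (γ t) ∂π) + ∫⁻ γ, e (γ t) ∂π :=
      lintegral_add_left (hg.comp (measurable_eval_at t)) _
    _ ≤ _ := by
      gcongr
      rw [← lintegral_map he (measurable_eval_at t)]
      refine (lintegral_mono' hM le_rfl).trans ?_
      rw [lintegral_smul_measure, smul_eq_mul]
      gcongr

lemma measurable_lintegral_Icc_speed (q : ℝ) (s t : I) :
    Measurable fun γ : Curve X => ∫⁻ r in Icc s t, speed γ r ^ q :=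
  (measurable_speed.pow_const q).lintegral_prod_right'

lemma measurable_lintegral_Icc_eval {g : X → ℝ≥0∞} (hg : Measurable g) (s t : I) :
    Measurable fun γ : Curve X => ∫⁻ r in Icc s t, g (γ r) :=
  (hg.comp measurable_eval).lintegral_prod_right'

/-- The joint law of (γ_s, γ_t) under π competes with the optimal coupling, and Hölder bounds its
cost by the energy of π on [s,t]. -/
lemma lintegral_edist_rpow_le_of_optGeo (hq : 1 < q) [IsProbabilityMeasure π] {s t : I}
    (hst : s ≤ t)
    (hac : ∀ᵐ γ ∂π, ∀ s t : I, s ≤ t → edist (γ s) (γ t) ≤ ∫⁻ r in Icc s t, speed γ r)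
    (hopt : IsOptGeo q (π.map fun γ => γ s) (π.map fun γ => γ t) π') :
    ∫⁻ γ, edist (γ 0) (γ 1) ^ q ∂π' ≤
      ENNReal.ofReal ((t : ℝ) - s) ^ (q - 1) * ∫⁻ γ, (∫⁻ r in Icc s t, speed γ r ^ q) ∂π := by
  have hm : ∀ a b : I, Measurable fun γ : Curve X => (γ a, γ b) := fun a b =>
    (measurable_eval_at a).prodMk (measurable_eval_at b)
  have hmd : Measurable fun z : X × X => edist z.1 z.2 ^ q := measurable_edist.pow_const q
  have hcoup : IsCoupling (π.map fun γ => γ s) (π.map fun γ => γ t)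
      (π.map fun γ => (γ s, γ t)) := by
    refine ⟨Measure.isProbabilityMeasure_map (hm s t).aemeasurable, ?_, ?_⟩
    · rw [Measure.map_map measurable_fst (hm s t)]
      rfl
    · rw [Measure.map_map measurable_snd (hm s t)]
      rfl
  have h1 := hopt.optimal.2 _ hcoup
  rw [lintegral_map hmd (hm 0 1), lintegral_map hmd (hm s t)] at h1
  refine h1.trans ?_
  rw [← lintegral_const_mul _ (measurable_lintegral_Icc_speed q s t)]
  refine lintegral_mono_ae ?_
  filter_upwards [hac] with γ hγ
  refine (ENNReal.rpow_le_rpow (hγ s t hst) (zero_le_one.trans hq.le)).trans ?_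
  have := lintegral_rpow_le (volume.restrict (Icc s t))
    (measurable_speed_curve γ).aemeasurable hq
  rwa [Measure.restrict_apply_univ, volume_Icc_unitInterval] at this

/-- The bound for one step of the polygonal interpolation, up to an error term. -/
lemma interpolation_step [SigmaFinite m] (hpq : p.HolderConjugate q) (hC : HasBIPProfile m q C)
    {x₀ : X} {R : ℝ} (hR : 0 ≤ R) (hGm : Measurable G)
    (hG : ∀ π : Measure (Curve X), InGeod m q C π → PlanInequality π f G)
    {F : X → ℝ≥0∞} (hF : Measurable F) (hFf : ∀ x y, F x ≤ F y + ENNReal.ofReal |f x - f y|)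
    [IsProbabilityMeasure π] {c : ℝ≥0} (hc : ∀ t : I, π.map (fun γ => γ t) ≤ c • m)
    (hac : ∀ᵐ γ ∂π, ∀ s t : I, s ≤ t → edist (γ s) (γ t) ≤ ∫⁻ r in Icc s t, speed γ r)
    (hball : ∀ᵐ γ ∂π, ∀ t : I, γ t ∈ Metric.closedBall x₀ R)
    {Λ : ℝ≥0∞} (hΛ : Λ ≠ 0) (hΛ' : Λ ≠ ∞) {φ e : X → ℝ≥0∞} {n : ℕ} {ε : ℝ≥0∞}
    (hφm : Measurable φ) (hem : Measurable e) (hφ : ∀ x y, φ x ≤ φ y + n * edist x y)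
    (h1 : ∀ x, ENNReal.ofReal (G x) ^ p ≤ φ x + e x)
    (h2 : ∀ x, φ x ≤ ENNReal.ofReal (G x) ^ p + e x) (he : ∫⁻ x, e x ∂m ≤ ε)
    {δ : ℝ} {s t : I} (hst : s < t) (hδ : (t : ℝ) - s ≤ δ) :
    ∫⁻ γ, F (γ t) ∂π ≤ (∫⁻ γ, F (γ s) ∂π) +
      (Λ ^ p / ENNReal.ofReal p * ((∫⁻ γ, (∫⁻ r in Icc s t, ENNReal.ofReal (G (γ r)) ^ p) ∂π) +
        ((c + ENNReal.ofReal (C (2 * R + 1)) * c) * ε) * ENNReal.ofReal ((t : ℝ) - s) +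
        2 * n * ENNReal.ofReal δ * (ENNReal.ofReal ((t : ℝ) - s) +
          ∫⁻ γ, (∫⁻ r in Icc s t, speed γ r ^ q) ∂π)) +
      Λ⁻¹ ^ q / ENNReal.ofReal q * ∫⁻ γ, (∫⁻ r in Icc s t, speed γ r ^ q) ∂π) := by
  have hq : 1 < q := hpq.symm.lt
  set g : X → ℝ≥0∞ := fun x => ENNReal.ofReal (G x) ^ p with hg
  have hgm : Measurable g := (ENNReal.measurable_ofReal.comp hGm).pow_const p
  set l := ENNReal.ofReal ((t : ℝ) - s) with hl
  have hl0 : l ≠ 0 := by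
    rw [hl, Ne, ENNReal.ofReal_eq_zero, not_le]
    exact sub_pos.2 hst
  have hlt : l ≠ ∞ := ENNReal.ofReal_ne_top
  set E := ∫⁻ γ, (∫⁻ r in Icc s t, speed γ r ^ q) ∂π with hE
  set M := ENNReal.ofReal (C (2 * R + 1)) * c with hM
  set κ₁ := Λ ^ p / ENNReal.ofReal p
  set κ₂ := Λ⁻¹ ^ q / ENNReal.ofReal q
  have hpr : ∀ r : I, IsProbabilityMeasure (π.map fun γ => γ r) := fun r =>
    Measure.isProbabilityMeasure_map (measurable_eval_at r).aemeasurable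
  have hbr : ∀ r : I, ∀ᵐ x ∂(π.map fun γ => γ r), x ∈ Metric.closedBall x₀ R := by
    intro r
    refine (ae_map_iff (p := fun x => x ∈ Metric.closedBall x₀ R)
      (measurable_eval_at r).aemeasurable Metric.isClosed_closedBall.measurableSet).2 ?_
    filter_upwards [hball] with γ hγ using hγ r
  have hφr : ∀ r : I, Measurable fun γ : Curve X => φ (γ r) := fun r =>
    hφm.comp (measurable_eval_at r)
  have hc' : ∀ t : I, π.map (fun γ => γ t) ≤ (c : ℝ≥0∞) • m := hc
  obtain ⟨π', hopt, hgeod, hmap⟩ := exists_geodesic_interpolation hC hR ENNReal.coe_ne_top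
    (hc' s) (hc' t) (hbr s) (hbr t)
  have hprob' := hopt.isProbabilityMeasure
  -- the energy of the geodesic plan
  have hd : ∫⁻ γ, edist (γ 0) (γ 1) ^ q ∂π' ≤ l ^ (q - 1) * E :=
    lintegral_edist_rpow_le_of_optGeo hq hst.le hac hopt
  have hmd : Measurable fun γ : Curve X => edist (γ 0) (γ 1) ^ q :=
    ((measurable_eval_at 0).edist (measurable_eval_at 1)).pow_const q
  -- Run in time l instead of 1, the geodesic plan has energy at most that of π on the step.
  have hd1 : l * (l⁻¹ ^ q * ∫⁻ γ, edist (γ 0) (γ 1) ^ q ∂π') ≤ E := by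
    calc _ ≤ l * (l⁻¹ ^ q * (l ^ (q - 1) * E)) := by gcongr
      _ = (l * (l⁻¹ ^ q * l ^ (q - 1))) * E := by ring
      _ = E := by rw [mul_inv_rpow_mul_rpow_sub_one hl0 hlt, one_mul]
  have hd2 : ∫⁻ γ, edist (γ 0) (γ 1) ∂π' ≤ l + E := by
    calc ∫⁻ γ, edist (γ 0) (γ 1) ∂π' ≤ ∫⁻ γ, (l + l * (l⁻¹ ^ q * edist (γ 0) (γ 1) ^ q)) ∂π' := by
          refine lintegral_mono fun γ => ?_
          have := le_one_add_rpow hq (l⁻¹ * edist (γ 0) (γ 1))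
          rw [ENNReal.mul_rpow_of_nonneg _ _ (zero_le_one.trans hq.le)] at this
          calc edist (γ 0) (γ 1) = l * (l⁻¹ * edist (γ 0) (γ 1)) := by
                rw [← mul_assoc, ENNReal.mul_inv_cancel hl0 hlt, one_mul]
            _ ≤ l * (1 + l⁻¹ ^ q * edist (γ 0) (γ 1) ^ q) := by gcongr
            _ = _ := by ring
      _ = l + l * (l⁻¹ ^ q * ∫⁻ γ, edist (γ 0) (γ 1) ^ q ∂π') := by
          rw [lintegral_add_left measurable_const, lintegral_const, measure_univ, mul_one,
            lintegral_const_mul _ (hmd.const_mul _), lintegral_const_mul _ hmd]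
      _ ≤ l + E := by gcongr
  -- the length of the curves of the test plan
  have hV : ∫⁻ γ, (∫⁻ r in Icc s t, speed γ r) ∂π ≤ l + E := by
    calc _ ≤ ∫⁻ γ, (l + ∫⁻ r in Icc s t, speed γ r ^ q) ∂π := by
          refine lintegral_mono fun γ => ?_
          calc ∫⁻ r in Icc s t, speed γ r ≤ ∫⁻ r in Icc s t, (1 + speed γ r ^ q) :=
                lintegral_mono fun r => le_one_add_rpow hq _
            _ = _ := by
                rw [lintegral_add_left measurable_const, setLIntegral_one,
                  volume_Icc_unitInterval]
      _ = l + E := by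
          rw [lintegral_add_left measurable_const, lintegral_const, measure_univ, mul_one]
  -- the values of the upper gradient along the geodesic plan
  have hA₁ : ∀ r : I, ∫⁻ γ, g (γ r) ∂π' ≤ (∫⁻ γ, φ (γ s) ∂π) + n * (l + E) + M * ε := by
    intro r
    refine (lintegral_eval_le hφm hem h1 he r (hmap r)).trans ?_
    gcongr
    calc ∫⁻ γ, φ (γ r) ∂π' ≤ ∫⁻ γ, (φ (γ 0) + n * edist (γ 0) (γ 1)) ∂π' := by
          refine lintegral_mono_ae ?_
          filter_upwards [hopt.geodesic] with γ hγ
          refine (hφ (γ r) (γ 0)).trans ?_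
          gcongr
          exact hγ.edist_le r
      _ = (∫⁻ γ, φ (γ 0) ∂π') + n * ∫⁻ γ, edist (γ 0) (γ 1) ∂π' := by
          rw [lintegral_add_left (hφr 0),
            lintegral_const_mul _ ((measurable_eval_at 0).edist (measurable_eval_at 1))]
      _ ≤ _ := by
          refine add_le_add (le_of_eq ?_) (mul_le_mul' le_rfl hd2)
          rw [← lintegral_map hφm (measurable_eval_at 0), hopt.map_zero,
            lintegral_map hφm (measurable_eval_at s)]
  -- The value of φ at time s is replaced by its average over the step along π, at the cost of the
  -- Lipschitz constant n times the mean length.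
  have hA₂ : l * ∫⁻ γ, φ (γ s) ∂π ≤
      (∫⁻ γ, (∫⁻ r in Icc s t, g (γ r)) ∂π) + (c * ε + n * (l + E)) * l := by
    have hgu : Measurable (Function.uncurry fun (γ : Curve X) (r : I) => g (γ r)) :=
      hgm.comp measurable_eval
    rw [lintegral_lintegral_swap hgu.aemeasurable]
    have hl2 : volume (Icc s t) = l := volume_Icc_unitInterval s t
    calc l * ∫⁻ γ, φ (γ s) ∂π = ∫⁻ _ in Icc s t, (∫⁻ γ, φ (γ s) ∂π) := by
          rw [setLIntegral_const, hl2, mul_comm]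
      _ ≤ ∫⁻ r in Icc s t, ((∫⁻ γ, g (γ r) ∂π) + (c * ε + n * (l + E))) := by
          refine setLIntegral_mono' measurableSet_Icc fun r hr => ?_
          calc ∫⁻ γ, φ (γ s) ∂π ≤ ∫⁻ γ, (φ (γ r) + n * ∫⁻ r in Icc s t, speed γ r) ∂π := by
                refine lintegral_mono_ae ?_
                filter_upwards [hac] with γ hγ
                refine (hφ (γ s) (γ r)).trans ?_
                gcongr
                exact (hγ s r hr.1).trans (lintegral_mono_set (Icc_subset_Icc le_rfl hr.2))
            _ = (∫⁻ γ, φ (γ r) ∂π) + n * ∫⁻ γ, (∫⁻ r in Icc s t, speed γ r) ∂π := by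
                rw [lintegral_add_left (hφr r),
                  lintegral_const_mul _ measurable_speed.lintegral_prod_right']
            _ ≤ ((∫⁻ γ, g (γ r) ∂π) + c * ε) + n * (l + E) := by
                gcongr
                exact lintegral_eval_le hgm hem h2 he r (hc' r)
            _ = _ := by ring
      _ = _ := by
          rw [lintegral_add_right _ measurable_const, setLIntegral_const, hl2]
  have hgrad : ∫⁻ γ, (∫⁻ r, gradAlong G γ r) ∂π' ≤
      κ₁ * ((∫⁻ γ, (∫⁻ r in Icc s t, g (γ r)) ∂π) + ((c + M) * ε) * l + 2 * n * l * (l + E)) +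
        κ₂ * E := by
    calc ∫⁻ γ, (∫⁻ r, gradAlong G γ r) ∂π'
        ≤ ∫⁻ γ, (∫⁻ r, l * (κ₁ * g (γ r) + κ₂ * (l⁻¹ ^ q * edist (γ 0) (γ 1) ^ q))) ∂π' := by
          refine lintegral_mono_ae ?_
          filter_upwards [hopt.geodesic] with γ hγ
          refine lintegral_mono fun r => ?_
          exact (mul_le_mul' le_rfl (hγ.speed_le r)).trans
            (young_scaled hpq hΛ hΛ' hl0 hlt _ _)
      _ = l * (κ₁ * (∫⁻ γ, (∫⁻ r, g (γ r)) ∂π') +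
          κ₂ * (l⁻¹ ^ q * ∫⁻ γ, edist (γ 0) (γ 1) ^ q ∂π')) := by
          have hgγ : ∀ γ : Curve X, Measurable fun r => g (γ r) := fun γ =>
            hgm.comp γ.continuous.measurable
          have hgi : Measurable fun γ : Curve X => ∫⁻ r, g (γ r) :=
            (hgm.comp measurable_eval).lintegral_prod_right'
          have e1 : ∀ γ : Curve X,
              ∫⁻ r, l * (κ₁ * g (γ r) + κ₂ * (l⁻¹ ^ q * edist (γ 0) (γ 1) ^ q)) =
              l * (κ₁ * (∫⁻ r, g (γ r)) + κ₂ * (l⁻¹ ^ q * edist (γ 0) (γ 1) ^ q)) := by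
            intro γ
            rw [lintegral_const_mul _ (((hgγ γ).const_mul _).add_const _),
              lintegral_add_right _ measurable_const, lintegral_const_mul _ (hgγ γ),
              lintegral_const, measure_univ, mul_one]
          simp only [e1]
          have hsum : Measurable fun γ : Curve X => κ₁ * (∫⁻ r, g (γ r)) +
              κ₂ * (l⁻¹ ^ q * edist (γ 0) (γ 1) ^ q) :=
            (hgi.const_mul _).add ((hmd.const_mul _).const_mul _)
          rw [lintegral_const_mul _ hsum,
            lintegral_add_left (hgi.const_mul _), lintegral_const_mul _ hgi,
            lintegral_const_mul _ (hmd.const_mul _), lintegral_const_mul _ hmd]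
      _ = κ₁ * (l * ∫⁻ γ, (∫⁻ r, g (γ r)) ∂π') +
          κ₂ * (l * (l⁻¹ ^ q * ∫⁻ γ, edist (γ 0) (γ 1) ^ q ∂π')) := by ring
      _ ≤ κ₁ * (l * ((∫⁻ γ, φ (γ s) ∂π) + n * (l + E) + M * ε)) + κ₂ * E := by
          have hgu : Measurable (Function.uncurry fun (γ : Curve X) (r : I) => g (γ r)) :=
            hgm.comp measurable_eval
          rw [lintegral_lintegral_swap hgu.aemeasurable]
          gcongr
          calc ∫⁻ r, (∫⁻ γ, g (γ r) ∂π')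
              ≤ ∫⁻ _ : I, ((∫⁻ γ, φ (γ s) ∂π) + n * (l + E) + M * ε) := lintegral_mono hA₁
            _ = _ := by rw [lintegral_const, measure_univ, mul_one]
      _ = κ₁ * (l * (∫⁻ γ, φ (γ s) ∂π) + (n * (l + E) + M * ε) * l) + κ₂ * E := by ring
      _ ≤ κ₁ * (((∫⁻ γ, (∫⁻ r in Icc s t, g (γ r)) ∂π) + (c * ε + n * (l + E)) * l) +
          (n * (l + E) + M * ε) * l) + κ₂ * E := by gcongr
      _ = _ := by ring
  calc ∫⁻ γ, F (γ t) ∂π = ∫⁻ γ, F (γ 1) ∂π' := by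
        rw [← lintegral_map hF (measurable_eval_at t), ← hopt.map_one,
          lintegral_map hF (measurable_eval_at 1)]
    _ ≤ ∫⁻ γ, (F (γ 0) + ENNReal.ofReal |f (γ 1) - f (γ 0)|) ∂π' :=
        lintegral_mono fun γ => hFf _ _
    _ = (∫⁻ γ, F (γ 0) ∂π') + ∫⁻ γ, ENNReal.ofReal |f (γ 1) - f (γ 0)| ∂π' :=
        lintegral_add_left (hF.comp (measurable_eval_at 0)) _
    _ ≤ (∫⁻ γ, F (γ s) ∂π) + ∫⁻ γ, (∫⁻ r, gradAlong G γ r) ∂π' := by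
        refine add_le_add (le_of_eq ?_) (hG π' hgeod)
        rw [← lintegral_map hF (measurable_eval_at 0), hopt.map_zero,
          lintegral_map hF (measurable_eval_at s)]
    _ ≤ _ := by
        refine add_le_add le_rfl (hgrad.trans ?_)
        -- One factor l of the quadratic error 2nl(l + E) is bounded by δ; what remains is additive
        -- over adjacent intervals, so the errors can be summed.
        gcongr
        exact ENNReal.ofReal_le_ofReal hδ

end Interpolation

end BIPSpaces

end

noncomputable section

namespace BIPSpaces

set_option linter.unusedSectionVars false

variable {X : Type*} [MetricSpace X] [MeasurableSpace X] [BorelSpace X]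
  [SecondCountableTopology X] {m : Measure X} {p q : ℝ} {f G : X → ℝ} {C : ℝ → ℝ}

/-! ### Geodesic plans detect weak upper gradients -/

section GeodesicPlans

variable {π : Measure (Curve X)}

lemma le_of_forall_le_add_mul_ofReal {a b D : ℝ≥0∞} (hD : D ≠ ∞)
    (h : ∀ δ : ℝ, 0 < δ → a ≤ b + D * ENNReal.ofReal δ) : a ≤ b := by
  have h1 : Tendsto (fun δ : ℝ => b + D * ENNReal.ofReal δ) (𝓝[>] 0)
      (𝓝 (b + D * ENNReal.ofReal 0)) := by
    refine tendsto_const_nhds.add (ENNReal.Tendsto.const_mul ?_ (Or.inr hD))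
    exact (ENNReal.continuous_ofReal.tendsto 0).mono_left nhdsWithin_le_nhds
  rw [ENNReal.ofReal_zero, mul_zero, add_zero] at h1
  refine ge_of_tendsto h1 ?_
  filter_upwards [self_mem_nhdsWithin] with δ hδ using h δ hδ

/-- The integrand that Young's inequality with weight `Λ` gives in place of `G(γ_t) |γ̇_t|`. -/
def youngAlong (p q : ℝ) (Λ : ℝ≥0∞) (G : X → ℝ) (γ : Curve X) (t : I) : ℝ≥0∞ :=
  Λ ^ p / ENNReal.ofReal p * ENNReal.ofReal (G (γ t)) ^ p +
    Λ⁻¹ ^ q / ENNReal.ofReal q * speed γ t ^ q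

lemma measurable_youngAlong (hGm : Measurable G) (Λ : ℝ≥0∞) :
    Measurable (Function.uncurry (youngAlong p q Λ G)) := by
  have h1 : Measurable fun z : Curve X × I => ENNReal.ofReal (G (z.1 z.2)) ^ p :=
    ((ENNReal.measurable_ofReal.comp hGm).pow_const p).comp measurable_eval
  exact (h1.const_mul _).add ((measurable_speed.pow_const q).const_mul _)

lemma lintegral_youngAlong (hGm : Measurable G) (Λ : ℝ≥0∞) (γ : Curve X) (s : Set I) :
    ∫⁻ r in s, youngAlong p q Λ G γ r =
      Λ ^ p / ENNReal.ofReal p * (∫⁻ r in s, ENNReal.ofReal (G (γ r)) ^ p) +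
        Λ⁻¹ ^ q / ENNReal.ofReal q * ∫⁻ r in s, speed γ r ^ q := by
  have h1 : Measurable fun r : I => ENNReal.ofReal (G (γ r)) ^ p :=
    ((ENNReal.measurable_ofReal.comp hGm).pow_const p).comp γ.continuous.measurable
  have h2 := (measurable_speed_curve γ).pow_const q
  simp only [youngAlong]
  rw [lintegral_add_left (h1.const_mul _), lintegral_const_mul _ h1, lintegral_const_mul _ h2]

lemma rpow_div_ofReal_ne_top {Λ : ℝ≥0∞} (hΛ : Λ ≠ ∞) (hp : 0 < p) :
    Λ ^ p / ENNReal.ofReal p ≠ ∞ :=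
  ENNReal.div_ne_top (ENNReal.rpow_ne_top_of_nonneg hp.le hΛ) (by simpa using hp)

/-- The one-step estimates are telescoped. F is a function of one point, so the integrals of F(γ_t)
depend only on marginals and consecutive steps match. -/
lemma lintegral_eval_le_add_youngAlong (hfin : BoundedlyFinite m) [SigmaFinite m]
    (hpq : p.HolderConjugate q) (hC : HasBIPProfile m q C)
    {x₀ : X} {R : ℝ} (hR : 0 ≤ R) (hGm : Measurable G) (hGp : MemLp G (ENNReal.ofReal p) m)
    (hG : ∀ π : Measure (Curve X), InGeod m q C π → PlanInequality π f G)
    {F : X → ℝ≥0∞} (hF : Measurable F) (hFf : ∀ x y, F x ≤ F y + ENNReal.ofReal |f x - f y|)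
    (hπ : IsTestPlan m q π) (hball : ∀ᵐ γ ∂π, ∀ t : I, γ t ∈ Metric.closedBall x₀ R)
    {Λ : ℝ≥0∞} (hΛ : Λ ≠ 0) (hΛ' : Λ ≠ ∞) {s t : I} (hst : s ≤ t) :
    ∫⁻ γ, F (γ t) ∂π ≤ ∫⁻ γ, (F (γ s) + ∫⁻ r in Icc s t, youngAlong p q Λ G γ r) ∂π := by
  have hprob := hπ.isProbabilityMeasure
  obtain ⟨c, hc⟩ := hπ.compression
  have hq : 1 < q := hpq.symm.lt
  have hac := hπ.ae_edist_le hq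
  have hgm : Measurable fun x => ENNReal.ofReal (G x) ^ p :=
    (ENNReal.measurable_ofReal.comp hGm).pow_const p
  have hg1 := measurable_lintegral_Icc_eval hgm s t
  have hv1 : Measurable fun γ : Curve X => ∫⁻ r in Icc s t, speed γ r ^ q :=
    measurable_lintegral_Icc_speed q s t
  have hFs : Measurable fun γ : Curve X => F (γ s) := hF.comp (measurable_eval_at s)
  simp only [lintegral_youngAlong hGm]
  rw [lintegral_add_left hFs, lintegral_add_left (hg1.const_mul _), lintegral_const_mul _ hg1,
    lintegral_const_mul _ hv1]
  have hκ : Λ ^ p / ENNReal.ofReal p ≠ ∞ := rpow_div_ofReal_ne_top hΛ' hpq.pos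
  set κ₁ := Λ ^ p / ENNReal.ofReal p with hκ₁
  set κ₂ := Λ⁻¹ ^ q / ENNReal.ofReal q with hκ₂
  set A : I → I → ℝ≥0∞ := fun s t => ∫⁻ γ, (∫⁻ r in Icc s t, ENNReal.ofReal (G (γ r)) ^ p) ∂π
    with hA
  set E : I → I → ℝ≥0∞ := fun s t => ∫⁻ γ, (∫⁻ r in Icc s t, speed γ r ^ q) ∂π with hE
  have hA_add : ∀ s r t, s ≤ r → r ≤ t → A s r + A r t = A s t := by
    intro s r t hsr hrt
    simp only [hA]
    rw [← lintegral_add_left (measurable_lintegral_Icc_eval hgm s r)]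
    exact lintegral_congr fun γ => setLIntegral_Icc_add_Icc hsr hrt _
  have hE_add : ∀ s r t, s ≤ r → r ≤ t → E s r + E r t = E s t := by
    intro s r t hsr hrt
    simp only [hE]
    rw [← lintegral_add_left (measurable_lintegral_Icc_speed q s r)]
    exact lintegral_congr fun γ => setLIntegral_Icc_add_Icc hsr hrt _
  have hl_add : ∀ s r t : I, s ≤ r → r ≤ t → ENNReal.ofReal ((r : ℝ) - s) +
      ENNReal.ofReal ((t : ℝ) - r) = ENNReal.ofReal ((t : ℝ) - s) := by
    intro s r t hsr hrt
    rw [← ENNReal.ofReal_add (sub_nonneg.2 hsr) (sub_nonneg.2 hrt)]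
    congr 1
    ring
  have hEt : E s t ≠ ∞ := by
    refine ne_top_of_le_ne_top hπ.lintegral_speed_lt_top.ne (lintegral_mono fun γ => ?_)
    exact setLIntegral_le_lintegral _ _
  set K : ℝ≥0∞ := c + ENNReal.ofReal (C (2 * R + 1)) * c with hK
  have hKt : K ≠ ∞ := by
    rw [hK]
    exact ENNReal.add_ne_top.2
      ⟨ENNReal.coe_ne_top, ENNReal.mul_ne_top ENNReal.ofReal_ne_top ENNReal.coe_ne_top⟩
  change ∫⁻ γ, F (γ t) ∂π ≤ (∫⁻ γ, F (γ s) ∂π) + (κ₁ * A s t + κ₂ * E s t)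
  refine le_of_forall_le_add_mul_ofReal (D := κ₁ * (K * ENNReal.ofReal ((t : ℝ) - s)))
    (ENNReal.mul_ne_top hκ (ENNReal.mul_ne_top hKt ENNReal.ofReal_ne_top)) fun ε hε => ?_
  obtain ⟨φ, e, n, hφm, hem, hφ, h1, h2, he⟩ := exists_lipschitz_approx hfin hgm
    (lintegral_ofReal_rpow_lt_top hpq.pos hGp).ne (ε := ENNReal.ofReal ε) (by simpa using hε)
  -- The Lipschitz constant n depends on ε and may blow up as ε → 0, so the step size δ is sent to
  -- zero first, with ε fixed.
  refine le_of_forall_le_add_mul_ofReal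
    (D := κ₁ * (2 * n * (ENNReal.ofReal ((t : ℝ) - s) + E s t))) ?_ fun δ hδ => ?_
  · refine ENNReal.mul_ne_top hκ (ENNReal.mul_ne_top ?_ ?_)
    · exact ENNReal.mul_ne_top ENNReal.ofNat_ne_top (ENNReal.natCast_ne_top n)
    · exact ENNReal.add_ne_top.2 ⟨ENNReal.ofReal_ne_top, hEt⟩
  have key := le_add_of_short_steps (Ψ := fun t => ∫⁻ γ, F (γ t) ∂π)
    (Φ := fun s t => κ₁ * (A s t + (K * ENNReal.ofReal ε) * ENNReal.ofReal ((t : ℝ) - s) +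
        2 * n * ENNReal.ofReal δ * (ENNReal.ofReal ((t : ℝ) - s) + E s t)) + κ₂ * E s t)
    (fun s r t hsr hrt => by
      simp only [← hA_add s r t hsr hrt, ← hE_add s r t hsr hrt, ← hl_add s r t hsr hrt]
      ring) hδ
    (fun s t hst hδ => interpolation_step hpq hC hR hGm hG hF hFf hc hac hball hΛ hΛ' hφm hem hφ
      h1 h2 he hst hδ) s t hst
  refine key.trans (le_of_eq ?_)
  ring

lemma setLIntegral_eval_le_add_youngAlong (hfin : BoundedlyFinite m) [SigmaFinite m]
    (hpq : p.HolderConjugate q) (hC : HasBIPProfile m q C)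
    {x₀ : X} {R : ℝ} (hR : 0 ≤ R) (hGm : Measurable G) (hGp : MemLp G (ENNReal.ofReal p) m)
    (hG : ∀ π : Measure (Curve X), InGeod m q C π → PlanInequality π f G)
    {F : X → ℝ≥0∞} (hF : Measurable F) (hFf : ∀ x y, F x ≤ F y + ENNReal.ofReal |f x - f y|)
    (hπ : IsTestPlan m q π) {Γ : Set (Curve X)} (hΓ : MeasurableSet Γ)
    (hball : ∀ γ ∈ Γ, ∀ t : I, γ t ∈ Metric.closedBall x₀ R)
    {Λ : ℝ≥0∞} (hΛ : Λ ≠ 0) (hΛ' : Λ ≠ ∞) {s t : I} (hst : s ≤ t) :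
    ∫⁻ γ in Γ, F (γ t) ∂π ≤
      ∫⁻ γ in Γ, (F (γ s) + ∫⁻ r in Icc s t, youngAlong p q Λ G γ r) ∂π := by
  have hprob := hπ.isProbabilityMeasure
  by_cases h0 : π Γ = 0
  · rw [Measure.restrict_eq_zero.2 h0, lintegral_zero_measure]
    exact bot_le
  have h1 := lintegral_eval_le_add_youngAlong hfin hpq hC hR hGm hGp hG hF hFf (hπ.restrict h0)
    (Measure.ae_smul_measure ((ae_restrict_iff' hΓ).2 (Eventually.of_forall hball)) _)
    hΛ hΛ' hst
  rw [lintegral_smul_measure, lintegral_smul_measure, smul_eq_mul, smul_eq_mul] at h1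
  exact (ENNReal.mul_le_mul_iff_right (ENNReal.inv_ne_zero.2 (measure_ne_top π Γ))
    (ENNReal.inv_ne_top.2 h0)).1 h1

/-- Taking F to be the positive part of f + K avoids any integrability of f. Conditioning on
arbitrary sets of curves inside a ball makes the estimate pointwise, and K is finally chosen so that
f(γ_s) + K ≥ 0. -/
lemma ae_ofReal_sub_le_youngAlong (hfin : BoundedlyFinite m) [SigmaFinite m]
    (hpq : p.HolderConjugate q) (hC : HasBIPProfile m q C) (x₀ : X)
    (hf : Measurable f) (hGm : Measurable G) (hGp : MemLp G (ENNReal.ofReal p) m)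
    (hG : ∀ π : Measure (Curve X), InGeod m q C π → PlanInequality π f G)
    (hπ : IsTestPlan m q π)
    {Λ : ℝ≥0∞} (hΛ : Λ ≠ 0) (hΛ' : Λ ≠ ∞) {s t : I} (hst : s ≤ t) :
    ∀ᵐ γ ∂π, ENNReal.ofReal (f (γ t) - f (γ s)) ≤ ∫⁻ r in Icc s t, youngAlong p q Λ G γ r := by
  have hprob := hπ.isProbabilityMeasure
  let B : ℕ → Set (Curve X) := fun R => {γ | ∀ t : I, γ t ∈ Metric.closedBall x₀ (R : ℝ)}
  have hB : ∀ R, MeasurableSet (B R) := by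
    intro R
    refine IsClosed.measurableSet ?_
    simp only [B, ofPred_forall]
    exact isClosed_iInter fun t =>
      Metric.isClosed_closedBall.preimage (continuous_eval_const t)
  have hFm : ∀ K : ℕ, Measurable fun x => ENNReal.ofReal (f x + K) := fun K =>
    ENNReal.measurable_ofReal.comp (hf.add_const _)
  have key : ∀ R K : ℕ, ∀ᵐ γ ∂π, γ ∈ B R → ENNReal.ofReal (f (γ t) + K) ≤
      ENNReal.ofReal (f (γ s) + K) + ∫⁻ r in Icc s t, youngAlong p q Λ G γ r := by
    intro R K
    rw [← ae_restrict_iff' (hB R)]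
    refine ae_le_of_forall_setLIntegral_le_of_sigmaFinite
      ((hFm K).comp (measurable_eval_at t)) fun Γ hΓ _ => ?_
    rw [Measure.restrict_restrict hΓ]
    refine setLIntegral_eval_le_add_youngAlong (F := fun x => ENNReal.ofReal (f x + K)) hfin hpq hC
      (Nat.cast_nonneg R) hGm hGp hG (hFm K) (fun x y => ?_) hπ (hΓ.inter (hB R))
      (fun γ hγ => hγ.2) hΛ hΛ' hst
    refine le_trans (ENNReal.ofReal_le_ofReal ?_) ENNReal.ofReal_add_le
    linarith [le_abs_self (f x - f y)]
  filter_upwards [ae_all_iff.2 fun R => ae_all_iff.2 (key R)] with γ hγ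
  obtain ⟨R, hR⟩ : ∃ R : ℕ, γ ∈ B R := by
    obtain ⟨r, hr⟩ := (isCompact_range γ.continuous).isBounded.subset_closedBall x₀
    obtain ⟨n, hn⟩ := exists_nat_ge r
    exact ⟨n, fun t => Metric.closedBall_subset_closedBall hn (hr (mem_range_self t))⟩
  obtain ⟨K, hK⟩ := exists_nat_ge (-f (γ s))
  rcases le_total (f (γ t)) (f (γ s)) with hle | hle
  · rw [ENNReal.ofReal_of_nonpos (sub_nonpos.2 hle)]
    exact bot_le
  have h1 := hγ R K hR
  rw [show f (γ t) + K = (f (γ s) + K) + (f (γ t) - f (γ s)) by ring,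
    ENNReal.ofReal_add (by linarith) (sub_nonneg.2 hle)] at h1
  exact (ENNReal.add_le_add_iff_left ENNReal.ofReal_ne_top).1 h1

lemma ae_ofReal_abs_sub_le_youngAlong (hfin : BoundedlyFinite m) [SigmaFinite m]
    (hpq : p.HolderConjugate q) (hC : HasBIPProfile m q C) (x₀ : X)
    (hf : Measurable f) (hGm : Measurable G) (hGp : MemLp G (ENNReal.ofReal p) m)
    (hG : ∀ π : Measure (Curve X), InGeod m q C π → PlanInequality π f G)
    (hπ : IsTestPlan m q π)
    {Λ : ℝ≥0∞} (hΛ : Λ ≠ 0) (hΛ' : Λ ≠ ∞) {s t : I} (hst : s ≤ t) :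
    ∀ᵐ γ ∂π, ENNReal.ofReal |f (γ t) - f (γ s)| ≤ ∫⁻ r in Icc s t, youngAlong p q Λ G γ r := by
  -- The preceding estimate is one-sided; the other sign comes from -f.
  have hG' : ∀ π : Measure (Curve X), InGeod m q C π → PlanInequality π (-f) G := by
    intro π h
    refine le_trans (le_of_eq (lintegral_congr fun γ => ?_)) (hG π h)
    simp only [Pi.neg_apply]
    rw [← abs_neg]
    congr 2
    ring
  filter_upwards [ae_ofReal_sub_le_youngAlong hfin hpq hC x₀ hf hGm hGp hG hπ hΛ hΛ' hst,
    ae_ofReal_sub_le_youngAlong hfin hpq hC x₀ hf.neg hGm hGp hG' hπ hΛ hΛ' hst] with γ h1 h2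
  rcases abs_cases (f (γ t) - f (γ s)) with h | h
  · rwa [h.1]
  · rw [h.1]
    refine le_trans (le_of_eq ?_) h2
    simp only [Pi.neg_apply]
    congr 1
    ring

lemma exists_rat_young_lt (hpq : p.HolderConjugate q) {a b c : ℝ} (ha : 0 ≤ a) (hb : 0 ≤ b)
    (hc : a * b < c) :
    ∃ l : ℚ, 0 < l ∧ (l : ℝ) ^ p / p * a ^ p + (l : ℝ)⁻¹ ^ q / q * b ^ q < c := by
  -- The shift by τ makes both factors positive, so that the optimal Young weight exists even when a
  -- or b is zero.
  obtain ⟨τ, hτ, hτc⟩ : ∃ τ : ℝ, 0 < τ ∧ (a + τ) * (b + τ) < c := by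
    have h1 : Tendsto (fun τ : ℝ => (a + τ) * (b + τ)) (𝓝[>] 0) (𝓝 ((a + 0) * (b + 0))) := by
      refine Tendsto.mono_left ?_ nhdsWithin_le_nhds
      exact Continuous.tendsto (by fun_prop) 0
    rw [add_zero, add_zero] at h1
    obtain ⟨τ, h2, h3⟩ := ((h1.eventually (gt_mem_nhds hc)).and self_mem_nhdsWithin).exists
    exact ⟨τ, h3, h2⟩
  have ha' : 0 < a + τ := by linarith
  have hb' : 0 < b + τ := by linarith
  have hp := hpq.pos
  have hq := hpq.symm.pos
  -- This weight is the equality case: both Young terms become (a + τ)(b + τ), divided by p and by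
  -- q.
  set l₀ : ℝ := (a + τ) ^ (-1 / q) * (b + τ) ^ (1 / p) with hl₀
  have hl₀pos : 0 < l₀ := mul_pos (Real.rpow_pos_of_pos ha' _) (Real.rpow_pos_of_pos hb' _)
  have hsum : 1 / p + 1 / q = 1 := by
    simpa only [one_div] using hpq.inv_add_inv_eq_one
  have e1 : l₀ ^ p * (a + τ) ^ p = (a + τ) * (b + τ) := by
    rw [hl₀, Real.mul_rpow (Real.rpow_nonneg ha'.le _) (Real.rpow_nonneg hb'.le _),
      ← Real.rpow_mul ha'.le, ← Real.rpow_mul hb'.le, one_div_mul_cancel hp.ne', Real.rpow_one,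
      mul_right_comm, ← Real.rpow_add ha']
    have : -1 / q * p + p = 1 := by
      have : -1 / q = 1 / p - 1 := by rw [neg_div]; linarith
      rw [this]
      field_simp
      ring
    rw [this, Real.rpow_one]
  have e2 : l₀⁻¹ ^ q * (b + τ) ^ q = (a + τ) * (b + τ) := by
    rw [hl₀, mul_inv, ← Real.rpow_neg ha'.le, ← Real.rpow_neg hb'.le,
      Real.mul_rpow (Real.rpow_nonneg ha'.le _) (Real.rpow_nonneg hb'.le _),
      ← Real.rpow_mul ha'.le, ← Real.rpow_mul hb'.le, mul_assoc, ← Real.rpow_add hb']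
    have h1 : -(-1 / q) * q = 1 := by field_simp
    have h2 : -(1 / p) * q + q = 1 := by
      have : 1 / p = 1 - 1 / q := by linarith
      rw [this]
      field_simp
      ring
    rw [h1, h2, Real.rpow_one, Real.rpow_one]
  have hlt : l₀ ^ p / p * a ^ p + l₀⁻¹ ^ q / q * b ^ q < c := by
    refine lt_of_le_of_lt ?_ hτc
    calc l₀ ^ p / p * a ^ p + l₀⁻¹ ^ q / q * b ^ q
        ≤ l₀ ^ p / p * (a + τ) ^ p + l₀⁻¹ ^ q / q * (b + τ) ^ q := by
          gcongr <;> linarith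
      _ = (1 / p) * (l₀ ^ p * (a + τ) ^ p) + (1 / q) * (l₀⁻¹ ^ q * (b + τ) ^ q) := by ring
      _ = (1 / p + 1 / q) * ((a + τ) * (b + τ)) := by rw [e1, e2]; ring
      _ = (a + τ) * (b + τ) := by rw [hsum, one_mul]
  have hcont : ContinuousAt (fun l : ℝ => l ^ p / p * a ^ p + l⁻¹ ^ q / q * b ^ q) l₀ := by
    refine ContinuousAt.add ?_ ?_
    · exact ((continuousAt_id.rpow_const (Or.inl hl₀pos.ne')).div_const _).mul_const _
    · exact (((continuousAt_inv₀ hl₀pos.ne').rpow_const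
        (Or.inl (inv_pos.2 hl₀pos).ne')).div_const _).mul_const _
  have hev := (hcont.eventually (gt_mem_nhds hlt)).and (lt_mem_nhds hl₀pos)
  obtain ⟨U, hU, hUo, hUl⟩ := mem_nhds_iff.1 hev
  obtain ⟨l, hl⟩ := Rat.denseRange_cast.exists_mem_open hUo ⟨l₀, hUl⟩
  exact ⟨l, by exact_mod_cast (hU hl).2, (hU hl).1⟩

/-- Optimizing the weight at each time recovers G|γ̇|. Rational weights suffice by continuity, and
being countable they share one null set of curves. -/
lemma iInf_youngAlong_le (hpq : p.HolderConjugate q) {γ : Curve X} {t : I}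
    (ht : speed γ t < ∞) :
    ⨅ l : {l : ℚ // 0 < l}, youngAlong p q (ENNReal.ofReal (l : ℚ)) G γ t ≤ gradAlong G γ t := by
  have hp := hpq.pos
  have hq := hpq.symm.pos
  obtain ⟨b, hb⟩ : ∃ b : ℝ≥0, speed γ t = b := ⟨_, (ENNReal.coe_toNNReal ht.ne).symm⟩
  have hb' : (b : ℝ≥0∞) = ENNReal.ofReal b := by simp
  obtain ⟨a, ha, haG⟩ : ∃ a : ℝ, 0 ≤ a ∧ ENNReal.ofReal (G (γ t)) = ENNReal.ofReal a :=
    ⟨max (G (γ t)) 0, le_max_right _ _, by simp⟩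
  simp only [youngAlong, gradAlong, hb, haG, hb']
  rw [← ENNReal.ofReal_mul ha]
  refine ENNReal.le_of_forall_pos_le_add fun ε hε _ => ?_
  obtain ⟨l, hl, hlt⟩ := exists_rat_young_lt hpq ha b.coe_nonneg (lt_add_of_pos_right (a * b) hε)
  have hl' : (0 : ℝ) < l := by exact_mod_cast hl
  refine (iInf_le _ ⟨l, hl⟩).trans ?_
  have e : ((ε : ℝ≥0) : ℝ≥0∞) = ENNReal.ofReal ε := by simp
  rw [e, ← ENNReal.ofReal_add (mul_nonneg ha b.coe_nonneg) ε.coe_nonneg]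
  refine le_trans (le_of_eq ?_) (ENNReal.ofReal_le_ofReal hlt.le)
  simp only
  rw [← ENNReal.ofReal_inv_of_pos hl', ENNReal.ofReal_rpow_of_pos hl',
    ENNReal.ofReal_rpow_of_pos (inv_pos.2 hl'), ENNReal.ofReal_rpow_of_nonneg ha hp.le,
    ENNReal.ofReal_rpow_of_nonneg b.coe_nonneg hq.le, ← ENNReal.ofReal_div_of_pos hp,
    ← ENNReal.ofReal_div_of_pos hq, ← ENNReal.ofReal_mul (by positivity),
    ← ENNReal.ofReal_mul (by positivity), ← ENNReal.ofReal_add (by positivity) (by positivity)]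

lemma IsTestPlan.ae_lintegral_youngAlong_ne_top (hpq : p.HolderConjugate q)
    (h : IsTestPlan m q π) (hGm : Measurable G) (hG : MemLp G (ENNReal.ofReal p) m) {Λ : ℝ≥0∞}
    (hΛ : Λ ≠ 0) (hΛ' : Λ ≠ ∞) : ∀ᵐ γ ∂π, ∫⁻ t, youngAlong p q Λ G γ t ≠ ∞ := by
  have hprob := h.isProbabilityMeasure
  obtain ⟨c, hc⟩ := h.compression
  have hφ : Measurable fun x => ENNReal.ofReal (G x) ^ p :=
    (ENNReal.measurable_ofReal.comp hGm).pow_const p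
  have h1 := (lintegral_lintegral_eval_le hc hφ).trans_lt
    (ENNReal.mul_lt_top ENNReal.coe_lt_top (lintegral_ofReal_rpow_lt_top hpq.pos hG))
  have hm : Measurable (fun γ : Curve X => ∫⁻ t, ENNReal.ofReal (G (γ t)) ^ p) :=
    (hφ.comp measurable_eval).lintegral_prod_right'
  filter_upwards [ae_lt_top hm h1.ne, h.ae_lintegral_speed_lt_top] with γ h2 h3
  have := lintegral_youngAlong (p := p) (q := q) hGm Λ γ univ
  simp only [Measure.restrict_univ] at this
  rw [this]
  exact ENNReal.add_ne_top.2 ⟨ENNReal.mul_ne_top (rpow_div_ofReal_ne_top hΛ' hpq.pos) h2.ne,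
    ENNReal.mul_ne_top (rpow_div_ofReal_ne_top (ENNReal.inv_ne_top.2 hΛ) hpq.symm.pos) h3.ne⟩

/-- On a space with a profile function for the conjugate exponent, it is enough to test weak upper
gradients along the plans of `Geod_q`. -/
lemma HasBIPProfile.isWeakUpperGradient (hfin : BoundedlyFinite m) (x₀ : X) (hp : 1 < p)
    (hC : HasBIPProfile m p.conjExponent C) (hf : Measurable f) (h0 : 0 ≤ᵐ[m] G)
    (hGp : MemLp G (ENNReal.ofReal p) m)
    (hG : ∀ π : Measure (Curve X), InGeod m p.conjExponent C π → PlanInequality π f G) :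
    IsWeakUpperGradient m p f G := by
  have := sigmaFinite_of_boundedlyFinite hfin
  have hpq := Real.HolderConjugate.conjExponent hp
  have hq : 1 < p.conjExponent := hpq.symm.lt
  set G' := hGp.1.mk G
  have hGG' : G =ᵐ[m] G' := hGp.1.ae_eq_mk
  have hG'm : Measurable G' := hGp.1.stronglyMeasurable_mk.measurable
  have hG'p := hGp.ae_eq hGG'
  have hG' : ∀ π : Measure (Curve X), InGeod m p.conjExponent C π → PlanInequality π f G' :=
    fun π h => (h.isTestPlan (zero_le_one.trans hq.le)).planInequality_congr hGG' (hG π h)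
  refine ⟨h0, hGp, fun π hπ => ?_⟩
  have hprob := hπ.isProbabilityMeasure
  refine hπ.planInequality_congr hGG'.symm (planInequality_of_ae_hasCurveBound ?_)
  have key : ∀ l : {l : ℚ // 0 < l}, ∀ᵐ γ ∂π, HasCurveBound (fun t => f (γ t))
      (youngAlong p p.conjExponent (ENNReal.ofReal (l : ℚ)) G' γ) := by
    intro l
    have hl : ENNReal.ofReal (l : ℚ) ≠ 0 := by
      have : (0 : ℝ) < ((l : ℚ) : ℝ) := by exact_mod_cast l.2
      simpa using this
    exact ae_hasCurveBound hf (measurable_youngAlong hG'm _)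
      (hπ.ae_lintegral_youngAlong_ne_top hpq hG'm hG'p hl ENNReal.ofReal_ne_top)
      fun s t hst => ae_ofReal_abs_sub_le_youngAlong hfin hpq hC x₀ hf hG'm hG'p hG' hπ hl
        ENNReal.ofReal_ne_top hst
  have : Nonempty {l : ℚ // 0 < l} := ⟨⟨1, one_pos⟩⟩
  filter_upwards [ae_all_iff.2 key, hπ.ae_ae_speed_lt_top hq] with γ h1 h2
  refine (HasCurveBound.iInf h1).mono_ae ?_
  filter_upwards [h2] with t ht using iInf_youngAlong_le hpq ht

end GeodesicPlans

/-! ### Independence of the exponent on BIP-spaces -/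

section BIP

/-- Plans of Geod for the second exponent are test plans for the first, so the p₁-gradient satisfies
(∗) on them and is a p₂-gradient as soon as it is in L^{p₂}. -/
lemma IsBIPSpace.sobolevUpgrade (hX : IsBIPSpace m) (hfin : BoundedlyFinite m) (x₀ : X) :
    SobolevUpgrade m := by
  intro p₁ p₂ hp₁ hp₂ f hf hfp hG
  have hq₁ : 1 < p₁.conjExponent := (Real.HolderConjugate.conjExponent hp₁).symm.lt
  obtain ⟨C, hC⟩ := hX _ (Real.HolderConjugate.conjExponent hp₂).symm.lt
  have hmin := isWeakUpperGradient_minGrad hp₁ hf.1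
  exact ⟨⟨hf.1.1, _, hC.isWeakUpperGradient hfin x₀ hp₂ hf.1.1 hmin.nonneg hG fun π hπ =>
    hmin.le π (hπ.isTestPlan (zero_le_one.trans hq₁.le))⟩, hfp⟩

/-- Both gradients bound f along almost every curve of a plan in Geod, hence so does their minimum.
It lies in L^{p₁}, so it is a p₁-gradient, and minimality gives the inequality. -/
lemma IsBIPSpace.minGrad_le_minGrad (hX : IsBIPSpace m) (hfin : BoundedlyFinite m) (x₀ : X)
    {p₁ p₂ : ℝ} (hp₁ : 1 < p₁) (hp₂ : 1 < p₂) (h₁ : InSobolevClass m p₁ f)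
    (h₂ : InSobolevClass m p₂ f) : minGrad m p₁ f ≤ᵐ[m] minGrad m p₂ f := by
  have hq₁ : 1 < p₁.conjExponent := (Real.HolderConjugate.conjExponent hp₁).symm.lt
  have hq₂ : 1 < p₂.conjExponent := (Real.HolderConjugate.conjExponent hp₂).symm.lt
  have hG₁ := isWeakUpperGradient_minGrad hp₁ h₁
  have hG₂ := isWeakUpperGradient_minGrad hp₂ h₂
  obtain ⟨C, hC⟩ := hX _ hq₁
  set G : X → ℝ := fun x => min (minGrad m p₁ f x) (minGrad m p₂ f x) with hGdef
  have h0 : 0 ≤ᵐ[m] G := by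
    filter_upwards [hG₁.nonneg, hG₂.nonneg] with x a b using le_min a b
  have hG : IsWeakUpperGradient m p₁ f G := by
    refine hC.isWeakUpperGradient hfin x₀ hp₁ h₁.1 h0 ?_ fun π hπ => ?_
    · refine hG₁.memLp.of_le
        (hG₁.memLp.1.aemeasurable.min hG₂.memLp.1.aemeasurable).aestronglyMeasurable ?_
      filter_upwards [h0, hG₁.nonneg] with x a b
      rw [Real.norm_of_nonneg a, Real.norm_of_nonneg b]
      exact min_le_left _ _
    · refine planInequality_of_ae_hasCurveBound ?_
      filter_upwards [hG₁.ae_hasCurveBound hp₁ h₁.1 (hπ.isTestPlan (zero_le_one.trans hq₁.le)),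
        hG₂.ae_hasCurveBound hp₂ h₁.1 (hπ.isTestPlan (zero_le_one.trans hq₂.le))] with γ a b
      refine a.of_eq_on b (Eventually.of_forall fun t ht => absurd rfl ht)
        (Eventually.of_forall fun t _ => ?_)
      simp only [gradAlong, hGdef]
      rcases le_total (minGrad m p₁ f (γ t)) (minGrad m p₂ f (γ t)) with h | h
      · rw [min_eq_left h]
        exact min_le_left _ _
      · rw [min_eq_right h]
        exact min_le_right _ _
  filter_upwards [minGrad_le hp₁ h₁.1 hG] with x hx using hx.trans (min_le_right _ _)

lemma IsBIPSpace.gradientsAgree (hX : IsBIPSpace m) (hfin : BoundedlyFinite m) (x₀ : X) :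
    GradientsAgree m := by
  intro p₁ p₂ hp₁ hp₂ f h₁ h₂
  filter_upwards [hX.minGrad_le_minGrad hfin x₀ hp₁ hp₂ h₁.1 h₂.1,
    hX.minGrad_le_minGrad hfin x₀ hp₂ hp₁ h₂.1 h₁.1] with x a b using le_antisymm a b

end BIP

end BIPSpaces

end

theorem mainTheorem1 {X : Type*} [MetricSpace X] [CompleteSpace X]
    [TopologicalSpace.SeparableSpace X] [MeasurableSpace X] [BorelSpace X]
    (m : Measure X) (hm : m ≠ 0) (hfin : BoundedlyFinite m) :
    -- `p`-independence on BIP-spaces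
    (IsBIPSpace m → ∀ p₁ p₂ : ℝ, 1 < p₁ → 1 < p₂ → ∀ f : X → ℝ,
      InSobolevClassLoc m p₁ f → MemLpLoc m p₂ (localGrad m p₁ f) →
        InSobolevClassLoc m p₂ f ∧ localGrad m p₁ f =ᵐ[m] localGrad m p₂ f) ∧
    -- on BIP-spaces the plans of `Geod_q` detect weak upper gradients
    (IsBIPSpace m → ∀ p : ℝ, 1 < p → ∀ C : ℝ → ℝ, HasBIPProfile m p.conjExponent C →
      ∀ f G : X → ℝ, Measurable f → 0 ≤ᵐ[m] G → MemLp G (ENNReal.ofReal p) m →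
        ((InSobolevClass m p f ∧ IsWeakUpperGradient m p f G) ↔
          ∀ π : Measure (Curve X), InGeod m p.conjExponent C π → PlanInequality π f G)) ∧
    -- relation with `p`-independence in the strong sense, without BIP
    (LocalPIndependence m ↔ GradientsAgree m ∧ SobolevUpgrade m) ∧
    (StrongPIndependence m ↔ DenseIntersections m ∧ LocalPIndependence m) := by
  have : SecondCountableTopology X := UniformSpace.secondCountable_of_separable X
  obtain ⟨x₀⟩ : Nonempty X := by
    by_contra h
    rw [not_nonempty_iff] at h
    exact hm m.eq_zero_of_isEmpty
  refine ⟨fun hX => localPIndependence_of_gradientsAgree x₀ hfin (hX.gradientsAgree hfin x₀)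
    (hX.sobolevUpgrade hfin x₀), fun _ p hp C hC f G hf h0 hG => ⟨fun h π hπ => ?_, fun h => ?_⟩,
    localPIndependence_iff x₀ hfin, ?_⟩
  · exact h.2.le π (hπ.isTestPlan
      (zero_le_one.trans (Real.HolderConjugate.conjExponent hp).symm.lt.le))
  · have := hC.isWeakUpperGradient hfin x₀ hp hf h0 hG h
    exact ⟨⟨hf, G, this⟩, this⟩
  · rw [localPIndependence_iff x₀ hfin]
    rfl
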